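/- Let $N$ be a positive integer and $m$ a real number with $N\ge m>1$; put $\phi_m(x)=|x|^{m-2}x$ for $x\ne0$ and $\phi_m(0)=0$. For $f:\mathbb R\to\mathbb R$ write $F(s)=\int_0^s f(t)\,dt$ and $Q(s)=mNF(s)-(N-m)sf(s)$. Assume: $(f_1)$ $f\in C(\mathbb R)$. $(f_2)$ (i) There are $\beta^-<0<\beta^+$ with $F(s)<0$ for all $s\in(\beta^-,\beta^+)\setminus\{0\}$, $F(\beta^\pm)=0$, $f(\beta^+)>0$, $f(\beta^-)<0$, $f(s)>0$ for $s\in(\beta^+,\gamma^+)$ and $f(s)<0$ for $s\in(\gamma^-,\beta^-)$, where $\gamma^+=\min\{s>\beta^+: f(s)=0\}$, with $\gamma^+=\infty$ if $f$ has no zero in $(\beta^+,\infty)$, and $\gamma^-=\max\{s<\beta^-: f(s)=0\}$, with $\gamma^-=-\infty$ if $f$ has no zero in $(-\infty,\beta^-)$. (ii) $\lim_{s\to\gamma^-}F(s)=L=\lim_{s\to\gamma^+}F(s)$ for a common $L$, finite or infinite (limits taken from inside $(\gamma^-,\gamma^+)$). (iii) $f$ is locally Lipschitz in $(\gamma^-,0)\cup(0,\gamma^+)$.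 $(f_3)$ (a) If $\gamma^+=\infty$: there is $\bar\beta>\beta^+$ with $Q(s)\ge0$ for all $s\ge\bar\beta$, and there is $\theta\in(0,1)$ with $$\lim_{s\to\infty}\ \inf_{s_1,s_2\in[\theta s,s]}Q(s_2)\Bigl(\frac{|s|^{m-2}s}{f(s_1)}\Bigr)^{N/m}=\infty .$$ (b) If $\gamma^-=-\infty$: there is $\bar\beta$ with $-\bar\beta<\beta^-$ and $Q(s)\ge0$ for all $s\le-\bar\beta$, and there is $\theta\in(0,1)$ with $$\lim_{s\to-\infty}\ \inf_{s_1,s_2\in[s,\theta s]}Q(s_2)\Bigl(\frac{|s|^{m-2}s}{f(s_1)}\Bigr)^{N/m}=\infty .$$ $(f_4)$ (a) If $\gamma^+<\infty$: there are $L_0>0$ and $\bar\beta\in(\beta^+,\gamma^+)$ with $f(s)\le L_0(\gamma^+-s)^{m-1}$ for all $s\in[\bar\beta,\gamma^+)$. (b) If $\gamma^->-\infty$: there are $L_0>0$ and $\bar\beta$ with $\gamma^-<-\bar\beta<\beta^-$ and $-f(s)\le L_0(s-\gamma^-)^{m-1}$ for all $s\in(\gamma^-,-\bar\beta]$. Then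 for every integer $k\ge0$ there is a bound state with exactly $k$ zeros, that is, a nonconstant $C^1$ function $u:[0,\infty)\to\mathbb R$ with $\phi_m(u')$ also of class $C^1$ on $[0,\infty)$, such that $$(\phi_m(u'))'+\frac{N-1}{r}\phi_m(u')+f(u)=0\quad(r>0),\qquad u'(0)=0,\qquad \lim_{r\to\infty}u(r)=0,$$ and such that, for some $R\in(0,\infty]$, $u$ has exactly $k$ zeros in $(0,R)$, all of them simple ($u'\neq0$ there), and $u\equiv0$ on $[R,\infty)$. (When $u$ does not vanish identically near infinity, $R=\infty$ and $u$ has exactly $k$ zeros in $(0,\infty)$.) -/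

import Mathlib

open Set Filter Topology

noncomputable section

namespace RadialBoundState

/-- The function `φ_m(x) = |x|^(m-2) x`, with `φ_m(0) = 0`. -/
def phi (m x : ℝ) : ℝ := |x| ^ (m - 2) * x

/-- The primitive `F(s) = ∫₀ˢ f(t) dt`. -/
def primitive (f : ℝ → ℝ) (s : ℝ) : ℝ := ∫ t in (0 : ℝ)..s, f t

/-- The function `Q(s) = m N F(s) - (N - m) s f(s)`. -/
def pohozaevQ (N : ℕ) (m : ℝ) (f : ℝ → ℝ) (s : ℝ) : ℝ :=
  m * N * primitive f s - (N - m) * s * f s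

/-- `γ⁺`: the smallest zero of `f` beyond `β⁺`, and `+∞` if there is none. -/
def gammaPlus (f : ℝ → ℝ) (βp : ℝ) : EReal :=
  sInf ((fun s : ℝ => (s : EReal)) '' {s : ℝ | βp < s ∧ f s = 0})

/-- `γ⁻`: the largest zero of `f` below `β⁻`, and `-∞` if there is none. -/
def gammaMinus (f : ℝ → ℝ) (βm : ℝ) : EReal :=
  sSup ((fun s : ℝ => (s : EReal)) '' {s : ℝ | s < βm ∧ f s = 0})

/-- The sign structure of `f` and of its primitive, the equality of the limits of the primitive at
the two ends `γ⁻`, `γ⁺`, and the local Lipschitz condition away from `0`. -/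
structure SignCondition (f : ℝ → ℝ) (βm βp : ℝ) : Prop where
  betaMinus_neg : βm < 0
  betaPlus_pos : 0 < βp
  primitive_neg : ∀ s ∈ Ioo βm βp, s ≠ 0 → primitive f s < 0
  primitive_betaMinus : primitive f βm = 0
  primitive_betaPlus : primitive f βp = 0
  betaMinus_nondegenerate : f βm < 0
  betaPlus_nondegenerate : 0 < f βp
  pos_right : ∀ s : ℝ, βp < s → (s : EReal) < gammaPlus f βp → 0 < f s
  neg_left : ∀ s : ℝ, gammaMinus f βm < (s : EReal) → s < βm → f s < 0
  /-- `F(s) → L` as `s → γ⁻` and as `s → γ⁺`, with the same finite or infinite `L`. -/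
  equal_limits : ∃ L : EReal,
    Tendsto (fun s : ℝ => (primitive f s : EReal))
      (comap (fun s : ℝ => (s : EReal)) (𝓝[>] (gammaMinus f βm))) (𝓝 L) ∧
    Tendsto (fun s : ℝ => (primitive f s : EReal))
      (comap (fun s : ℝ => (s : EReal)) (𝓝[<] (gammaPlus f βp))) (𝓝 L)
  locallyLipschitz : LocallyLipschitzOn
    {s : ℝ | gammaMinus f βm < (s : EReal) ∧ (s : EReal) < gammaPlus f βp ∧ s ≠ 0} f

/-- The condition on `Q` near an infinite end `γ⁺ = ∞` or `γ⁻ = -∞`. -/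
structure GrowthAtInfinity (N : ℕ) (m : ℝ) (f : ℝ → ℝ) (βm βp : ℝ) : Prop where
  plus_nonneg : gammaPlus f βp = ⊤ →
    ∃ b : ℝ, βp < b ∧ ∀ s : ℝ, b ≤ s → 0 ≤ pohozaevQ N m f s
  plus_limit : gammaPlus f βp = ⊤ →
    ∃ θ ∈ Ioo (0 : ℝ) 1, Tendsto
      (fun s : ℝ => sInf ((fun p : ℝ × ℝ =>
          pohozaevQ N m f p.2 * (phi m s / f p.1) ^ ((N : ℝ) / m)) ''
        (Icc (θ * s) s ×ˢ Icc (θ * s) s)))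
      atTop atTop
  minus_nonneg : gammaMinus f βm = ⊥ →
    ∃ b : ℝ, -b < βm ∧ ∀ s : ℝ, s ≤ -b → 0 ≤ pohozaevQ N m f s
  minus_limit : gammaMinus f βm = ⊥ →
    ∃ θ ∈ Ioo (0 : ℝ) 1, Tendsto
      (fun s : ℝ => sInf ((fun p : ℝ × ℝ =>
          pohozaevQ N m f p.2 * (phi m s / f p.1) ^ ((N : ℝ) / m)) ''
        (Icc s (θ * s) ×ˢ Icc s (θ * s))))
      atBot atTop

/-- The growth bound near a finite end `γ⁺` or `γ⁻`. -/
structure BoundAtFiniteEnd (m : ℝ) (f : ℝ → ℝ) (βm βp : ℝ) : Prop where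
  plus : ∀ g : ℝ, gammaPlus f βp = (g : EReal) →
    ∃ L₀ > (0 : ℝ), ∃ b : ℝ, βp < b ∧ b < g ∧
      ∀ s ∈ Ico b g, f s ≤ L₀ * (g - s) ^ (m - 1)
  minus : ∀ g : ℝ, gammaMinus f βm = (g : EReal) →
    ∃ L₀ > (0 : ℝ), ∃ b : ℝ, -βm < b ∧ g < -b ∧
      ∀ s ∈ Ioc g (-b), -f s ≤ L₀ * (s - g) ^ (m - 1)

/-- The derivative on `[0, ∞)`: one-sided at `0`, the usual one at `r > 0`. -/
def radialDeriv (u : ℝ → ℝ) (r : ℝ) : ℝ := derivWithin u (Ici 0) r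

/-- The function `φ_m(u')` on `[0, ∞)`. -/
def flux (m : ℝ) (u : ℝ → ℝ) (r : ℝ) : ℝ := phi m (radialDeriv u r)

/-- `u` (only its values on `[0, ∞)` matter) is a bound state: a nonconstant solution, with `u` and
`φ_m(u')` of class `C¹` on `[0, ∞)`, of
`(φ_m(u'))' + (N-1)/r φ_m(u') + f(u) = 0` for `r > 0`, `u'(0) = 0`, `u(r) → 0` as `r → ∞`. -/
structure IsBoundState (N : ℕ) (m : ℝ) (f u : ℝ → ℝ) : Prop where
  contDiffOn : ContDiffOn ℝ 1 u (Ici 0)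
  flux_contDiffOn : ContDiffOn ℝ 1 (flux m u) (Ici 0)
  equation : ∀ r : ℝ, 0 < r →
    radialDeriv (flux m u) r + ((N : ℝ) - 1) / r * flux m u r + f (u r) = 0
  deriv_zero : radialDeriv u 0 = 0
  tendsto_zero : Tendsto u atTop (𝓝 0)
  nonconstant : ∃ r ≥ (0 : ℝ), ∃ s ≥ (0 : ℝ), u r ≠ u s

/-- `u` has exactly `k` zeros in `(0, ∞)`, where the interval `[R, ∞)` on which `u` may be
identically zero (if `u` has bounded support) is not counted; all `k` zeros are simple.
For `R = ∞` these are all the zeros of `u` in `(0, ∞)`. -/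
def HasExactlyZeros (k : ℕ) (u : ℝ → ℝ) : Prop :=
  ∃ R : EReal, 0 < R ∧ (∀ r : ℝ, R ≤ (r : EReal) → u r = 0) ∧
    {r : ℝ | 0 < r ∧ (r : EReal) < R ∧ u r = 0}.Finite ∧
    {r : ℝ | 0 < r ∧ (r : EReal) < R ∧ u r = 0}.ncard = k ∧
    ∀ r : ℝ, 0 < r → (r : EReal) < R → u r = 0 → radialDeriv u r ≠ 0

end RadialBoundState

end

/-! Put d = N - 1, q = m/(m-1) and w = φ_m(u'). The equation becomes the system u' = φ_q(w), w' =
-(d/r) w - f(u), and the energy I = |w|^q/q + F(u) satisfies I' = -(d/r)|w|^q ≤ 0. Hence a solution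
starting at height a stays in the interval [b, a] with F(b) = F(a), and f may be frozen outside it.

The solution with given u(0) need not be unique, so the shooting is done in regularized problems
(`Scheme`): φ_q and f are replaced by Lipschitz functions and d/r by d/(r+η). Starting from βp/2 the
energy is negative and there is no zero; starting from a suitable a there are k+1 zeros with sign
changes. Hence there are two arbitrarily close initial heights, one whose solution has k+1 sign
changes and one whose solution has not. By continuous dependence both solutions converge, along an
ultrafilter, to one solution u of the original problem (`Truncated.exists_shooting_limit`).

Before its first double zero R (possibly R = ∞), u has at most k zeros, since k+1 simple zeros would
produce sign changes in the approximations that lack them. So the zero number k+1 of the other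
approximations escapes past every point before R, and this makes I ≥ 0 there. The first k zeros do
not escape: a solution near 0 with r I(r) small lacks the energy to leave a neighbourhood of 0 where
F < 0 (`IsSol.trapped`), and in that neighbourhood it cannot leave 0 and come back with I ≥ 0
(`IsSol.eq_zero_between_zeros`). Thus u has exactly k zeros before R. If R is finite, u is continued
by 0. If not, I tends to 0, because at large r a solution with energy bounded below oscillates
(`exists_many_zeros`), and then u tends to 0.

It remains to find a height a from which solutions oscillate. It suffices that the energy is still
above a reference level at a time M that depends only on that level and on k (`Shape.exists_time`).
Near a finite end γ this follows from a Gronwall estimate, as the solution leaves γ slowly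
(`IsGlobalSol.lt_of_close`). If both ends are infinite it follows from the Pohozaev identity and the
growth condition on Q (`Shape.exists_hasBoundState_of_infinite`). -/

namespace RadialBoundState

/-! ### Powers φ_q, primitives and odd reflection. -/

theorem phi_neg (q x : ℝ) : phi q (-x) = -phi q x := by simp [phi]

theorem phi_zero (q : ℝ) : phi q 0 = 0 := by simp [phi]

theorem phi_of_nonneg {q x : ℝ} (hq : 1 < q) (hx : 0 ≤ x) : phi q x = x ^ (q - 1) := by
  rcases hx.eq_or_lt with rfl | h
  · rw [phi_zero, Real.zero_rpow (by linarith)]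
  · rw [phi, abs_of_pos h, ← Real.rpow_add_one h.ne']
    congr 1; ring

theorem phi_eq_max {q : ℝ} (hq : 1 < q) (x : ℝ) :
    phi q x = (max x 0) ^ (q - 1) - (max (-x) 0) ^ (q - 1) := by
  have h0 : (0 : ℝ) ^ (q - 1) = 0 := Real.zero_rpow (by linarith)
  rcases le_total 0 x with h | h
  · rw [phi_of_nonneg hq h, max_eq_left h, max_eq_right (by linarith), h0, sub_zero]
  · rw [max_eq_right h, max_eq_left (by linarith), h0, ← phi_of_nonneg hq (by linarith), phi_neg]
    ring

theorem continuous_phi {q : ℝ} (hq : 1 < q) : Continuous (phi q) := by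
  have : phi q = fun x => (max x 0) ^ (q - 1) - (max (-x) 0) ^ (q - 1) := funext (phi_eq_max hq)
  rw [this]
  refine Continuous.sub ?_ ?_
  · exact (continuous_id.max continuous_const).rpow_const fun _ => Or.inr (by linarith)
  · exact (continuous_neg.max continuous_const).rpow_const fun _ => Or.inr (by linarith)

theorem monotone_phi {q : ℝ} (hq : 1 < q) : Monotone (phi q) := by
  intro x y h
  rw [phi_eq_max hq, phi_eq_max hq]
  have h1 : (max x 0) ^ (q - 1) ≤ (max y 0) ^ (q - 1) :=
    Real.rpow_le_rpow (le_max_right _ _) (max_le_max_right _ h) (by linarith)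
  have h2 : (max (-y) 0) ^ (q - 1) ≤ (max (-x) 0) ^ (q - 1) :=
    Real.rpow_le_rpow (le_max_right _ _) (max_le_max_right _ (neg_le_neg h)) (by linarith)
  linarith

theorem mul_phi {q : ℝ} (hq : 1 < q) (x : ℝ) : x * phi q x = |x| ^ q := by
  have key : ∀ y : ℝ, 0 ≤ y → y * phi q y = |y| ^ q := by
    intro y hy
    rw [phi_of_nonneg hq hy, abs_of_nonneg hy]
    rcases hy.eq_or_lt with rfl | h
    · rw [zero_mul, Real.zero_rpow (by linarith)]
    · rw [mul_comm, ← Real.rpow_add_one h.ne']; congr 1; ring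
  rcases le_total 0 x with h | h
  · exact key x h
  · have := key (-x) (by linarith)
    rwa [phi_neg, abs_neg, neg_mul_neg] at this

theorem mul_phi_nonneg {q : ℝ} (hq : 1 < q) (x : ℝ) : 0 ≤ x * phi q x := by
  rw [mul_phi hq]; positivity

theorem abs_phi {q : ℝ} (hq : 1 < q) (x : ℝ) : |phi q x| = |x| ^ (q - 1) := by
  rcases le_total 0 x with h | h
  · rw [phi_of_nonneg hq h, abs_of_nonneg h, abs_of_nonneg (Real.rpow_nonneg h _)]
  · rw [← abs_neg, ← phi_neg, phi_of_nonneg hq (by linarith), abs_of_nonpos h,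
      abs_of_nonneg (Real.rpow_nonneg (by linarith) _)]

theorem phi_pos {q x : ℝ} (hq : 1 < q) (hx : 0 < x) : 0 < phi q x := by
  rw [phi_of_nonneg hq hx.le]; exact Real.rpow_pos_of_pos hx _

theorem phi_eq_zero_iff {q x : ℝ} (hq : 1 < q) : phi q x = 0 ↔ x = 0 := by
  refine ⟨fun h => ?_, fun h => by rw [h, phi_zero]⟩
  have := abs_phi hq x
  rw [h, abs_zero, eq_comm, Real.rpow_eq_zero (abs_nonneg _) (by linarith)] at this
  exact abs_eq_zero.1 this

theorem one_lt_conj {m : ℝ} (hm : 1 < m) : 1 < m / (m - 1) := by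
  rw [lt_div_iff₀ (by linarith)]; linarith

/-- The exponents satisfy (q-1)(m-1) = 1 for q = m/(m-1). This inverse is what recovers u' from the
flux w = φ_m(u'). -/
theorem phi_phi_conj {m : ℝ} (hm : 1 < m) (x : ℝ) : phi m (phi (m / (m - 1)) x) = x := by
  have hq := one_lt_conj hm
  have key : ∀ y : ℝ, 0 ≤ y → phi m (phi (m / (m - 1)) y) = y := by
    intro y hy
    rw [phi_of_nonneg hq hy, phi_of_nonneg hm (Real.rpow_nonneg hy _), ← Real.rpow_mul hy]
    have : (m / (m - 1) - 1) * (m - 1) = 1 := by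
      have : m - 1 ≠ 0 := by linarith
      field_simp; ring
    rw [this, Real.rpow_one]
  rcases le_total 0 x with h | h
  · exact key x h
  · have := key (-x) (by linarith)
    rw [phi_neg, phi_neg] at this
    linarith

theorem hasDerivAt_primitive {f : ℝ → ℝ} (hf : Continuous f) (s : ℝ) :
    HasDerivAt (primitive f) (f s) s :=
  intervalIntegral.integral_hasDerivAt_right (hf.intervalIntegrable _ _)
    (hf.stronglyMeasurableAtFilter _ _) hf.continuousAt

theorem continuous_primitive {f : ℝ → ℝ} (hf : Continuous f) : Continuous (primitive f) :=
  continuous_iff_continuousAt.2 fun s => (hasDerivAt_primitive hf s).continuousAt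

theorem primitive_zero (f : ℝ → ℝ) : primitive f 0 = 0 := by simp [primitive]

theorem primitive_phi {q : ℝ} (hq : 1 < q) (x : ℝ) : primitive (phi q) x = |x| ^ q / q := by
  have h : ∀ y ∈ uIcc (0 : ℝ) x, HasDerivAt (fun y : ℝ => |y| ^ q / q) (phi q y) y := by
    intro y _
    have := (hasDerivAt_abs_rpow y hq).div_const q
    refine this.congr_deriv ?_
    rw [phi]; field_simp
  rw [primitive, intervalIntegral.integral_eq_sub_of_hasDerivAt h
    ((continuous_phi hq).intervalIntegrable _ _)]
  simp [Real.zero_rpow (show q ≠ 0 by linarith)]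

/-- The odd reflection of a function. -/
def reflect (f : ℝ → ℝ) (s : ℝ) : ℝ := -f (-s)

theorem reflect_reflect (f : ℝ → ℝ) : reflect (reflect f) = f := by
  funext s; simp [reflect]

theorem reflect_phi (q : ℝ) : reflect (phi q) = phi q := by
  funext s; simp [reflect, phi_neg]

theorem continuous_reflect {f : ℝ → ℝ} (hf : Continuous f) : Continuous (reflect f) :=
  (hf.comp continuous_neg).neg

theorem primitive_reflect (f : ℝ → ℝ) (s : ℝ) : primitive (reflect f) s = primitive f (-s) := by
  simp only [primitive, reflect, intervalIntegral.integral_neg]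
  rw [intervalIntegral.integral_comp_neg, intervalIntegral.integral_symm]
  simp

/-- For a monotone `ψ` with `ψ 0 = 0`, the primitive is nonnegative and at most `x ψ(x)`. -/
theorem primitive_nonneg_le_mul {ψ : ℝ → ℝ} (hψ : Monotone ψ) (hc : Continuous ψ) (h0 : ψ 0 = 0)
    (x : ℝ) : 0 ≤ primitive ψ x ∧ primitive ψ x ≤ x * ψ x := by
  have key : ∀ g : ℝ → ℝ, Monotone g → Continuous g → g 0 = 0 → ∀ y : ℝ, 0 ≤ y →
      0 ≤ primitive g y ∧ primitive g y ≤ y * g y := by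
    intro g hg hgc hg0 y hy
    constructor
    · exact intervalIntegral.integral_nonneg hy fun t ht => hg0 ▸ hg ht.1
    · have := intervalIntegral.integral_mono_on hy (hgc.intervalIntegrable _ _)
        (continuous_const.intervalIntegrable (μ := MeasureTheory.volume) 0 y)
        (fun t ht => hg ht.2 : ∀ t ∈ Icc 0 y, g t ≤ g y)
      simpa [primitive] using this
  rcases le_total 0 x with h | h
  · exact key ψ hψ hc h0 x h
  · have := key (reflect ψ) (fun a b hab => neg_le_neg (hψ (neg_le_neg hab)))
      (continuous_reflect hc) (by simp [reflect, h0]) (-x) (by linarith)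
    rw [primitive_reflect] at this
    simpa [reflect] using this

/-! ### The first order system and its energy. -/

/-- The first order form `u' = ψ(w)`, `w' = -d/(r+η) w - f(u)` of the radial equation on `[0, T]`,
with `w(0) = 0`. -/
structure IsSol (d : ℕ) (η : ℝ) (ψ f : ℝ → ℝ) (T : ℝ) (u w : ℝ → ℝ) : Prop where
  contu : ContinuousOn u (Icc 0 T)
  contw : ContinuousOn w (Icc 0 T)
  du : ∀ r ∈ Ioo 0 T, HasDerivAt u (ψ (w r)) r
  dw : ∀ r ∈ Ioo 0 T, HasDerivAt w (-((d : ℝ) / (r + η) * w r) - f (u r)) r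
  w0 : w 0 = 0

/-- The energy of a solution. -/
noncomputable def energy (ψ f u w : ℝ → ℝ) (r : ℝ) : ℝ := primitive ψ (w r) + primitive f (u r)

variable {d : ℕ} {η T : ℝ} {ψ f u w : ℝ → ℝ}

theorem energy_reflect (ψ f u w : ℝ → ℝ) :
    energy (reflect ψ) (reflect f) (-u) (-w) = energy ψ f u w := by
  funext r; simp [energy, primitive_reflect]

theorem energy_eq_of_zero {r : ℝ} (h : u r = 0) : energy ψ f u w r = primitive ψ (w r) := by
  simp [energy, h, primitive_zero]

namespace IsSol

theorem mono {T' : ℝ} (h : IsSol d η ψ f T u w) (hT : T' ≤ T) : IsSol d η ψ f T' u w :=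
  ⟨h.contu.mono (Icc_subset_Icc_right hT), h.contw.mono (Icc_subset_Icc_right hT),
    fun r hr => h.du r ⟨hr.1, hr.2.trans_le hT⟩, fun r hr => h.dw r ⟨hr.1, hr.2.trans_le hT⟩, h.w0⟩

theorem reflect (h : IsSol d η ψ f T u w) :
    IsSol d η (reflect ψ) (reflect f) T (-u) (-w) where
  contu := h.contu.neg
  contw := h.contw.neg
  du r hr := by simpa [RadialBoundState.reflect] using (h.du r hr).neg
  dw r hr := (h.dw r hr).neg.congr_deriv (by simp [RadialBoundState.reflect]; ring)
  w0 := by simp [h.w0]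

theorem congr_f {g : ℝ → ℝ} (h : IsSol d η ψ f T u w) (hg : ∀ r ∈ Ioo 0 T, f (u r) = g (u r)) :
    IsSol d η ψ g T u w :=
  ⟨h.contu, h.contw, h.du, fun r hr => hg r hr ▸ h.dw r hr, h.w0⟩

theorem hasDerivAt_energy (h : IsSol d η ψ f T u w) (hψ : Continuous ψ) (hf : Continuous f)
    {r : ℝ} (hr : r ∈ Ioo 0 T) :
    HasDerivAt (energy ψ f u w) (-((d : ℝ) / (r + η) * (w r * ψ (w r)))) r := by
  have h1 := (hasDerivAt_primitive hψ (w r)).comp r (h.dw r hr)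
  have h2 := (hasDerivAt_primitive hf (u r)).comp r (h.du r hr)
  exact (h1.add h2).congr_deriv (by ring)

theorem continuousOn_energy (h : IsSol d η ψ f T u w) (hψ : Continuous ψ) (hf : Continuous f) :
    ContinuousOn (energy ψ f u w) (Icc 0 T) :=
  ((continuous_primitive hψ).comp_continuousOn h.contw).add
    ((continuous_primitive hf).comp_continuousOn h.contu)

/-- Damping is the only contribution to the derivative: the terms with f(u) ψ(w) cancel. -/
theorem antitoneOn_energy (h : IsSol d η ψ f T u w) (hψ : Continuous ψ) (hf : Continuous f)
    (hη : 0 ≤ η) (hpos : ∀ x, 0 ≤ x * ψ x) : AntitoneOn (energy ψ f u w) (Icc 0 T) := by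
  refine antitoneOn_of_hasDerivWithinAt_nonpos (convex_Icc 0 T) (h.continuousOn_energy hψ hf)
    (f' := fun r => -((d : ℝ) / (r + η) * (w r * ψ (w r)))) ?_ ?_
  · intro r hr
    rw [interior_Icc] at hr
    exact (h.hasDerivAt_energy hψ hf hr).hasDerivWithinAt
  · intro r hr
    rw [interior_Icc] at hr
    have := hr.1
    have := hpos (w r)
    have : 0 ≤ (d : ℝ) / (r + η) * (w r * ψ (w r)) := by positivity
    linarith

/-- The integrating factor (r+η)^d removes the damping term. -/
theorem hasDerivAt_weighted (h : IsSol d η ψ f T u w) (hη : 0 ≤ η) {r : ℝ} (hr : r ∈ Ioo 0 T) :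
    HasDerivAt (fun t => (t + η) ^ d * w t) (-((r + η) ^ d * f (u r))) r := by
  have hp : r + η ≠ 0 := by have := hr.1; positivity
  have h1 : HasDerivAt (fun t : ℝ => (t + η) ^ d) (d * (r + η) ^ (d - 1)) r := by
    simpa using ((hasDerivAt_id' r).fun_add (hasDerivAt_const r η)).fun_pow d
  refine (h1.mul (h.dw r hr)).congr_deriv ?_
  rcases d with _ | d
  · simp
  · simp only [Nat.add_sub_cancel]
    field_simp
    ring

/-- An upper bound for `f(u)` on `(0, r)` bounds `w(r)` from below. -/
theorem neg_mul_le (h : IsSol d η ψ f T u w) (hη : 0 ≤ η) {r C : ℝ} (hr : r ∈ Icc 0 T)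
    (hC : 0 ≤ C) (hf : ∀ t ∈ Ioo 0 r, f (u t) ≤ C) : -(C * r) ≤ w r := by
  rcases hr.1.eq_or_lt with rfl | hr0
  · simp [h.w0]
  have hp : 0 < (r + η) ^ d := by positivity
  have h' := h.mono hr.2
  have hmono : MonotoneOn (fun t => (t + η) ^ d * w t + C * (r + η) ^ d * t) (Icc 0 r) := by
    refine monotoneOn_of_hasDerivWithinAt_nonneg (convex_Icc 0 r)
      (f' := fun t => -((t + η) ^ d * f (u t)) + C * (r + η) ^ d) ?_ ?_ ?_
    · have := h'.contw
      fun_prop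
    · intro t ht
      rw [interior_Icc] at ht
      have := (h'.hasDerivAt_weighted hη ht).fun_add ((hasDerivAt_id' t).const_mul (C * (r + η) ^ d))
      simpa using this.hasDerivWithinAt
    · intro t ht
      rw [interior_Icc] at ht
      have h1 : (t + η) ^ d ≤ (r + η) ^ d := by
        have := ht.1; have := ht.2; gcongr
      have h2 : 0 ≤ (t + η) ^ d := by have := ht.1; positivity
      have := mul_le_mul_of_nonneg_left (hf t ht) h2
      have := mul_le_mul_of_nonneg_left h1 hC
      linarith
  have := hmono ⟨le_rfl, hr0.le⟩ ⟨hr0.le, le_rfl⟩ hr0.le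
  simp only [h.w0, mul_zero, add_zero] at this
  have h3 : 0 ≤ (r + η) ^ d * (w r + C * r) := by linarith
  have := nonneg_of_mul_nonneg_right h3 hp
  linarith

theorem abs_le_mul (h : IsSol d η ψ f T u w) (hη : 0 ≤ η) {r C : ℝ} (hr : r ∈ Icc 0 T)
    (hC : 0 ≤ C) (hf : ∀ t ∈ Ioo 0 r, |f (u t)| ≤ C) : |w r| ≤ C * r := by
  refine abs_le.2 ⟨h.neg_mul_le hη hr hC fun t ht => (abs_le.1 (hf t ht)).2, ?_⟩
  have := h.reflect.neg_mul_le hη hr hC fun t ht => by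
    simpa [RadialBoundState.reflect] using neg_le.1 (abs_le.1 (hf t ht)).1
  simpa using this

end IsSol

end RadialBoundState

/-! ### Lipschitz approximation of the nonlinearities. -/

namespace RadialBoundState

/-- The truncation of a real number to `[a, b]`. -/
def clamp (a b s : ℝ) : ℝ := max a (min s b)

theorem clamp_mem {a b : ℝ} (h : a ≤ b) (s : ℝ) : clamp a b s ∈ Icc a b :=
  ⟨le_max_left _ _, max_le h (min_le_right _ _)⟩

theorem clamp_of_mem {a b s : ℝ} (h : s ∈ Icc a b) : clamp a b s = s := by
  rw [clamp, min_eq_left h.2, max_eq_right h.1]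

theorem clamp_of_le {a b s : ℝ} (hab : a ≤ b) (h : s ≤ a) : clamp a b s = a := by
  rw [clamp, min_eq_left (h.trans hab), max_eq_left h]

theorem clamp_of_ge {a b s : ℝ} (hab : a ≤ b) (h : b ≤ s) : clamp a b s = b := by
  rw [clamp, min_eq_right h, max_eq_right hab]

theorem lipschitzWith_clamp (a b : ℝ) : LipschitzWith 1 (clamp a b) :=
  (LipschitzWith.id.min_const b).const_max a

theorem continuous_clamp (a b : ℝ) : Continuous (clamp a b) := (lipschitzWith_clamp a b).continuous

theorem monotone_clamp (a b : ℝ) : Monotone (clamp a b) := fun _ _ h =>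
  max_le_max_left _ (min_le_min_right _ h)

theorem uniformContinuous_comp_clamp {f : ℝ → ℝ} (hf : Continuous f) {a b : ℝ} (hab : a ≤ b) :
    UniformContinuous fun s => f (clamp a b s) := by
  have h1 : UniformContinuousOn f (Icc a b) :=
    isCompact_Icc.uniformContinuousOn_of_continuous hf.continuousOn
  rw [Metric.uniformContinuousOn_iff] at h1
  rw [Metric.uniformContinuous_iff]
  intro ε hε
  obtain ⟨δ, hδ, h⟩ := h1 ε hε
  refine ⟨δ, hδ, fun {x y} hxy => h _ (clamp_mem hab x) _ (clamp_mem hab y) ?_⟩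
  have := (lipschitzWith_clamp a b).dist_le_mul x y
  simp only [NNReal.coe_one, one_mul] at this
  linarith

theorem exists_bound_comp_clamp {f : ℝ → ℝ} (hf : Continuous f) {a b : ℝ} (hab : a ≤ b) :
    ∃ C > 0, ∀ s, |f (clamp a b s)| ≤ C := by
  obtain ⟨C, hC⟩ := isCompact_Icc.exists_bound_of_continuousOn (hf.continuousOn (s := Icc a b))
  refine ⟨max C 1, by positivity, fun s => (hC _ (clamp_mem hab s)).trans (le_max_left _ _)⟩

/-- The mean of `g` over `[s, s + τ]`. -/
noncomputable def mean (τ : ℝ) (g : ℝ → ℝ) (s : ℝ) : ℝ :=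
  (primitive g (s + τ) - primitive g s) / τ

section mean

variable {τ : ℝ} {g : ℝ → ℝ}

theorem exists_mean_eq (hτ : 0 < τ) (hg : Continuous g) (s : ℝ) :
    ∃ x ∈ Ioo s (s + τ), mean τ g s = g x := by
  obtain ⟨x, hx, h⟩ := exists_hasDerivAt_eq_slope (primitive g) g (by linarith : s < s + τ)
    (continuous_primitive hg).continuousOn fun x _ => hasDerivAt_primitive hg x
  refine ⟨x, hx, ?_⟩
  rw [h, mean]; congr 1; ring

theorem hasDerivAt_mean (hg : Continuous g) (s : ℝ) :
    HasDerivAt (mean τ g) ((g (s + τ) - g s) / τ) s := by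
  have h1 : HasDerivAt (fun s => primitive g (s + τ)) (g (s + τ)) s :=
    (hasDerivAt_primitive hg (s + τ)).comp_add_const s τ
  exact (h1.sub (hasDerivAt_primitive hg s)).div_const τ

theorem monotone_mean (hτ : 0 < τ) (hg : Continuous g) (hm : Monotone g) :
    Monotone (mean τ g) := by
  refine monotone_of_deriv_nonneg (fun s => (hasDerivAt_mean hg s).differentiableAt) fun s => ?_
  rw [(hasDerivAt_mean hg s).deriv]
  have := hm (by linarith : s ≤ s + τ)
  exact div_nonneg (by linarith) hτ.le

theorem exists_lipschitzWith_mean (hτ : 0 < τ) (hg : Continuous g) {C : ℝ}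
    (hC : ∀ s, |g s| ≤ C) : ∃ K, LipschitzWith K (mean τ g) := by
  refine ⟨Real.toNNReal (2 * C / τ), lipschitzWith_of_nnnorm_deriv_le
    (fun s => (hasDerivAt_mean hg s).differentiableAt) fun s => ?_⟩
  rw [(hasDerivAt_mean hg s).deriv, ← NNReal.coe_le_coe, coe_nnnorm, Real.norm_eq_abs, abs_div,
    abs_of_pos hτ]
  refine le_trans ?_ (Real.le_coe_toNNReal _)
  gcongr
  have := abs_sub (g (s + τ)) (g s)
  have := hC s
  have := hC (s + τ)
  linarith

theorem abs_mean_le (hτ : 0 < τ) (hg : Continuous g) {C : ℝ} (hC : ∀ s, |g s| ≤ C) (s : ℝ) :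
    |mean τ g s| ≤ C := by
  obtain ⟨x, _, h⟩ := exists_mean_eq hτ hg s
  rw [h]; exact hC x

theorem exists_mean_close (hg : UniformContinuous g) {ε : ℝ} (hε : 0 < ε) :
    ∃ δ > 0, ∀ τ, 0 < τ → τ ≤ δ → ∀ s, |mean τ g s - g s| ≤ ε := by
  obtain ⟨δ, hδ, h⟩ := Metric.uniformContinuous_iff.1 hg ε hε
  refine ⟨δ, hδ, fun τ hτ hτδ s => ?_⟩
  obtain ⟨x, hx, hxs⟩ := exists_mean_eq hτ hg.continuous s
  rw [hxs, ← Real.dist_eq]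
  refine (h ?_).le
  rw [Real.dist_eq, abs_lt]
  constructor <;> linarith [hx.1, hx.2]

end mean

/-- Monotone functions vanishing at `0` have bounded monotone Lipschitz approximations. -/
theorem exists_monotone_lipschitz_approx {ψ : ℝ → ℝ} (hψ : Continuous ψ) (hm : Monotone ψ)
    (h0 : ψ 0 = 0) {R ε : ℝ} (hR : 0 ≤ R) (hε : 0 < ε) :
    ∃ g : ℝ → ℝ, Monotone g ∧ g 0 = 0 ∧ (∃ K, LipschitzWith K g) ∧ (∃ C, ∀ x, |g x| ≤ C) ∧
      ∀ x, |x| ≤ R → |g x - ψ x| ≤ ε := by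
  have hab : -R ≤ R := by linarith
  set θ : ℝ → ℝ := fun s => ψ (clamp (-R) R s) with hθ
  have hu : UniformContinuous θ := uniformContinuous_comp_clamp hψ hab
  have hθm : Monotone θ := hm.comp (monotone_clamp _ _)
  obtain ⟨C, -, hC⟩ := exists_bound_comp_clamp hψ hab
  obtain ⟨δ, hδ, hclose⟩ := exists_mean_close hu (half_pos hε)
  -- A moving average of a bounded function is Lipschitz and keeps monotonicity. Subtracting its
  -- value at 0 restores the zero at the cost of a second ε/2.
  have hcl := hclose δ hδ le_rfl
  obtain ⟨K, hK⟩ := exists_lipschitzWith_mean hδ hu.continuous hC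
  refine ⟨fun x => mean δ θ x - mean δ θ 0, fun x y hxy => ?_, by simp,
    ⟨K, fun x y => ?_⟩, ⟨C + C, fun x => ?_⟩, fun x hx => ?_⟩
  · have := monotone_mean hδ hu.continuous hθm hxy
    dsimp only; linarith
  · simpa [edist_dist, Real.dist_eq] using hK x y
  · have := abs_sub (mean δ θ x) (mean δ θ 0)
    have := abs_mean_le hδ hu.continuous hC x
    have := abs_mean_le hδ hu.continuous hC 0
    linarith
  · have h1 := hcl x
    have h2 := hcl 0
    have h3 : θ x = ψ x := by rw [hθ]; simp only; rw [clamp_of_mem (abs_le.1 hx)]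
    have h4 : θ 0 = 0 := by rw [hθ]; simp only; rw [clamp_of_mem ⟨by linarith, hR⟩, h0]
    rw [h3] at h1
    rw [h4] at h2
    rw [abs_le] at *
    constructor <;> linarith [h1.1, h1.2, h2.1, h2.2]

/-- The map that collapses `[-δ, δ]` to `0`. -/
def deadZone (δ s : ℝ) : ℝ := s - clamp (-δ) δ s

theorem deadZone_neg {δ : ℝ} (hδ : 0 ≤ δ) (s : ℝ) : deadZone δ (-s) = -deadZone δ s := by
  have : clamp (-δ) δ (-s) = -clamp (-δ) δ s := by
    rcases le_total s (-δ) with h | h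
    · rw [clamp_of_le (by linarith) h, clamp_of_ge (by linarith) (by linarith), neg_neg]
    rcases le_total δ s with h' | h'
    · rw [clamp_of_ge (by linarith) h', clamp_of_le (by linarith) (by linarith)]
    · rw [clamp_of_mem ⟨h, h'⟩, clamp_of_mem ⟨by linarith, by linarith⟩]
  rw [deadZone, deadZone, this]; ring

theorem continuous_deadZone (δ : ℝ) : Continuous (deadZone δ) :=
  continuous_id.sub (continuous_clamp _ _)

theorem deadZone_of_abs_le {δ s : ℝ} (h : |s| ≤ δ) : deadZone δ s = 0 := by
  rw [deadZone, clamp_of_mem (abs_le.1 h), sub_self]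

/-- The dead zone contributes nothing and merely translates f afterwards, so the new primitive at s
≥ δ is F(s - δ). -/
theorem primitive_comp_deadZone_nonpos {f : ℝ → ℝ} (hf : Continuous f) (h0 : f 0 = 0)
    {δ b : ℝ} (hδ : 0 ≤ δ) (hF : ∀ s ∈ Icc 0 b, primitive f s ≤ 0) {s : ℝ} (hs : s ∈ Icc 0 b) :
    primitive (fun t => f (deadZone δ t)) s ≤ 0 := by
  have hc : Continuous fun t => f (deadZone δ t) := hf.comp (continuous_deadZone δ)
  have hzero : ∀ x ∈ Icc 0 δ, primitive (fun t => f (deadZone δ t)) x = 0 := by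
    intro x hx
    have : ∀ t ∈ uIcc 0 x, f (deadZone δ t) = 0 := by
      intro t ht
      rw [uIcc_of_le hx.1] at ht
      rw [deadZone_of_abs_le, h0]
      rw [abs_of_nonneg ht.1]; exact ht.2.trans hx.2
    rw [primitive, intervalIntegral.integral_congr this]; simp
  rcases le_total s δ with h | h
  · exact (hzero s ⟨hs.1, h⟩).le
  · have h1 := intervalIntegral.integral_add_adjacent_intervals
      (hc.intervalIntegrable (μ := MeasureTheory.volume) 0 δ) (hc.intervalIntegrable δ s)
    have h2 : ∫ t in δ..s, f (deadZone δ t) = ∫ t in δ..s, f (t - δ) := by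
      refine intervalIntegral.integral_congr fun t ht => ?_
      rw [uIcc_of_le h] at ht
      simp only [deadZone]
      rw [clamp_of_ge (by linarith) ht.1]
    rw [h2, intervalIntegral.integral_comp_sub_right (fun t => f t), sub_self] at h1
    have h3 := hzero δ ⟨hδ, le_rfl⟩
    have h4 := hF (s - δ) ⟨by linarith, by linarith [hs.2]⟩
    rw [primitive] at h3 h4 ⊢
    linarith

theorem primitive_lt_primitive {g G : ℝ → ℝ} (hg : Continuous g) (hG : Continuous G)
    (hle : ∀ t, 0 ≤ t → g t ≤ G t) {ρ : ℝ} (hρ : 0 < ρ) (hlt : ∀ t ∈ Ioo 0 ρ, g t < G t)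
    {s : ℝ} (hs : 0 < s) : primitive g s < primitive G s := by
  refine intervalIntegral.integral_lt_integral_of_continuousOn_of_le_of_exists_lt hs
    hg.continuousOn hG.continuousOn (fun t ht => hle t ht.1.le) ?_
  have := lt_min hs hρ
  have h1 := min_le_left s ρ
  have h2 := min_le_right s ρ
  exact ⟨min s ρ / 2, ⟨by linarith, by linarith⟩, hlt _ ⟨by linarith, by linarith⟩⟩

/-- A uniformly continuous bounded function with nonpositive primitive near `0` has Lipschitz
approximations with negative primitive. -/
theorem exists_lipschitz_approx {f : ℝ → ℝ} (hf : UniformContinuous f) {C : ℝ}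
    (hC : ∀ s, |f s| ≤ C) (h0 : f 0 = 0) {a b : ℝ}
    (ha : a ≤ 0) (hb : 0 ≤ b) (hF : ∀ s ∈ Icc a b, primitive f s ≤ 0) {ε : ℝ} (hε : 0 < ε) :
    ∃ g : ℝ → ℝ, (∃ K, LipschitzWith K g) ∧ (∀ s, |g s - f s| ≤ ε) ∧
      ∀ s ∈ Icc a b, s ≠ 0 → primitive g s < 0 := by
  obtain ⟨δ₀, hδ₀, hfδ⟩ := Metric.uniformContinuous_iff.1 hf (ε / 4) (by linarith)
  obtain ⟨δ, hδ, hδ1, hδ2⟩ : ∃ δ > 0, δ < δ₀ ∧ δ ≤ ε :=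
    ⟨min (δ₀ / 2) ε, by positivity, (min_le_left _ _).trans_lt (by linarith), min_le_right _ _⟩
  set G : ℝ → ℝ := fun s => f (deadZone δ s) with hG
  have hGf : ∀ s, |G s - f s| ≤ ε / 4 := by
    intro s
    rw [← Real.dist_eq]
    refine (hfδ ?_).le
    rw [Real.dist_eq, deadZone, sub_sub_cancel_left, abs_neg]
    exact (abs_le.2 (clamp_mem (by linarith) s)).trans_lt hδ1
  have hGu : UniformContinuous G := by
    refine hf.comp ?_
    exact uniformContinuous_id.sub (lipschitzWith_clamp _ _).uniformContinuous
  have hGc := hGu.continuous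
  obtain ⟨τ₀, hτ₀, hmean⟩ := exists_mean_close hGu
    (show 0 < min (ε / 4) (δ / 2) by positivity)
  obtain ⟨τ, hτ, hτ1, hτ2⟩ : ∃ τ > 0, τ ≤ τ₀ ∧ τ ≤ δ / 2 :=
    ⟨min τ₀ (δ / 2), by positivity, min_le_left _ _, min_le_right _ _⟩
  have hm := hmean τ hτ hτ1
  obtain ⟨K, hK⟩ := exists_lipschitzWith_mean hτ hGc (fun s => hC _ : ∀ s, |G s| ≤ C)
  -- The dead zone is wider than the averaging length, so the mean vanishes for |s| ≤ δ/2 and g(s) =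
  -- -s there, which gives a strict sign. Further out the clamp is ±δ/2 and absorbs the averaging
  -- error. Hence g ≤ G on the right of 0, g ≥ G on the left, and the primitive of G is already
  -- nonpositive.
  set g : ℝ → ℝ := fun s => mean τ G s - clamp (-(δ / 2)) (δ / 2) s with hg
  have hgK : LipschitzWith (K + 1) g := hK.sub (lipschitzWith_clamp _ _)
  have hmz : ∀ s, |s| ≤ δ / 2 → mean τ G s = 0 := by
    intro s hs
    obtain ⟨x, hx, hxs⟩ := exists_mean_eq hτ hGc s
    rw [hxs, hG]; simp only
    rw [deadZone_of_abs_le, h0]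
    rw [abs_le] at *
    constructor <;> linarith [hx.1, hx.2, hs.1, hs.2]
  have hGz : ∀ s, |s| ≤ δ / 2 → G s = 0 := by
    intro s hs
    rw [hG]; simp only
    rw [deadZone_of_abs_le (by linarith), h0]
  have hin : ∀ s, |s| ≤ δ / 2 → g s - G s = -s := by
    intro s hs
    rw [hGz s hs, hg]; simp only
    rw [hmz s hs, clamp_of_mem (abs_le.1 hs)]; ring
  have hmle : ∀ s, |mean τ G s - G s| ≤ δ / 2 := fun s => (hm s).trans (min_le_right _ _)
  have hpos : ∀ t, 0 ≤ t → g t ≤ G t := by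
    intro t ht
    rcases le_total t (δ / 2) with h | h
    · have := hin t (by rwa [abs_of_nonneg ht]); linarith
    · have := (abs_le.1 (hmle t)).2
      rw [hg]; simp only
      rw [clamp_of_ge (by linarith) h]; linarith
  have hneg : ∀ t, t ≤ 0 → G t ≤ g t := by
    intro t ht
    rcases le_total (-(δ / 2)) t with h | h
    · have := hin t (by rw [abs_of_nonpos ht]; linarith)
      linarith
    · have := (abs_le.1 (hmle t)).1
      rw [hg]; simp only
      rw [clamp_of_le (by linarith) h]; linarith
  refine ⟨g, ⟨_, hgK⟩, fun s => ?_, fun s hs hs0 => ?_⟩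
  · have h1 := hGf s
    have h2 := (hm s).trans (min_le_left _ _)
    have h3 := clamp_mem (by linarith : -(δ / 2) ≤ δ / 2) s
    rw [hg]; simp only
    rw [abs_le] at *
    constructor <;> linarith [h1.1, h1.2, h2.1, h2.2, h3.1, h3.2]
  · rcases lt_or_gt_of_ne hs0 with h | h
    · have h1 := primitive_lt_primitive (continuous_reflect hgK.continuous)
        (continuous_reflect hGc) (fun t ht => neg_le_neg (hneg (-t) (by linarith)))
        (ρ := δ / 2) (by linarith) (fun t ht => by
          have := hin (-t) (by rw [abs_neg, abs_of_pos ht.1]; exact ht.2.le)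
          simp only [reflect]
          linarith [ht.1]) (s := -s) (by linarith)
      have h2 : reflect G = fun t => reflect f (deadZone δ t) := by
        funext t; simp only [reflect, hG]; rw [deadZone_neg hδ.le]
      rw [h2] at h1
      have h3 := primitive_comp_deadZone_nonpos (continuous_reflect hf.continuous)
        (by simp [reflect, h0]) hδ.le (b := -s) (fun x hx => by
          rw [primitive_reflect]
          exact hF _ ⟨by linarith [hx.2, hs.1], by linarith [hx.1]⟩)
        (s := -s) ⟨by linarith, le_rfl⟩
      have h4 := h1.trans_le h3
      rwa [primitive_reflect, neg_neg] at h4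
    · exact (primitive_lt_primitive hgK.continuous hGc hpos (ρ := δ / 2) (by linarith)
        (fun t ht => by
          have := hin t (by rw [abs_of_pos ht.1]; exact ht.2.le)
          linarith [ht.1]) h).trans_le
        (primitive_comp_deadZone_nonpos hf.continuous h0 hδ.le (b := s)
          (fun x hx => hF x ⟨ha.trans hx.1, hx.2.trans hs.2⟩)
          ⟨h.le, le_rfl⟩)

/-! ### Existence and continuous dependence for the regularized problem. -/

theorem hasDerivWithinAt_Ici_of_Ioo {x g : ℝ → ℝ} {T : ℝ} (hx : ContinuousOn x (Icc 0 T))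
    (hg : ContinuousOn g (Icc 0 T)) (h : ∀ t ∈ Ioo 0 T, HasDerivAt x (g t) t) {t : ℝ}
    (ht : t ∈ Ico 0 T) : HasDerivWithinAt x (g t) (Ici t) t := by
  rcases ht.1.eq_or_lt with rfl | h0
  · have hT : (0 : ℝ) < T := ht.2
    have hmem : Ioo (0 : ℝ) T ∈ 𝓝[>] (0 : ℝ) := Ioo_mem_nhdsGT hT
    refine hasDerivWithinAt_Ici_of_tendsto_deriv (s := Ioo 0 T)
      (fun t ht => (h t ht).differentiableAt.differentiableWithinAt)
      ((hx 0 ⟨le_rfl, hT.le⟩).mono Ioo_subset_Icc_self) hmem ?_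
    have h1 : Tendsto g (𝓝[Ioo 0 T] 0) (𝓝 (g 0)) :=
      (hg 0 ⟨le_rfl, hT.le⟩).mono Ioo_subset_Icc_self
    rw [nhdsWithin_Ioo_eq_nhdsGT hT] at h1
    refine h1.congr' ?_
    filter_upwards [hmem] with t ht
    exact (h t ht).deriv.symm
  · exact (h t ⟨h0, ht.2⟩).hasDerivWithinAt

/-- The vector field of the system for `u` and the weighted flux `W = (r+η)^d w`. -/
noncomputable def field (d : ℕ) (η : ℝ) (ψ f : ℝ → ℝ) (t : ℝ) (p : ℝ × ℝ) : ℝ × ℝ :=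
  (ψ (p.2 / (t + η) ^ d), -((t + η) ^ d * f p.1))

variable {d : ℕ} {η T : ℝ} {ψ f : ℝ → ℝ}

/-- Here η > 0 matters: the division by (t+η)^d stays bounded at t = 0. -/
theorem exists_lipschitzWith_field (hη : 0 < η) {K₁ K₂ : NNReal} (hψ : LipschitzWith K₁ ψ)
    (hf : LipschitzWith K₂ f) : ∃ K : NNReal, ∀ t ∈ Icc 0 T, LipschitzWith K (field d η ψ f t) := by
  refine ⟨max (K₁ * Real.toNNReal (1 / η ^ d)) (Real.toNNReal ((T + η) ^ d) * K₂),
    fun t ht => ?_⟩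
  have h1 : η ^ d ≤ (t + η) ^ d := by have := ht.1; gcongr; linarith
  have h2 : (t + η) ^ d ≤ (T + η) ^ d := by have := ht.1; have := ht.2; gcongr
  have hpos : 0 < η ^ d := by positivity
  refine LipschitzWith.prodMk ?_ ?_
  · refine hψ.comp (LipschitzWith.of_dist_le_mul fun p q => ?_)
    rw [Real.dist_eq, ← sub_div, abs_div, abs_of_pos (hpos.trans_le h1), Real.coe_toNNReal _
      (by positivity)]
    have h3 : |p.2 - q.2| ≤ dist p q := le_max_right _ _
    calc |p.2 - q.2| / (t + η) ^ d ≤ dist p q / η ^ d := by gcongr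
      _ = 1 / η ^ d * dist p q := by ring
  · refine LipschitzWith.of_dist_le_mul fun p q => ?_
    have h3 : |p.1 - q.1| ≤ dist p q := le_max_left _ _
    have h4 := hf.dist_le_mul p.1 q.1
    rw [Real.dist_eq, Real.dist_eq] at h4
    rw [NNReal.coe_mul, Real.coe_toNNReal _ (hpos.le.trans (h1.trans h2)), Real.dist_eq,
      neg_sub_neg, ← mul_sub, abs_mul, abs_of_pos (hpos.trans_le h1), abs_sub_comm, mul_assoc]
    have h5 : |f p.1 - f q.1| ≤ K₂ * dist p q := h4.trans (by gcongr)
    exact mul_le_mul h2 h5 (abs_nonneg _) (hpos.le.trans (h1.trans h2))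

theorem IsSol.hasDerivWithinAt_field {u w : ℝ → ℝ} (h : IsSol d η ψ f T u w) (hη : 0 < η)
    (hψ : Continuous ψ) (hf : Continuous f) {t : ℝ} (ht : t ∈ Ico 0 T) :
    HasDerivWithinAt (fun t => (u t, (t + η) ^ d * w t))
      (field d η ψ f t (u t, (t + η) ^ d * w t)) (Ici t) t := by
  have hp : (t + η) ^ d ≠ 0 := by have := ht.1; positivity
  have h1 := hasDerivWithinAt_Ici_of_Ioo h.contu (hψ.comp_continuousOn h.contw) h.du ht
  have h2 := hasDerivWithinAt_Ici_of_Ioo (g := fun r => -((r + η) ^ d * f (u r)))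
    (x := fun t => (t + η) ^ d * w t) (T := T) (by have := h.contw; fun_prop)
    (by have := h.contu; fun_prop) (fun r hr => h.hasDerivAt_weighted hη.le hr) ht
  refine (h1.prodMk h2).congr_deriv ?_
  simp only [field]
  rw [mul_div_cancel_left₀ _ hp]
  rfl

/-- Gronwall's inequality. The constant may blow up along the regularization; this is harmless,
since the initial heights are chosen afterwards. -/
theorem exists_dependence (hη : 0 < η) {K₁ K₂ : NNReal} (hψ : LipschitzWith K₁ ψ)
    (hf : LipschitzWith K₂ f) : ∃ K > 0, ∀ u w u' w', IsSol d η ψ f T u w →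
      IsSol d η ψ f T u' w' → ∀ t ∈ Icc 0 T, |u t - u' t| ≤ K * |u 0 - u' 0| := by
  obtain ⟨K, hK⟩ := exists_lipschitzWith_field (d := d) (T := T) hη hψ hf
  refine ⟨Real.exp (K * T), Real.exp_pos _, fun u w u' w' h h' t ht => ?_⟩
  have key := dist_le_of_trajectories_ODE_of_mem (v := field d η ψ f) (s := fun _ => univ)
    (fun t ht => (hK t (Ico_subset_Icc_self ht)).lipschitzOnWith)
    (f := fun t => (u t, (t + η) ^ d * w t)) (g := fun t => (u' t, (t + η) ^ d * w' t))
    (h.contu.prodMk (by have := h.contw; fun_prop))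
    (fun t ht => h.hasDerivWithinAt_field hη hψ.continuous hf.continuous ht) (fun _ _ => mem_univ _)
    (h'.contu.prodMk (by have := h'.contw; fun_prop))
    (fun t ht => h'.hasDerivWithinAt_field hη hψ.continuous hf.continuous ht)
    (fun _ _ => mem_univ _) (δ := |u 0 - u' 0|) (by
      rw [h.w0, h'.w0, Prod.dist_eq]; simp [Real.dist_eq]) t ht
  have h1 : |u t - u' t| ≤ _ := (le_max_left _ _).trans key
  refine h1.trans ?_
  rw [mul_comm]
  have := ht.2
  gcongr
  linarith

theorem exists_isSol (hη : 0 < η) {K₁ K₂ : NNReal} (hψ : LipschitzWith K₁ ψ)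
    (hf : LipschitzWith K₂ f) {C : ℝ} (hCψ : ∀ x, |ψ x| ≤ C) (hCf : ∀ x, |f x| ≤ C)
    (hT : 0 ≤ T) (α : ℝ) : ∃ u w, IsSol d η ψ f T u w ∧ u 0 = α := by
  obtain ⟨K, hK⟩ := exists_lipschitzWith_field (d := d) (T := T) hη hψ hf
  have hC : 0 ≤ C := (abs_nonneg _).trans (hCψ 0)
  -- B bounds the field everywhere, so a ball of radius B T is never left and Picard-Lindelöf
  -- applies on all of [0, T].
  set B : ℝ := max C ((T + η) ^ d * C) with hB
  have hB0 : 0 ≤ B := hC.trans (le_max_left _ _)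
  have hψc := hψ.continuous
  have hp : IsPicardLindelof (field d η ψ f) (⟨0, le_rfl, hT⟩ : Icc (0 : ℝ) T) (α, (0 : ℝ))
      (Real.toNNReal (B * T)) 0 (Real.toNNReal B) K :=
    { lipschitzOnWith := fun t ht => (hK t ht).lipschitzOnWith
      continuousOn := fun p _ => by
        have : ∀ t ∈ Icc 0 T, (t + η) ^ d ≠ 0 := fun t ht => by have := ht.1; positivity
        unfold field
        refine ContinuousOn.prodMk ?_ (by fun_prop)
        refine hψc.comp_continuousOn ?_
        exact continuousOn_const.div (by fun_prop) this
      norm_le := fun t ht p _ => by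
        rw [Real.coe_toNNReal _ hB0]
        have h2 : (t + η) ^ d ≤ (T + η) ^ d := by have := ht.1; have := ht.2; gcongr
        have h0 : 0 ≤ (t + η) ^ d := by have := ht.1; positivity
        refine max_le ((hCψ _).trans (le_max_left _ _)) ?_
        simp only [field]
        rw [norm_neg, Real.norm_eq_abs, abs_mul, abs_of_nonneg h0]
        exact (mul_le_mul h2 (hCf _) (abs_nonneg _) (h0.trans h2)).trans (le_max_right _ _)
      mul_max_le := by
        simp only [sub_zero, sub_self, NNReal.coe_zero]
        rw [max_eq_left hT, Real.coe_toNNReal _ hB0, Real.coe_toNNReal _ (by positivity)] }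
  obtain ⟨x, hx0, hx⟩ := hp.exists_eq_forall_mem_Icc_hasDerivWithinAt₀
  have hcont : ContinuousOn x (Icc 0 T) := fun t ht => (hx t ht).continuousWithinAt
  have hd : ∀ t ∈ Ioo 0 T, HasDerivAt x (field d η ψ f t (x t)) t := fun t ht =>
    (hx t (Ioo_subset_Icc_self ht)).hasDerivAt (Icc_mem_nhds ht.1 ht.2)
  simp only at hx0
  refine ⟨fun t => (x t).1, fun t => (x t).2 / (t + η) ^ d, ⟨?_, ?_, fun t ht => ?_,
    fun t ht => ?_, by simp [hx0]⟩, by simp [hx0]⟩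
  · exact continuous_fst.comp_continuousOn hcont
  · refine (continuous_snd.comp_continuousOn hcont).div (by fun_prop) fun t ht => ?_
    have := ht.1; positivity
  · exact (hasFDerivAt_fst (𝕜 := ℝ)).comp_hasDerivAt t (hd t ht)
  · have h2 : HasDerivAt (fun t => (x t).2) (-((t + η) ^ d * f (x t).1)) t :=
      (hasFDerivAt_snd (𝕜 := ℝ) (E := ℝ) (F := ℝ) (p := x t)).comp_hasDerivAt t (hd t ht)
    have hne : t + η ≠ 0 := by have := ht.1; positivity
    have h3 : HasDerivAt (fun t : ℝ => (t + η) ^ d) (d * (t + η) ^ (d - 1)) t := by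
      simpa using ((hasDerivAt_id' t).fun_add (hasDerivAt_const t η)).fun_pow d
    refine (h2.fun_div h3 (pow_ne_zero _ hne)).congr_deriv ?_
    rcases d with _ | d
    · simp
    · simp only [Nat.add_sub_cancel]
      field_simp
      ring

end RadialBoundState

/-! ### Compactness: limits of regularized solutions. -/

namespace RadialBoundState

theorem abs_sub_le_of_hasDerivAt {x g : ℝ → ℝ} {R D : ℝ} (hx : ContinuousOn x (Icc 0 R))
    (h : ∀ t ∈ Ioo 0 R, HasDerivAt x (g t) t) (hg : ∀ t ∈ Ioo 0 R, |g t| ≤ D) {s t : ℝ}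
    (hs : s ∈ Icc 0 R) (ht : t ∈ Icc 0 R) : |x s - x t| ≤ D * |s - t| := by
  have key : ∀ a ∈ Icc 0 R, ∀ b ∈ Icc 0 R, a < b → |x b - x a| ≤ D * |b - a| := by
    intro a ha b hb hab
    obtain ⟨c, hc, hcs⟩ := exists_hasDerivAt_eq_slope x g hab
      (hx.mono (Icc_subset_Icc ha.1 hb.2))
      fun y hy => h y ⟨ha.1.trans_lt hy.1, hy.2.trans_le hb.2⟩
    have hba : b - a ≠ 0 := by linarith
    have h1 : x b - x a = g c * (b - a) := by rw [hcs]; field_simp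
    rw [h1, abs_mul]
    gcongr
    exact hg c ⟨ha.1.trans_lt hc.1, hc.2.trans_le hb.2⟩
  rcases lt_trichotomy s t with hst | rfl | hst
  · rw [abs_sub_comm, abs_sub_comm s t]; exact key s hs t ht hst
  · simp
  · exact key t ht s hs hst

/-- Along an ultrafilter, locally equi-Lipschitz functions converge jointly. -/
theorem exists_ultrafilter_limit (U : Ultrafilter ℕ) {x : ℕ → ℝ → ℝ}
    (hlip : ∀ R > 0, ∃ D, ∀ᶠ n in (U : Filter ℕ), ∀ s ∈ Icc 0 R, ∀ t ∈ Icc 0 R,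
      |x n s - x n t| ≤ D * |s - t|)
    {B : ℝ} (hB : ∀ᶠ n in (U : Filter ℕ), |x n 0| ≤ B) :
    ∃ y : ℝ → ℝ, ∀ r, 0 ≤ r →
      Tendsto (fun p : ℕ × ℝ => x p.1 p.2) ((U : Filter ℕ) ×ˢ 𝓝[Ici 0] r) (𝓝 (y r)) := by
  have hpt : ∀ r, ∃ y, 0 ≤ r → Tendsto (fun n => x n r) U (𝓝 y) := by
    intro r
    by_cases hr : 0 ≤ r
    · obtain ⟨D, hD⟩ := hlip (r + 1) (by linarith)
      have hmem : ∀ᶠ n in (U : Filter ℕ), x n r ∈ Icc (-(B + D * r)) (B + D * r) := by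
        filter_upwards [hD, hB] with n h1 h2
        have := h1 r ⟨hr, by linarith⟩ 0 ⟨le_rfl, by linarith⟩
        rw [sub_zero, abs_of_nonneg hr] at this
        rw [mem_Icc, ← abs_le]
        have := abs_sub_abs_le_abs_sub (x n r) (x n 0)
        linarith
      obtain ⟨y, _, hy⟩ := (isCompact_Icc (a := -(B + D * r)) (b := B + D * r)).ultrafilter_le_nhds
        (U.map fun n => x n r) (le_principal_iff.2 hmem)
      exact ⟨y, fun _ => hy⟩
    · exact ⟨0, fun h => absurd h hr⟩
  choose y hy using hpt
  refine ⟨y, fun r hr => ?_⟩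
  obtain ⟨D, hD⟩ := hlip (r + 1) (by linarith)
  -- Pointwise limits come from compactness; the common Lipschitz constant upgrades them to joint
  -- convergence in (n, s), so that moving points such as zeros can be followed.
  rw [Metric.tendsto_nhds]
  intro ε hε
  have h1 : ∀ᶠ n in (U : Filter ℕ), (∀ s ∈ Icc 0 (r + 1), ∀ t ∈ Icc 0 (r + 1),
      |x n s - x n t| ≤ D * |s - t|) ∧ dist (x n r) (y r) < ε / 2 :=
    hD.and ((Metric.tendsto_nhds.1 (hy r hr)) (ε / 2) (half_pos hε))
  have h2 : ∀ᶠ s in 𝓝[Ici 0] r, s ∈ Icc 0 (r + 1) ∧ D * |s - r| < ε / 2 := by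
    have ha : ∀ᶠ s in 𝓝 r, s < r + 1 := gt_mem_nhds (by linarith)
    have hb : ∀ᶠ s in 𝓝 r, D * |s - r| < ε / 2 := by
      have : Continuous fun s : ℝ => D * |s - r| := by fun_prop
      exact this.continuousAt.eventually_lt_const (by simp; linarith)
    filter_upwards [nhdsWithin_le_nhds ha, nhdsWithin_le_nhds hb, self_mem_nhdsWithin] with s h h' h0
    exact ⟨⟨h0, h.le⟩, h'⟩
  filter_upwards [h1.prod_mk h2] with p hp
  obtain ⟨⟨ha, hb⟩, hc, hd⟩ := hp
  have := ha p.2 hc r ⟨hr, by linarith⟩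
  rw [Real.dist_eq] at hb ⊢
  have := abs_sub_le (x p.1 p.2) (x p.1 r) (y r)
  linarith

theorem tendsto_of_joint {l : Filter ℕ} {x : ℕ → ℝ → ℝ} {y r : ℝ}
    (h : Tendsto (fun p : ℕ × ℝ => x p.1 p.2) (l ×ˢ 𝓝[Ici 0] r) (𝓝 y)) {ρ : ℕ → ℝ}
    (h0 : ∀ᶠ n in l, 0 ≤ ρ n) (hρ : Tendsto ρ l (𝓝 r)) :
    Tendsto (fun n => x n (ρ n)) l (𝓝 y) :=
  h.comp (tendsto_id.prodMk (tendsto_nhdsWithin_iff.2 ⟨hρ, h0⟩))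

theorem continuousOn_of_joint {l : Filter ℕ} [NeBot l] {x : ℕ → ℝ → ℝ} {y : ℝ → ℝ}
    (h : ∀ r, 0 ≤ r → Tendsto (fun p : ℕ × ℝ => x p.1 p.2) (l ×ˢ 𝓝[Ici 0] r) (𝓝 (y r))) :
    ContinuousOn y (Ici 0) := by
  intro r hr
  rw [ContinuousWithinAt, Metric.tendsto_nhds]
  intro ε hε
  have h1 := (Metric.tendsto_nhds.1 (h r hr)) (ε / 2) (half_pos hε)
  rw [Filter.eventually_prod_iff] at h1
  obtain ⟨P, hP, Q, hQ, hPQ⟩ := h1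
  filter_upwards [hQ, self_mem_nhdsWithin] with s hs hs0
  have h3 : Tendsto (fun n => x n s) l (𝓝 (y s)) :=
    tendsto_of_joint (ρ := fun _ => s) (h s hs0) (Eventually.of_forall fun _ => hs0)
      tendsto_const_nhds
  have h4 : dist (y s) (y r) ≤ ε / 2 :=
    le_of_tendsto (h3.dist tendsto_const_nhds) (hP.mono fun n hn => (hPQ hn hs).le)
  linarith

/-- A sequence of regularizations of the radial problem. -/
structure Scheme (ψ f : ℝ → ℝ) (C : ℝ) (η : ℕ → ℝ) (ψn fn : ℕ → ℝ → ℝ) : Prop where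
  eta_pos : ∀ n, 0 < η n
  eta_lim : Tendsto η atTop (𝓝 0)
  C_nonneg : 0 ≤ C
  bound : ∀ n s, |fn n s| ≤ C
  f_lim : ∀ ε > 0, ∀ᶠ n in atTop, ∀ s, |fn n s - f s| ≤ ε
  psi_lim : ∀ ε > 0, ∀ R, ∀ᶠ n in atTop, ∀ x, |x| ≤ R → |ψn n x - ψ x| ≤ ε
  psi_mono : ∀ n, Monotone (ψn n)
  psi_zero : ∀ n, ψn n 0 = 0
  psi_cont : ∀ n, Continuous (ψn n)
  f_cont : ∀ n, Continuous (fn n)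

theorem joint_of_locally_uniform {g : ℝ → ℝ} {gn : ℕ → ℝ → ℝ} (hg : Continuous g)
    (hlim : ∀ ε > 0, ∀ R, ∀ᶠ n in atTop, ∀ x, |x| ≤ R → |gn n x - g x| ≤ ε) (x : ℝ) :
    Tendsto (fun p : ℕ × ℝ => gn p.1 p.2) (atTop ×ˢ 𝓝 x) (𝓝 (g x)) := by
  rw [Metric.tendsto_nhds]
  intro ε hε
  have h1 := hlim (ε / 3) (by linarith) (|x| + 1)
  have h2 : ∀ᶠ y in 𝓝 x, |y| ≤ |x| + 1 ∧ dist (g y) (g x) < ε / 3 := by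
    have ha : ∀ᶠ y in 𝓝 x, |y| < |x| + 1 :=
      continuous_abs.continuousAt.eventually_lt_const (by linarith)
    have hb := (Metric.tendsto_nhds.1 (hg.tendsto x)) (ε / 3) (by linarith)
    filter_upwards [ha, hb] with y h h'
    exact ⟨h.le, h'⟩
  filter_upwards [h1.prod_mk h2] with p hp
  have h3 := hp.1 p.2 hp.2.1
  have h4 := hp.2.2
  rw [Real.dist_eq] at h4 ⊢
  have := abs_sub_le (gn p.1 p.2) (g p.2) (g x)
  linarith

theorem primitive_locally_uniform {g : ℝ → ℝ} {gn : ℕ → ℝ → ℝ} (hg : Continuous g)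
    (hgn : ∀ n, Continuous (gn n))
    (hlim : ∀ ε > 0, ∀ R, ∀ᶠ n in atTop, ∀ x, |x| ≤ R → |gn n x - g x| ≤ ε) :
    ∀ ε > 0, ∀ R, ∀ᶠ n in atTop, ∀ x, |x| ≤ R → |primitive (gn n) x - primitive g x| ≤ ε := by
  intro ε hε R
  have hR : 0 < |R| + 1 := by positivity
  filter_upwards [hlim (ε / (|R| + 1)) (by positivity) R] with n hn x hx
  rw [primitive, primitive, ← intervalIntegral.integral_sub ((hgn n).intervalIntegrable _ _)
    (hg.intervalIntegrable _ _)]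
  have h1 : ∀ t ∈ Set.uIoc 0 x, ‖gn n t - g t‖ ≤ ε / (|R| + 1) := by
    intro t ht
    refine hn t (le_trans ?_ hx)
    rcases le_total 0 x with h0 | h0
    · rw [uIoc_of_le h0] at ht
      rw [abs_of_nonneg h0, abs_of_pos ht.1]; exact ht.2
    · rw [uIoc_of_ge h0] at ht
      rw [abs_of_nonpos h0, abs_of_nonpos ht.2]; linarith [ht.1]
  have h2 := intervalIntegral.norm_integral_le_of_norm_le_const h1
  rw [sub_zero, Real.norm_eq_abs] at h2
  refine h2.trans ?_
  rw [div_mul_eq_mul_div, div_le_iff₀ hR]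
  have := hx.trans (le_abs_self R)
  gcongr
  linarith

namespace Scheme

variable {d : ℕ} {ψ f : ℝ → ℝ} {C : ℝ} {η : ℕ → ℝ} {ψn fn : ℕ → ℝ → ℝ}

theorem primitive_f_lim (h : Scheme ψ f C η ψn fn) (hf : Continuous f) :
    ∀ ε > 0, ∀ R, ∀ᶠ n in atTop, ∀ x, |x| ≤ R → |primitive (fn n) x - primitive f x| ≤ ε :=
  primitive_locally_uniform hf h.f_cont fun ε hε _ => (h.f_lim ε hε).mono fun _ hn x _ => hn x

theorem primitive_psi_lim (h : Scheme ψ f C η ψn fn) (hψ : Continuous ψ) :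
    ∀ ε > 0, ∀ R, ∀ᶠ n in atTop, ∀ x, |x| ≤ R → |primitive (ψn n) x - primitive ψ x| ≤ ε :=
  primitive_locally_uniform hψ h.psi_cont h.psi_lim

theorem tendsto_energy (h : Scheme ψ f C η ψn fn) (hψ : Continuous ψ) (hf : Continuous f)
    {l : Filter ℕ} (hl : l ≤ atTop) {un wn : ℕ → ℝ → ℝ} {ρ : ℕ → ℝ} {u w : ℝ → ℝ} {r : ℝ}
    (hu : Tendsto (fun n => un n (ρ n)) l (𝓝 (u r)))
    (hw : Tendsto (fun n => wn n (ρ n)) l (𝓝 (w r))) :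
    Tendsto (fun n => energy (ψn n) (fn n) (un n) (wn n) (ρ n)) l (𝓝 (energy ψ f u w r)) :=
  ((joint_of_locally_uniform (continuous_primitive hψ) (h.primitive_psi_lim hψ) (w r)).comp
    ((show Tendsto id l atTop from hl).prodMk hw)).add
  ((joint_of_locally_uniform (continuous_primitive hf) (h.primitive_f_lim hf) (u r)).comp
    ((show Tendsto id l atTop from hl).prodMk hu))

/-- Solutions of the regularized problems converge, along an ultrafilter, to a solution of the
limit problem. -/
theorem exists_limit (h : Scheme ψ f C η ψn fn) (hψ : Continuous ψ) (hf : Continuous f)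
    (U : Ultrafilter ℕ) (hU : (U : Filter ℕ) ≤ atTop) {T : ℕ → ℝ} (hT : Tendsto T atTop atTop)
    {un wn : ℕ → ℝ → ℝ} (hsol : ∀ n, IsSol d (η n) (ψn n) (fn n) (T n) (un n) (wn n))
    {B : ℝ} (hB : ∀ n, |un n 0| ≤ B) :
    ∃ u w, (∀ T, IsSol d 0 ψ f T u w) ∧
      ∀ r, 0 ≤ r → ∀ ρ : ℕ → ℝ, (∀ᶠ n in (U : Filter ℕ), 0 ≤ ρ n) → Tendsto ρ U (𝓝 r) →
        Tendsto (fun n => un n (ρ n)) U (𝓝 (u r)) ∧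
        Tendsto (fun n => wn n (ρ n)) U (𝓝 (w r)) := by
  have hC := h.C_nonneg
  have hwb : ∀ n, ∀ r ∈ Icc 0 (T n), |wn n r| ≤ C * r := fun n r hr =>
    (hsol n).abs_le_mul (h.eta_pos n).le hr hC fun t _ => h.bound n _
  have hTU : ∀ R, ∀ᶠ n in (U : Filter ℕ), R ≤ T n := fun R => hU (hT.eventually_ge_atTop R)
  have hwlip : ∀ R > 0, ∃ D, ∀ᶠ n in (U : Filter ℕ), ∀ s ∈ Icc 0 R, ∀ t ∈ Icc 0 R,
      |wn n s - wn n t| ≤ D * |s - t| := by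
    intro R hR
    refine ⟨(d + 1) * C, (hTU R).mono fun n hn s hs t ht => ?_⟩
    have hs' := (hsol n).mono hn
    refine abs_sub_le_of_hasDerivAt hs'.contw hs'.dw (fun r hr => ?_) hs ht
    have h1 := hwb n r ⟨hr.1.le, hr.2.le.trans hn⟩
    have h2 := h.bound n (un n r)
    have hη := h.eta_pos n
    have hr0 := hr.1
    -- The bound |w| ≤ C r compensates the singularity at 0 uniformly in η.
    have h3 : |(d : ℝ) / (r + η n) * wn n r| ≤ d * C := by
      rw [abs_mul, abs_of_nonneg (by positivity)]
      calc (d : ℝ) / (r + η n) * |wn n r| ≤ (d : ℝ) / r * (C * r) := by gcongr; linarith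
        _ = d * C := by field_simp
    have h4 := abs_sub (-((d : ℝ) / (r + η n) * wn n r)) (fn n (un n r))
    rw [abs_neg] at h4
    linarith
  have hulip : ∀ R > 0, ∃ D, ∀ᶠ n in (U : Filter ℕ), ∀ s ∈ Icc 0 R, ∀ t ∈ Icc 0 R,
      |un n s - un n t| ≤ D * |s - t| := by
    intro R hR
    obtain ⟨D, hD⟩ := (isCompact_Icc (a := -(C * R)) (b := C * R)).exists_bound_of_continuousOn
      hψ.continuousOn
    refine ⟨D + 1, ?_⟩
    filter_upwards [hTU R, hU (h.psi_lim 1 one_pos (C * R))] with n hn hp s hs t ht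
    have hs' := (hsol n).mono hn
    refine abs_sub_le_of_hasDerivAt hs'.contu hs'.du (fun r hr => ?_) hs ht
    have h1 : |wn n r| ≤ C * R := (hwb n r ⟨hr.1.le, hr.2.le.trans hn⟩).trans (by
      have := hr.2.le; gcongr)
    have h2 := hp _ h1
    have h3 := hD _ (abs_le.1 h1)
    rw [Real.norm_eq_abs] at h3
    have := abs_sub_abs_le_abs_sub (ψn n (wn n r)) (ψ (wn n r))
    linarith
  obtain ⟨u, hu⟩ := exists_ultrafilter_limit U hulip (Eventually.of_forall hB)
  obtain ⟨w, hw⟩ := exists_ultrafilter_limit U hwlip (B := 0)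
    (Eventually.of_forall fun n => by simp [(hsol n).w0])
  have hcu := continuousOn_of_joint hu
  have hcw := continuousOn_of_joint hw
  have hfst : ∀ r : ℝ, Tendsto (Prod.fst : ℕ × ℝ → ℕ) ((U : Filter ℕ) ×ˢ 𝓝 r) atTop :=
    fun r => tendsto_fst.mono_right hU
  have hsolU : ∀ r : ℝ, 0 < r → ∀ᶠ p : ℕ × ℝ in (U : Filter ℕ) ×ˢ 𝓝 r,
      p.2 ∈ Ioo 0 (T p.1) := by
    intro r hr
    filter_upwards [(hTU (r + 1)).prod_mk (Ioo_mem_nhds hr (by linarith : r < r + 1))] with p hp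
    exact ⟨hp.2.1, hp.2.2.trans_le hp.1⟩
  have hnhds : ∀ r : ℝ, 0 < r → 𝓝[Ici 0] r = 𝓝 r := fun r hr =>
    nhdsWithin_eq_nhds.2 (Ici_mem_nhds hr)
  -- Joint convergence to a continuous limit is uniform convergence near r, the form needed to pass
  -- to the limit in derivatives.
  have hunif : ∀ (r : ℝ) (F : ℕ → ℝ → ℝ) (g : ℝ → ℝ), ContinuousAt g r →
      Tendsto (fun p : ℕ × ℝ => F p.1 p.2) ((U : Filter ℕ) ×ˢ 𝓝 r) (𝓝 (g r)) →
      TendstoUniformlyOnFilter F g U (𝓝 r) := by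
    intro r F g hg hF
    have h2 : Tendsto (fun p : ℕ × ℝ => g p.2) ((U : Filter ℕ) ×ˢ 𝓝 r) (𝓝 (g r)) :=
      hg.tendsto.comp tendsto_snd
    rw [Metric.tendstoUniformlyOnFilter_iff]
    intro ε hε
    have h3 := h2.dist hF
    rw [dist_self] at h3
    exact h3.eventually_lt_const hε
  refine ⟨u, w, fun T' => ⟨hcu.mono Icc_subset_Ici_self, hcw.mono Icc_subset_Ici_self,
    fun r hr => ?_, fun r hr => ?_, ?_⟩, fun r hr ρ h0 hρ =>
      ⟨tendsto_of_joint (hu r hr) h0 hρ, tendsto_of_joint (hw r hr) h0 hρ⟩⟩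
  · have hr0 := hr.1
    have hcwr : ContinuousAt w r := hcw.continuousAt (Ici_mem_nhds hr0)
    refine hasDerivAt_of_tendstoUniformlyOnFilter (l := (U : Filter ℕ)) (f := un)
      (f' := fun n y => ψn n (wn n y)) (g' := fun y => ψ (w y)) (hunif r _ _ ?_ ?_) ?_ ?_
    · exact hψ.continuousAt.comp hcwr
    · have := hw r hr0.le
      rw [hnhds r hr0] at this
      exact (joint_of_locally_uniform hψ h.psi_lim (w r)).comp ((hfst r).prodMk this)
    · filter_upwards [hsolU r hr0] with p hp
      exact (hsol p.1).du p.2 hp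
    · filter_upwards [Ioi_mem_nhds hr0] with y hy
      exact tendsto_of_joint (ρ := fun _ => y) (hu y (le_of_lt hy))
        (Eventually.of_forall fun _ => le_of_lt hy) tendsto_const_nhds
  · have hr0 := hr.1
    have hcwr : ContinuousAt w r := hcw.continuousAt (Ici_mem_nhds hr0)
    have hcur : ContinuousAt u r := hcu.continuousAt (Ici_mem_nhds hr0)
    have hne : r + 0 ≠ 0 := by linarith
    refine hasDerivAt_of_tendstoUniformlyOnFilter (l := (U : Filter ℕ)) (f := wn)
      (f' := fun n y => -((d : ℝ) / (y + η n) * wn n y) - fn n (un n y))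
      (g' := fun y => -((d : ℝ) / (y + 0) * w y) - f (u y)) (hunif r _ _ ?_ ?_) ?_ ?_
    · exact (((continuousAt_const.div (continuousAt_id.add continuousAt_const) hne).mul
          hcwr).neg).sub (hf.continuousAt.comp hcur)
    · have hw' := hw r hr0.le
      have hu' := hu r hr0.le
      rw [hnhds r hr0] at hw' hu'
      refine Tendsto.sub (Tendsto.neg (Tendsto.mul (Tendsto.div tendsto_const_nhds
          (tendsto_snd.add (h.eta_lim.comp (hfst r))) hne) hw')) ?_
      exact (joint_of_locally_uniform hf (fun ε hε _ => (h.f_lim ε hε).mono fun _ hn x _ => hn x)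
        (u r)).comp ((hfst r).prodMk hu')
    · filter_upwards [hsolU r hr0] with p hp
      exact (hsol p.1).dw p.2 hp
    · filter_upwards [Ioi_mem_nhds hr0] with y hy
      exact tendsto_of_joint (ρ := fun _ => y) (hw y (le_of_lt hy))
        (Eventually.of_forall fun _ => le_of_lt hy) tendsto_const_nhds
  · refine tendsto_nhds_unique (tendsto_of_joint (ρ := fun _ => 0) (hw 0 le_rfl)
      (Eventually.of_forall fun _ => le_rfl) tendsto_const_nhds) ?_
    simp only [(hsol _).w0]
    exact tendsto_const_nhds

end Scheme

end RadialBoundState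

/-! ### Solutions on the half-line and oscillation at positive energy. -/

namespace RadialBoundState

variable {d : ℕ} {q : ℝ} {ψ f u w : ℝ → ℝ}

/-- A solution of the limit system on `[0, ∞)`. -/
def IsGlobalSol (d : ℕ) (ψ f u w : ℝ → ℝ) : Prop := ∀ T, IsSol d 0 ψ f T u w

namespace IsGlobalSol

theorem contu (h : IsGlobalSol d ψ f u w) : ContinuousOn u (Ici 0) := fun r hr =>
  ((h (r + 1)).contu r ⟨hr, by linarith⟩).mono_of_mem_nhdsWithin
    (inter_mem_nhdsWithin _ (Iic_mem_nhds (by linarith)))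

theorem contw (h : IsGlobalSol d ψ f u w) : ContinuousOn w (Ici 0) := fun r hr =>
  ((h (r + 1)).contw r ⟨hr, by linarith⟩).mono_of_mem_nhdsWithin
    (inter_mem_nhdsWithin _ (Iic_mem_nhds (by linarith)))

theorem du (h : IsGlobalSol d ψ f u w) {r : ℝ} (hr : 0 < r) : HasDerivAt u (ψ (w r)) r :=
  (h (r + 1)).du r ⟨hr, by linarith⟩

theorem dw (h : IsGlobalSol d ψ f u w) {r : ℝ} (hr : 0 < r) :
    HasDerivAt w (-((d : ℝ) / r * w r) - f (u r)) r := by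
  simpa using (h (r + 1)).dw r ⟨hr, by linarith⟩

theorem w0 (h : IsGlobalSol d ψ f u w) : w 0 = 0 := (h 0).w0

theorem reflect (h : IsGlobalSol d ψ f u w) :
    IsGlobalSol d (RadialBoundState.reflect ψ) (RadialBoundState.reflect f) (-u) (-w) :=
  fun T => (h T).reflect

theorem reflect_phi (h : IsGlobalSol d (phi q) f u w) :
    IsGlobalSol d (phi q) (RadialBoundState.reflect f) (-u) (-w) := by
  have := h.reflect
  rwa [RadialBoundState.reflect_phi] at this

theorem congr_f {g : ℝ → ℝ} (h : IsGlobalSol d ψ f u w) (hg : ∀ r, 0 < r → f (u r) = g (u r)) :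
    IsGlobalSol d ψ g u w := fun T => (h T).congr_f fun r hr => hg r hr.1

theorem dI (h : IsGlobalSol d ψ f u w) (hψ : Continuous ψ) (hf : Continuous f) {r : ℝ}
    (hr : 0 < r) : HasDerivAt (energy ψ f u w) (-((d : ℝ) / r * (w r * ψ (w r)))) r := by
  simpa using (h (r + 1)).hasDerivAt_energy hψ hf ⟨hr, by linarith⟩

theorem contI (h : IsGlobalSol d ψ f u w) (hψ : Continuous ψ) (hf : Continuous f) :
    ContinuousOn (energy ψ f u w) (Ici 0) :=
  ((continuous_primitive hψ).comp_continuousOn h.contw).add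
    ((continuous_primitive hf).comp_continuousOn h.contu)

theorem antiI (h : IsGlobalSol d ψ f u w) (hψ : Continuous ψ) (hf : Continuous f)
    (hpos : ∀ x, 0 ≤ x * ψ x) : AntitoneOn (energy ψ f u w) (Ici 0) := fun _ ha b hb hab =>
  (h b).antitoneOn_energy hψ hf le_rfl hpos ⟨ha, hab⟩ ⟨hb, le_rfl⟩ hab

end IsGlobalSol

theorem energy_reflect_phi (f u w : ℝ → ℝ) :
    energy (phi q) (reflect f) (-u) (-w) = energy (phi q) f u w := by
  have := energy_reflect (phi q) f u w
  rwa [reflect_phi] at this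

theorem exists_first_zero {g : ℝ → ℝ} {a b : ℝ} (hab : a ≤ b) (hg : ContinuousOn g (Icc a b))
    (ha : g a < 0) (hb : 0 ≤ g b) : ∃ c ∈ Ioc a b, g c = 0 ∧ ∀ r ∈ Ico a c, g r < 0 := by
  have hS : IsCompact (Icc a b ∩ g ⁻¹' Ici 0) :=
    isCompact_Icc.of_isClosed_subset (hg.preimage_isClosed_of_isClosed isClosed_Icc isClosed_Ici)
      inter_subset_left
  obtain ⟨c, ⟨⟨hc1, hc2⟩, hc3⟩, hmin⟩ := hS.exists_isLeast ⟨b, ⟨hab, le_rfl⟩, hb⟩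
  have hlt : ∀ r ∈ Ico a c, g r < 0 := by
    intro r hr
    by_contra hcon
    exact absurd (hmin ⟨⟨hr.1, hr.2.le.trans hc2⟩, not_lt.1 hcon⟩) (not_le.2 hr.2)
  have hac : a < c := by
    rcases hc1.eq_or_lt with rfl | h
    · exact absurd ha (not_lt.2 hc3)
    · exact h
  refine ⟨c, ⟨hac, hc2⟩, le_antisymm ?_ hc3, hlt⟩
  have hcc : ContinuousWithinAt g (Ico a c) c :=
    (hg c ⟨hc1, hc2⟩).mono fun x hx => ⟨hx.1, hx.2.le.trans hc2⟩
  have hne : (𝓝[Ico a c] c).NeBot := by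
    rw [← mem_closure_iff_nhdsWithin_neBot, closure_Ico hac.ne]
    exact ⟨hac.le, le_rfl⟩
  exact le_of_tendsto hcc (eventually_nhdsWithin_of_forall fun r hr => (hlt r hr).le)

/-- The squared positive part is a differentiable cut-off, used in the auxiliary function of
`IsGlobalSol.exists_low_decreasing`. -/
theorem hasDerivAt_max_sq (x : ℝ) : HasDerivAt (fun y : ℝ => (max y 0) ^ 2) (2 * max x 0) x := by
  rcases lt_trichotomy x 0 with hx | rfl | hx
  · have : (fun y : ℝ => (max y 0) ^ 2) =ᶠ[𝓝 x] fun _ => 0 := by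
      filter_upwards [Iio_mem_nhds hx] with y hy
      rw [max_eq_right (le_of_lt hy)]; norm_num
    rw [max_eq_right hx.le, mul_zero]
    exact (hasDerivAt_const x (0 : ℝ)).congr_of_eventuallyEq this
  · rw [hasDerivAt_iff_isLittleO]
    have h2 : (fun y : ℝ => (max y 0) ^ 2) =o[𝓝 0] fun y : ℝ => y := by
      refine Asymptotics.IsBigO.trans_isLittleO (g := fun y : ℝ => y ^ 2) ?_
        (Asymptotics.isLittleO_pow_id one_lt_two)
      refine Asymptotics.isBigO_of_le _ fun y => ?_
      rcases le_total y 0 with h | h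
      · rw [max_eq_right h]; simp [sq_nonneg]
      · rw [max_eq_left h]
    simpa using h2
  · have : (fun y : ℝ => (max y 0) ^ 2) =ᶠ[𝓝 x] fun y => y ^ 2 := by
      filter_upwards [Ioi_mem_nhds hx] with y hy
      rw [max_eq_left (le_of_lt hy)]
    rw [max_eq_left hx.le]
    refine HasDerivAt.congr_of_eventuallyEq ?_ this
    simpa using hasDerivAt_pow 2 x

/-- If low values of a positive solution force a large slope and `f` is positive on high values,
then the solution is eventually low and decreasing. -/
theorem IsGlobalSol.exists_low_decreasing (hq : 1 < q) (hsol : IsGlobalSol d (phi q) f u w)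
    {τ T₁ s₁ s₂ v c K V lam : ℝ} (hτ0 : 0 < τ) (hT₁pos : 0 < T₁) (hs : s₁ ≤ s₂) (hs₂pos : 0 < s₂)
    (hvpos : 0 < v) (hlampos : 0 < lam) (hlamv : K + c ≤ lam * (2 * (s₂ - s₁)) * v)
    (hT₁ : 2 * V + lam * s₂ ^ 2 < c / 2 * T₁)
    (hpos : ∀ r ∈ Icc τ (τ + T₁), 0 < u r) (hwV : ∀ r ∈ Icc τ (τ + T₁), |w r| ≤ V)
    (hfK : ∀ r ∈ Icc τ (τ + T₁), -K ≤ f (u r))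
    (hfc : ∀ r ∈ Icc τ (τ + T₁), s₁ ≤ u r → c ≤ f (u r))
    (hlow : ∀ r ∈ Icc τ (τ + T₁), u r ≤ s₂ → v ≤ |phi q (w r)|)
    (hdamp : ∀ r ∈ Icc τ (τ + T₁), -((d : ℝ) / r * w r) ≤ c / 2) :
    ∃ t ∈ Icc τ (τ + T₁), u t ≤ s₂ ∧ w t ≤ 0 := by
  have hψc := continuous_phi hq
  by_contra hno
  push Not at hno
  have hsub0 : Icc τ (τ + T₁) ⊆ Ici 0 := fun r hr => hτ0.le.trans hr.1
  -- If u only rises while it is below s₂, then G is nonincreasing. Above s₁ the force c, less the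
  -- damping c/2, pays for the term c/2 · r. Below s₁ the slope is at least v, so the squared term
  -- falls at rate at least K + c and pays for the possibly negative f as well. Over a time T₁ the
  -- bounds on w and u contradict this.
  set G : ℝ → ℝ := fun r => w r + lam * (max (s₂ - u r) 0) ^ 2 + c / 2 * r with hG
  have hanti : AntitoneOn G (Icc τ (τ + T₁)) := by
    refine antitoneOn_of_hasDerivWithinAt_nonpos (convex_Icc _ _)
      (f' := fun r => -((d : ℝ) / r * w r) - f (u r) +
        lam * (2 * max (s₂ - u r) 0 * (-phi q (w r))) + c / 2) ?_ ?_ ?_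
    · have h1 := hsol.contu.mono hsub0
      have h2 := hsol.contw.mono hsub0
      fun_prop
    · intro r hr
      rw [interior_Icc] at hr
      have hr0 : 0 < r := hτ0.trans hr.1
      have h1 : HasDerivAt (fun r => s₂ - u r) (-phi q (w r)) r := (hsol.du hr0).const_sub s₂
      have h2 := (hasDerivAt_max_sq (s₂ - u r)).comp r h1
      have h3 := ((hsol.dw hr0).add (h2.const_mul lam)).add ((hasDerivAt_id' r).const_mul (c / 2))
      rw [mul_one] at h3
      exact h3.hasDerivWithinAt
    · intro r hr
      rw [interior_Icc] at hr
      have hr' := Ioo_subset_Icc_self hr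
      have h1 := hdamp r hr'
      have h2 := hfK r hr'
      have h3 := hpos r hr'
      have hup : u r ≤ s₂ → v ≤ phi q (w r) := fun hu => by
        have h5 := hno r hr' hu
        have h6 := hlow r hr' hu
        rwa [abs_of_pos (phi_pos hq h5)] at h6
      rcases le_total (u r) s₁ with hu1 | hu1
      · have hu2 : u r ≤ s₂ := by linarith
        rw [max_eq_left (by linarith)]
        have h5 := hup hu2
        have h6 : 2 * (s₂ - s₁) * v ≤ 2 * (s₂ - u r) * phi q (w r) := by gcongr
        have h7 := mul_le_mul_of_nonneg_left h6 hlampos.le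
        nlinarith
      · have h4 := hfc r hr' hu1
        have h5 : 0 ≤ 2 * max (s₂ - u r) 0 * phi q (w r) := by
          rcases le_total (u r) s₂ with hu2 | hu2
          · have := hup hu2
            have : 0 ≤ phi q (w r) := hvpos.le.trans this
            positivity
          · rw [max_eq_right (by linarith)]; simp
        have h6 := mul_nonneg hlampos.le h5
        nlinarith
  have h1 := hanti ⟨le_rfl, by linarith⟩ ⟨by linarith, le_rfl⟩
    (by linarith : τ ≤ τ + T₁)
  simp only [hG] at h1
  have h2 := (abs_le.1 (hwV τ ⟨le_rfl, by linarith⟩)).2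
  have h3 := (abs_le.1 (hwV (τ + T₁) ⟨by linarith, le_rfl⟩)).1
  have h4 : (max (s₂ - u τ) 0) ^ 2 ≤ s₂ ^ 2 := by
    have := hpos τ ⟨le_rfl, by linarith⟩
    gcongr
    exact max_le (by linarith) hs₂pos.le
  have h5 := mul_le_mul_of_nonneg_left h4 hlampos.le
  have h6 : 0 ≤ lam * (max (s₂ - u (τ + T₁)) 0) ^ 2 := by positivity
  nlinarith

/-- A low and decreasing solution with large slope reaches `0`. -/
theorem IsGlobalSol.exists_nonpos_of_low (hq : 1 < q) (hsol : IsGlobalSol d (phi q) f u w)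
    {t T₂ s₂ v : ℝ} (ht0 : 0 < t) (hT₂pos : 0 < T₂) (hvpos : 0 < v) (hT₂ : s₂ < v * T₂)
    (hut : u t ≤ s₂) (hwt : w t ≤ 0)
    (hlow : ∀ r ∈ Icc t (t + T₂), u r ≤ s₂ → v ≤ |phi q (w r)|) :
    u (t + T₂) ≤ 0 := by
  have hsub0 : Icc t (t + T₂) ⊆ Ici 0 := fun r hr => ht0.le.trans hr.1
  have hlowzero : ∀ r ∈ Icc t (t + T₂), u r ≤ s₂ → w r ≠ 0 := by
    intro r hr hur h0
    have := hlow r hr hur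
    rw [h0, phi_zero, abs_zero] at this
    linarith
  have hanti_of : ∀ b ≤ t + T₂, (∀ r ∈ Ico t b, w r < 0) → AntitoneOn u (Icc t b) := by
    intro b hb hw
    have hsb : Icc t b ⊆ Ici 0 := (Icc_subset_Icc_right hb).trans hsub0
    refine antitoneOn_of_hasDerivWithinAt_nonpos (convex_Icc _ _) (f' := fun r => phi q (w r))
      (hsol.contu.mono hsb) ?_ ?_
    · intro r hr
      rw [interior_Icc] at hr
      exact (hsol.du (ht0.trans hr.1)).hasDerivWithinAt
    · intro r hr
      rw [interior_Icc] at hr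
      have := monotone_phi hq (hw r ⟨hr.1.le, hr.2⟩).le
      rwa [phi_zero] at this
  have ht2 : t ∈ Icc t (t + T₂) := ⟨le_rfl, by linarith⟩
  -- While u is low, w cannot vanish because the slope is at least v; and as long as w < 0, u
  -- decreases and stays low.
  have hwneg : ∀ r ∈ Icc t (t + T₂), w r < 0 := by
    intro r hr
    by_contra hwr
    obtain ⟨t', ht', hz, hb⟩ := exists_first_zero hr.1
      (hsol.contw.mono ((Icc_subset_Icc_right hr.2).trans hsub0))
      (lt_of_le_of_ne hwt (hlowzero t ht2 hut)) (not_lt.1 hwr)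
    have hle : t' ≤ t + T₂ := ht'.2.trans hr.2
    have h1 := hanti_of t' hle hb ⟨le_rfl, ht'.1.le⟩ ⟨ht'.1.le, le_rfl⟩ ht'.1.le
    exact hlowzero t' ⟨ht'.1.le, hle⟩ (h1.trans hut) hz
  have hanti := hanti_of (t + T₂) le_rfl fun r hr => hwneg r ⟨hr.1, hr.2.le⟩
  have hfin : AntitoneOn (fun r => u r + v * r) (Icc t (t + T₂)) := by
    refine antitoneOn_of_hasDerivWithinAt_nonpos (convex_Icc _ _) (f' := fun r => phi q (w r) + v)
      (by have := hsol.contu.mono hsub0; fun_prop) ?_ ?_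
    · intro r hr
      rw [interior_Icc] at hr
      have := (hsol.du (ht0.trans hr.1)).fun_add
        ((hasDerivAt_id' r).const_mul v)
      rw [mul_one] at this
      exact this.hasDerivWithinAt
    · intro r hr
      rw [interior_Icc] at hr
      have hr' := Ioo_subset_Icc_self hr
      have h1 := hlow r hr' ((hanti ht2 hr' hr'.1).trans hut)
      have h2 := monotone_phi hq (hwneg r hr').le
      rw [phi_zero] at h2
      rw [abs_of_nonpos h2] at h1
      linarith
  have h1 := hfin ht2 ⟨by linarith, le_rfl⟩ (by linarith : t ≤ t + T₂)
  simp only at h1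
  nlinarith

/-- While the energy stays above a positive level, a solution cannot stay positive for long. -/
theorem exists_time_nonpos (hq : 1 < q) (hf : Continuous f) {βp Bp e₀ V : ℝ}
    (hβ : 0 < βp) (hB : βp ≤ Bp) (hF : ∀ s ∈ Icc 0 βp, primitive f s ≤ 0)
    (hfpos : ∀ s ∈ Icc βp Bp, 0 < f s) (he : 0 < e₀) (hV : 0 < V) :
    ∃ T > 0, ∃ M > 0, ∀ u w, IsGlobalSol d (phi q) f u w → ∀ τ ≥ M,
      (∀ r ∈ Icc τ (τ + T), u r ≤ Bp ∧ |w r| ≤ V ∧ e₀ ≤ energy (phi q) f u w r) →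
      ∃ r ∈ Icc τ (τ + T), u r ≤ 0 := by
  have hψc := continuous_phi hq
  have hF0 : primitive f βp < e₀ / 2 := (hF βp ⟨hβ.le, le_rfl⟩).trans_lt (by linarith)
  obtain ⟨δ, hδ, hFδ⟩ : ∃ δ > 0, ∀ s ∈ Icc 0 (βp + δ), primitive f s ≤ e₀ / 2 := by
    have := (continuous_primitive hf).continuousAt.eventually_lt_const hF0
    obtain ⟨δ, hδ, h⟩ := Metric.eventually_nhds_iff.1 this
    refine ⟨δ / 2, by linarith, fun s hs => ?_⟩
    rcases le_total s βp with h1 | h1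
    · exact (hF s ⟨hs.1, h1⟩).trans (by linarith)
    · refine (h ?_).le
      rw [Real.dist_eq, abs_of_nonneg (by linarith)]
      linarith [hs.2]
  obtain ⟨x₀, hx₀, hmin⟩ := isCompact_Icc.exists_isMinOn (nonempty_Icc.2 hB) hf.continuousOn
  set c := f x₀ with hc
  have hcpos : 0 < c := hfpos x₀ hx₀
  have hcle : ∀ s ∈ Icc βp Bp, c ≤ f s := fun s hs => hmin hs
  obtain ⟨K, hK⟩ := (isCompact_Icc (a := (0 : ℝ)) (b := Bp)).exists_bound_of_continuousOn
    hf.continuousOn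
  have hK0 : 0 ≤ K := (norm_nonneg _).trans (hK 0 ⟨le_rfl, hβ.le.trans hB⟩)
  set s₂ := βp + δ with hs₂
  -- For u ≤ s₂ one has F(u) ≤ e₀/2, so at least e₀/2 of the energy is in the primitive of φ_q,
  -- which is at most w φ_q(w) ≤ V |φ_q(w)|.
  set v := e₀ / (2 * V) with hv
  have hvpos : 0 < v := by positivity
  set lam := (K + c) / (δ * v) with hlam
  have hlampos : 0 < lam := by positivity
  have hlamv : lam * δ * v = K + c := by rw [hlam]; field_simp
  set T₁ := 2 / c * (2 * V + lam * s₂ ^ 2) + 1 with hT₁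
  set T₂ := s₂ / v + 1 with hT₂
  have hs₂pos : 0 < s₂ := by linarith
  have hT₁pos : 0 < T₁ := by positivity
  have hT₂pos : 0 < T₂ := by positivity
  refine ⟨T₁ + T₂, by positivity, 2 * d * V / c + 1, by positivity, fun u w hsol τ hτ hh => ?_⟩
  by_contra hcon
  push Not at hcon
  have hM : 0 < 2 * d * V / c + 1 := by positivity
  have hτ0 : 0 < τ := hM.trans_le hτ
  have hlow : ∀ r ∈ Icc τ (τ + (T₁ + T₂)), u r ≤ s₂ → v ≤ |phi q (w r)| := by
    intro r hr hur
    obtain ⟨h1, h2, h3⟩ := hh r hr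
    have h4 := hFδ (u r) ⟨(hcon r hr).le, hur⟩
    have h5 := (primitive_nonneg_le_mul (monotone_phi hq) hψc (phi_zero q) (w r)).2
    have h6 : e₀ / 2 ≤ |w r| * |phi q (w r)| := by
      rw [← abs_mul]
      refine le_trans ?_ (le_abs_self _)
      rw [energy] at h3
      linarith
    have h7 : |w r| * |phi q (w r)| ≤ V * |phi q (w r)| := by gcongr
    rw [hv, div_le_iff₀ (by positivity)]
    linarith
  have hdamp : ∀ r ∈ Icc τ (τ + (T₁ + T₂)), -((d : ℝ) / r * w r) ≤ c / 2 := by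
    intro r hr
    have hr0 : 0 < r := hτ0.trans_le hr.1
    have h1 : -(w r) ≤ V := (neg_le_abs _).trans (hh r hr).2.1
    have h2 : (d : ℝ) / r * V ≤ c / 2 := by
      rw [div_mul_eq_mul_div, div_le_iff₀ hr0]
      have h3 : 2 * d * V / c ≤ r := by linarith [hr.1]
      rw [div_le_iff₀ hcpos] at h3
      linarith
    have h3 : (d : ℝ) / r * (-(w r)) ≤ (d : ℝ) / r * V := by gcongr
    linarith
  have hsub : Icc τ (τ + T₁) ⊆ Icc τ (τ + (T₁ + T₂)) := Icc_subset_Icc_right (by linarith)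
  have hT₁' : c / 2 * T₁ = 2 * V + lam * s₂ ^ 2 + c / 2 := by rw [hT₁]; field_simp
  have hT₂' : v * T₂ = s₂ + v := by rw [hT₂]; field_simp
  obtain ⟨t, ht, hut, hwt⟩ := hsol.exists_low_decreasing (s₁ := βp + δ / 2) (s₂ := s₂) (K := K) hq
    hτ0 hT₁pos (by linarith) hs₂pos hvpos hlampos
    (by rw [← hlamv, hs₂]; refine le_of_eq ?_; ring) (by linarith)
    (fun r hr => hcon r (hsub hr)) (fun r hr => (hh r (hsub hr)).2.1)
    (fun r hr => (abs_le.1 (hK (u r) ⟨(hcon r (hsub hr)).le, (hh r (hsub hr)).1⟩)).1)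
    (fun r hr hu => hcle (u r) ⟨by linarith, (hh r (hsub hr)).1⟩)
    (fun r hr => hlow r (hsub hr)) (fun r hr => hdamp r (hsub hr))
  have hsub2 : Icc t (t + T₂) ⊆ Icc τ (τ + (T₁ + T₂)) :=
    Icc_subset_Icc ht.1 (by linarith [ht.2])
  have h1 := hsol.exists_nonpos_of_low hq (hτ0.trans_le ht.1) hT₂pos hvpos (by linarith) hut hwt
    fun r hr => hlow r (hsub2 hr)
  have h2 := hcon (t + T₂) (hsub2 ⟨by linarith, le_rfl⟩)
  linarith

theorem exists_abs_le_of_rpow_le (hq : 1 < q) (E : ℝ) : ∃ V > 0, ∀ x : ℝ, |x| ^ q / q ≤ E → |x| ≤ V := by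
  refine ⟨max 1 (q * E), by positivity, fun x hx => ?_⟩
  rcases le_total |x| 1 with h | h
  · exact h.trans (le_max_left _ _)
  · have h1 := Real.rpow_le_rpow_of_exponent_le h hq.le
    rw [Real.rpow_one] at h1
    rw [div_le_iff₀ (by linarith)] at hx
    exact (h1.trans hx).trans (by rw [mul_comm]; exact le_max_right _ _)

/-- A solution whose energy is positive at a large time has many zeros afterwards. -/
theorem exists_many_zeros (hq : 1 < q) (hf : Continuous f) {βm βp Bm Bp e₀ e₁ : ℝ}
    (hβm : βm < 0) (hβp : 0 < βp) (hBm : Bm ≤ βm) (hBp : βp ≤ Bp)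
    (hF : ∀ s ∈ Icc βm βp, primitive f s ≤ 0) (hfpos : ∀ s ∈ Icc βp Bp, 0 < f s)
    (hfneg : ∀ s ∈ Icc Bm βm, f s < 0) (he : 0 < e₀) (k : ℕ) :
    ∃ M > 0, ∀ u w, IsGlobalSol d (phi q) f u w → ∀ τ ≥ M, (∀ r ≥ τ, u r ∈ Icc Bm Bp) →
      e₀ ≤ energy (phi q) f u w τ → energy (phi q) f u w τ ≤ e₁ →
      ∃ y : ℕ → ℝ, (∀ i < k, y i < y (i + 1)) ∧
        ∀ i ≤ k, τ ≤ y i ∧ u (y i) = 0 ∧ 0 < energy (phi q) f u w (y i) := by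
  have hψc := continuous_phi hq
  obtain ⟨A, hA⟩ := (isCompact_Icc (a := Bm) (b := Bp)).exists_bound_of_continuousOn
    (continuous_primitive hf).continuousOn
  obtain ⟨V, hV, hVw⟩ := exists_abs_le_of_rpow_le hq (e₁ + A)
  obtain ⟨T, hT, M₁, hM₁, h1⟩ := exists_time_nonpos (d := d) hq hf hβp hBp
    (fun s hs => hF s ⟨by linarith [hs.1], hs.2⟩) hfpos (half_pos he) hV
  obtain ⟨T', hT', M₂, hM₂, h2⟩ := exists_time_nonpos (d := d) (f := reflect f) (βp := -βm)
    (Bp := -Bm) hq (continuous_reflect hf) (by linarith) (by linarith)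
    (fun s hs => by
      rw [primitive_reflect]; exact hF _ ⟨by linarith [hs.2], by linarith [hs.1]⟩)
    (fun s hs => by
      have := hfneg (-s) ⟨by linarith [hs.2], by linarith [hs.1]⟩
      simp only [reflect]; linarith) (half_pos he) hV
  -- Each window of length P contains a point with u ≤ 0 and one with u ≥ 0, hence a zero. The extra
  -- 1 separates the zeros of consecutive windows.
  set P := max T T' + 1 with hP
  have hTP : T + 1 ≤ P := by rw [hP]; gcongr; exact le_max_left _ _
  have hTP' : T' + 1 ≤ P := by rw [hP]; gcongr; exact le_max_right _ _
  have hP0 : 0 < P := by linarith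
  set D := d * V ^ q with hD
  have hD0 : 0 ≤ D := by positivity
  set S := (k + 1) * P with hS
  have hS0 : 0 < S := by positivity
  refine ⟨max (max M₁ M₂) (2 * D * S / e₀) , lt_max_of_lt_left (lt_max_of_lt_left hM₁),
    fun u w hsol τ hτ hrange hlow hhigh => ?_⟩
  have hτ1 : M₁ ≤ τ := le_trans (le_trans (le_max_left _ _) (le_max_left _ _)) hτ
  have hτ2 : M₂ ≤ τ := le_trans (le_trans (le_max_right _ _) (le_max_left _ _)) hτ
  have hτ3 : 2 * D * S / e₀ ≤ τ := le_trans (le_max_right _ _) hτ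
  have hτ0 : 0 < τ := hM₁.trans_le hτ1
  have hanti := hsol.antiI hψc hf (mul_phi_nonneg hq)
  have hw : ∀ r ≥ τ, |w r| ≤ V := by
    intro r hr
    refine hVw _ ?_
    have h3 := hanti hτ0.le (hτ0.le.trans hr) hr
    have h4 := (abs_le.1 (hA (u r) (hrange r hr))).1
    rw [energy, primitive_phi hq] at h3
    linarith
  have hsub0 : Ici τ ⊆ Ici 0 := Ici_subset_Ici.2 hτ0.le
  -- The energy decreases at rate at most D/τ, so for τ large at most e₀/2 is lost over the k+1
  -- windows.
  have hdrop : ∀ r ∈ Icc τ (τ + S), e₀ / 2 ≤ energy (phi q) f u w r := by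
    have hmono : MonotoneOn (fun r => energy (phi q) f u w r + D / τ * r) (Ici τ) := by
      refine monotoneOn_of_hasDerivWithinAt_nonneg (convex_Ici τ)
        (f' := fun r => -((d : ℝ) / r * (w r * phi q (w r))) + D / τ) ?_ ?_ ?_
      · have := (hsol.contI hψc hf).mono hsub0
        fun_prop
      · intro r hr
        rw [interior_Ici] at hr
        have := (hsol.dI hψc hf (hτ0.trans hr)).fun_add ((hasDerivAt_id' r).const_mul (D / τ))
        rw [mul_one] at this
        exact this.hasDerivWithinAt
      · intro r hr
        rw [interior_Ici] at hr
        have hr' : τ < r := hr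
        have hr0 := hτ0.trans hr'
        have h3 : w r * phi q (w r) ≤ V ^ q := by
          rw [mul_phi hq]
          exact Real.rpow_le_rpow (abs_nonneg _) (hw r hr'.le) (by linarith)
        have h4 : (d : ℝ) / r * (w r * phi q (w r)) ≤ d / τ * V ^ q := by
          have := mul_phi_nonneg hq (w r)
          gcongr
        have h5 : (d : ℝ) / τ * V ^ q = D / τ := by rw [hD]; ring
        linarith
    intro r hr
    have h3 := hmono (mem_Ici.2 le_rfl) (mem_Ici.2 hr.1) hr.1
    simp only at h3
    have h4 : D / τ * (r - τ) ≤ D / τ * S := by gcongr; linarith [hr.2]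
    have h5 : D / τ * S ≤ e₀ / 2 := by
      rw [div_mul_eq_mul_div, div_le_iff₀ hτ0]
      rw [div_le_iff₀ he] at hτ3
      linarith
    linarith
  have hzero : ∀ i : ℕ, i ≤ k → ∃ y ∈ Icc (τ + i * P) (τ + i * P + (P - 1)), u y = 0 := by
    intro i hi
    have hi' : (i : ℝ) ≤ k := by exact_mod_cast hi
    have hiP : (i : ℝ) * P + P ≤ S := by rw [hS]; nlinarith
    have hiP0 : 0 ≤ (i : ℝ) * P := by positivity
    obtain ⟨a, ha, hua⟩ := h1 u w hsol (τ + i * P) (by linarith) fun r hr =>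
      ⟨(hrange r (by linarith [hr.1])).2, hw r (by linarith [hr.1]),
        hdrop r ⟨by linarith [hr.1], by linarith [hr.2]⟩⟩
    obtain ⟨b, hb, hub⟩ := h2 (-u) (-w) hsol.reflect_phi (τ + i * P) (by linarith) fun r hr => by
      rw [energy_reflect_phi, Pi.neg_apply, Pi.neg_apply, abs_neg]
      exact ⟨neg_le_neg (hrange r (by linarith [hr.1])).1, hw r (by linarith [hr.1]),
        hdrop r ⟨by linarith [hr.1], by linarith [hr.2]⟩⟩
    rw [Pi.neg_apply, neg_nonpos] at hub
    have hsub : uIcc a b ⊆ Icc (τ + i * P) (τ + i * P + (P - 1)) := by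
      have ha' : a ∈ Icc (τ + i * P) (τ + i * P + (P - 1)) := ⟨ha.1, by linarith [ha.2]⟩
      have hb' : b ∈ Icc (τ + i * P) (τ + i * P + (P - 1)) := ⟨hb.1, by linarith [hb.2]⟩
      exact uIcc_subset_Icc ha' hb'
    have hiv := intermediate_value_uIcc (hsol.contu.mono (hsub.trans fun r hr =>
      mem_Ici.2 (by linarith [hr.1])))
    obtain ⟨y, hy, hy0⟩ := hiv (show (0 : ℝ) ∈ uIcc (u a) (u b) from by
      rw [uIcc_of_le (hua.trans hub)]; exact ⟨hua, hub⟩)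
    exact ⟨y, hsub hy, hy0⟩
  choose! y hy hy0 using hzero
  refine ⟨y, fun i hi => ?_, fun i hi => ⟨?_, hy0 i hi, ?_⟩⟩
  · have h3 := (hy i hi.le).2
    have h4 := (hy (i + 1) hi).1
    push_cast at h4
    linarith
  · have h3 := (hy i hi).1
    have : 0 ≤ (i : ℝ) * P := by positivity
    linarith
  · have h3 := hy i hi
    have hi' : (i : ℝ) ≤ k := by exact_mod_cast hi
    have hiP : (i : ℝ) * P + P ≤ S := by rw [hS]; nlinarith
    have : 0 ≤ (i : ℝ) * P := by positivity
    exact (half_pos he).trans_le (hdrop _ ⟨by linarith [h3.1], by linarith [h3.2]⟩)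

end RadialBoundState

/-! ### Sign changes, decay at infinity and trapping near 0. -/

namespace RadialBoundState

variable {d : ℕ} {q η T : ℝ} {ψ f u w : ℝ → ℝ}

theorem eventually_right_of_hasDerivAt {g : ℝ → ℝ} {c g' : ℝ} (h : HasDerivAt g g' c)
    (h0 : g c = 0) (hg' : 0 < g') : ∀ᶠ t in 𝓝[>] c, 0 < g t := by
  have h1 := (hasDerivAt_iff_tendsto_slope.1 h).eventually_const_lt hg'
  have h2 : ∀ᶠ t in 𝓝[>] c, 0 < slope g c t :=
    nhdsWithin_mono c (fun x hx => ne_of_gt hx) h1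
  filter_upwards [h2, self_mem_nhdsWithin] with t ht htc
  rw [slope_def_field, h0, sub_zero] at ht
  have : 0 < t - c := sub_pos.2 htc
  exact (div_pos_iff_of_pos_right this).1 ht

theorem eventually_left_of_hasDerivAt {g : ℝ → ℝ} {c g' : ℝ} (h : HasDerivAt g g' c)
    (h0 : g c = 0) (hg' : 0 < g') : ∀ᶠ t in 𝓝[<] c, g t < 0 := by
  have h1 := (hasDerivAt_iff_tendsto_slope.1 h).eventually_const_lt hg'
  have h2 : ∀ᶠ t in 𝓝[<] c, 0 < slope g c t :=
    nhdsWithin_mono c (fun x hx => ne_of_lt hx) h1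
  filter_upwards [h2, self_mem_nhdsWithin] with t ht htc
  rw [slope_def_field, h0, sub_zero] at ht
  have h3 : t - c < 0 := sub_neg.2 htc
  by_contra hcon
  exact absurd ht (not_lt.2 (div_nonpos_of_nonneg_of_nonpos (not_lt.1 hcon) h3.le))

theorem chain_lt {y : ℕ → ℝ} {k : ℕ} (hy : ∀ i < k, y i < y (i + 1)) {i j : ℕ} (hij : i < j)
    (hj : j ≤ k) : y i < y j := by
  induction j, hij using Nat.le_induction with
  | base => exact hy i (by omega)
  | succ n hn ih => exact (ih (by omega)).trans (hy n (by omega))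

/-- `u` takes values of alternating signs at `K + 1` points of `[0, T]`, starting with a positive
one. -/
def Alternates (K : ℕ) (T : ℝ) (u : ℝ → ℝ) : Prop :=
  ∃ t : ℕ → ℝ, (∀ i < K, t i < t (i + 1)) ∧ ∀ i ≤ K, t i ∈ Icc 0 T ∧ 0 < (-1) ^ i * u (t i)

/-- The given zeros may skip others, but this does no harm: the first zero after a point of known
sign is simple, so the sign flips there, and that zero is not later than the given one. -/
theorem alternates_of_zeros {k : ℕ} {y : ℕ → ℝ} (hu : ContinuousOn u (Ici 0)) (hu0 : 0 < u 0)
    (hy : ∀ i < k, y i < y (i + 1)) (hy0 : ∀ i ≤ k, 0 < y i ∧ y i < T ∧ u (y i) = 0)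
    (hsimple : ∀ r, 0 < r → r ≤ y k → u r = 0 → ∃ c, c ≠ 0 ∧ HasDerivAt u c r) :
    Alternates (k + 1) T u := by
  -- Invariant of the induction: the i-th sign point lies strictly before the i-th given zero, and
  -- the last one, i = k+1, before T.
  set Y : ℕ → ℝ := fun i => if i ≤ k then y i else T with hY
  have hYT : ∀ i, Y i ≤ T := by
    intro i
    simp only [hY]
    split_ifs with h
    · exact (hy0 i h).2.1.le
    · exact le_rfl
  have hyk : ∀ j ≤ k, y j ≤ y k := fun j hj => by
    rcases hj.eq_or_lt with rfl | h
    · exact le_rfl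
    · exact (chain_lt hy h le_rfl).le
  have key : ∀ j ≤ k + 1, ∃ t : ℕ → ℝ, (∀ i < j, t i < t (i + 1)) ∧
      ∀ i ≤ j, 0 ≤ t i ∧ t i < Y i ∧ 0 < (-1) ^ i * u (t i) := by
    intro j
    induction j with
    | zero =>
      intro _
      refine ⟨fun _ => 0, by simp, fun i hi => ?_⟩
      obtain rfl : i = 0 := by omega
      simp only [hY, zero_le, if_true, pow_zero, one_mul]
      exact ⟨le_rfl, (hy0 0 (Nat.zero_le _)).1, hu0⟩
    | succ j ih =>
      intro hj
      obtain ⟨t, ht1, ht2⟩ := ih (by omega)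
      have hjk : j ≤ k := by omega
      obtain ⟨hj0, hjY, hjs⟩ := ht2 j le_rfl
      have hYj : Y j = y j := by simp [hY, hjk]
      rw [hYj] at hjY
      have hYj1 : y j < Y (j + 1) := by
        simp only [hY]
        split_ifs with h
        · exact hy j (by omega)
        · exact (hy0 j hjk).2.1
      have hcont : ContinuousOn (fun r => -((-1) ^ j * u r)) (Icc (t j) (y j)) := by
        have := hu.mono (fun r (hr : r ∈ Icc (t j) (y j)) => mem_Ici.2 (hj0.trans hr.1))
        fun_prop
      obtain ⟨c, hc, hc0, hcneg⟩ := exists_first_zero hjY.le hcont (by linarith)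
        (by rw [(hy0 j hjk).2.2]; simp)
      have hcpos : 0 < c := hj0.trans_lt hc.1
      have huc : u c = 0 := by
        have h1 : ((-1 : ℝ) ^ j) ≠ 0 := by positivity
        have h2 : (-1 : ℝ) ^ j * u c = 0 := by simpa using hc0
        exact (mul_eq_zero.1 h2).resolve_left h1
      obtain ⟨c', hc', hd⟩ := hsimple c hcpos (hc.2.trans (hyk j hjk)) huc
      have hdg : HasDerivAt (fun r => -((-1) ^ j * u r)) (-((-1) ^ j * c')) c :=
        (hd.const_mul _).neg
      have hne : -((-1 : ℝ) ^ j * c') ≠ 0 := by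
        have h1 : ((-1 : ℝ) ^ j) ≠ 0 := by positivity
        simp [hc']
      have hpos : 0 < -((-1 : ℝ) ^ j * c') := by
        rcases lt_or_gt_of_ne hne with h | h
        · exfalso
          have h1 := eventually_left_of_hasDerivAt hdg.neg (by simpa using hc0)
            (by linarith : 0 < -(-((-1 : ℝ) ^ j * c')))
          have h2 : ∀ᶠ r in 𝓝[<] c, r ∈ Ico (t j) c := Ico_mem_nhdsLT hc.1
          obtain ⟨r, hr1, hr2⟩ := (h1.and h2).exists
          have := hcneg r hr2
          simp only [Pi.neg_apply] at hr1
          linarith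
        · exact h
      have h1 := eventually_right_of_hasDerivAt hdg hc0 hpos
      have h2 : ∀ᶠ r in 𝓝[>] c, r ∈ Ioo c (Y (j + 1)) :=
        Ioo_mem_nhdsGT (hc.2.trans_lt hYj1)
      obtain ⟨r, hr1, hr2⟩ := (h1.and h2).exists
      refine ⟨Function.update t (j + 1) r, fun i hi => ?_, fun i hi => ?_⟩
      · rw [Function.update_of_ne (by omega)]
        rcases Nat.lt_succ_iff_lt_or_eq.1 hi with h | rfl
        · rw [Function.update_of_ne (by omega)]; exact ht1 i h
        · rw [Function.update_self]; exact hc.1.trans hr2.1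
      · rcases Nat.le_succ_iff.1 hi with h | rfl
        · rw [Function.update_of_ne (by omega)]; exact ht2 i h
        · rw [Function.update_self]
          refine ⟨hcpos.le.trans hr2.1.le, hr2.2, ?_⟩
          rw [pow_succ]; linarith
  obtain ⟨t, ht1, ht2⟩ := key (k + 1) le_rfl
  exact ⟨t, ht1, fun i hi => ⟨⟨(ht2 i hi).1, (ht2 i hi).2.1.le.trans (hYT i)⟩, (ht2 i hi).2.2⟩⟩

namespace IsGlobalSol

/-- A solution with positive energy cannot start to increase again while it is positive. -/
theorem neg_of_neg (hsol : IsGlobalSol d (phi q) f u w) {βp Bp r₁ : ℝ}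
    (hr₁ : 0 < r₁) (hF : ∀ s ∈ Ioo 0 βp, primitive f s < 0) (hfpos : ∀ s ∈ Icc βp Bp, 0 < f s)
    (hu : ∀ r ≥ r₁, 0 < u r ∧ u r ≤ Bp) (hI : ∀ r ≥ r₁, 0 < energy (phi q) f u w r)
    {t r : ℝ} (ht : r₁ ≤ t) (hw : w t < 0) (hr : t ≤ r) : w r < 0 := by
  by_contra hcon
  obtain ⟨c, hc, hc0, hneg⟩ := exists_first_zero hr
    (hsol.contw.mono fun x hx => mem_Ici.2 (hr₁.le.trans (ht.trans hx.1))) hw (not_lt.1 hcon)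
  have hrc : r₁ ≤ c := ht.trans hc.1.le
  have h1 := hI c hrc
  rw [energy, hc0, primitive_zero, zero_add] at h1
  -- Where w vanishes the energy is F(u). Its positivity forces u ≥ βp, hence f(u) > 0 and w is
  -- strictly decreasing there, so it cannot have come up from negative values.
  have h2 : βp ≤ u c := by
    by_contra h
    exact absurd h1 (not_lt.2 (hF _ ⟨(hu c hrc).1, not_le.1 h⟩).le)
  have h3 := hfpos _ ⟨h2, (hu c hrc).2⟩
  have h4 := (hsol.dw (hr₁.trans_le hrc)).neg
  rw [hc0, mul_zero, neg_zero, zero_sub, neg_neg] at h4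
  have h5 := eventually_left_of_hasDerivAt h4 (by simp [hc0]) h3
  have h6 : ∀ᶠ x in 𝓝[<] c, x ∈ Ico t c := Ico_mem_nhdsLT hc.1
  obtain ⟨x, hx1, hx2⟩ := (h5.and h6).exists
  have := hneg x hx2
  simp only [Pi.neg_apply] at hx1
  linarith

/-- A positive solution with positive energy has a limit at infinity. -/
theorem exists_tendsto (hq : 1 < q) (hsol : IsGlobalSol d (phi q) f u w) {βp Bp r₁ : ℝ}
    (hr₁ : 0 < r₁) (hF : ∀ s ∈ Ioo 0 βp, primitive f s < 0) (hfpos : ∀ s ∈ Icc βp Bp, 0 < f s)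
    (hu : ∀ r ≥ r₁, 0 < u r ∧ u r ≤ Bp) (hI : ∀ r ≥ r₁, 0 < energy (phi q) f u w r) :
    ∃ l ∈ Icc 0 Bp, Tendsto u atTop (𝓝 l) := by
  have hex : ∃ l, Tendsto u atTop (𝓝 l) := by
    by_cases hneg : ∃ t ≥ r₁, w t < 0
    · obtain ⟨t, ht, hwt⟩ := hneg
      have hanti : AntitoneOn u (Ici t) := by
        refine antitoneOn_of_hasDerivWithinAt_nonpos (convex_Ici t) (f' := fun r => phi q (w r))
          (hsol.contu.mono (Ici_subset_Ici.2 (hr₁.le.trans ht))) ?_ ?_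
        · intro r hr
          rw [interior_Ici] at hr
          exact (hsol.du ((hr₁.trans_le ht).trans hr)).hasDerivWithinAt
        · intro r hr
          rw [interior_Ici] at hr
          have := monotone_phi hq
            (hsol.neg_of_neg hr₁ hF hfpos hu hI ht hwt (le_of_lt hr)).le
          rwa [phi_zero] at this
      have h1 : Antitone fun r => u (max r t) := fun a b hab =>
        hanti (mem_Ici.2 (le_max_right _ _)) (mem_Ici.2 (le_max_right _ _)) (max_le_max_right _ hab)
      have h2 := tendsto_atTop_ciInf h1 ⟨0, by
        rintro _ ⟨r, rfl⟩; exact (hu _ (ht.trans (le_max_right _ _))).1.le⟩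
      refine ⟨_, h2.congr' ?_⟩
      filter_upwards [eventually_ge_atTop t] with r hr
      rw [max_eq_left hr]
    · push Not at hneg
      have hmono : MonotoneOn u (Ici r₁) := by
        refine monotoneOn_of_hasDerivWithinAt_nonneg (convex_Ici r₁) (f' := fun r => phi q (w r))
          (hsol.contu.mono (Ici_subset_Ici.2 hr₁.le)) ?_ ?_
        · intro r hr
          rw [interior_Ici] at hr
          exact (hsol.du (hr₁.trans hr)).hasDerivWithinAt
        · intro r hr
          rw [interior_Ici] at hr
          have := monotone_phi hq (hneg r (le_of_lt hr))
          rwa [phi_zero] at this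
      have h1 : Monotone fun r => u (max r r₁) := fun a b hab =>
        hmono (mem_Ici.2 (le_max_right _ _)) (mem_Ici.2 (le_max_right _ _)) (max_le_max_right _ hab)
      have h2 := tendsto_atTop_ciSup h1 ⟨Bp, by
        rintro _ ⟨r, rfl⟩; exact (hu _ (le_max_right _ _)).2⟩
      refine ⟨_, h2.congr' ?_⟩
      filter_upwards [eventually_ge_atTop r₁] with r hr
      rw [max_eq_left hr]
  obtain ⟨l, hl⟩ := hex
  have h1 : ∀ᶠ r in atTop, u r ∈ Icc 0 Bp := by
    filter_upwards [eventually_ge_atTop r₁] with r hr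
    exact ⟨(hu r hr).1.le, (hu r hr).2⟩
  exact ⟨l, isClosed_Icc.mem_of_tendsto hl h1, hl⟩

/-- A positive solution whose energy is positive and tends to `0` tends to `0`. -/
theorem tendsto_zero_of_pos (hq : 1 < q) (hf : Continuous f)
    (hsol : IsGlobalSol d (phi q) f u w) {βp Bp r₁ : ℝ}
    (hr₁ : 0 < r₁) (hF : ∀ s ∈ Ioo 0 βp, primitive f s < 0) (hfpos : ∀ s ∈ Icc βp Bp, 0 < f s)
    (hu : ∀ r ≥ r₁, 0 < u r ∧ u r ≤ Bp) (hI : ∀ r ≥ r₁, 0 < energy (phi q) f u w r)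
    (hI0 : Tendsto (energy (phi q) f u w) atTop (𝓝 0)) : Tendsto u atTop (𝓝 0) := by
  obtain ⟨l, hl, hul⟩ := hsol.exists_tendsto hq hr₁ hF hfpos hu hI
  have hψc := continuous_phi hq
  have hFu : Tendsto (fun r => primitive f (u r)) atTop (𝓝 (primitive f l)) :=
    ((continuous_primitive hf).tendsto l).comp hul
  have hH : Tendsto (fun r => |w r| ^ q / q) atTop (𝓝 (-primitive f l)) := by
    have := hI0.sub hFu
    rw [zero_sub] at this
    refine this.congr fun r => ?_
    rw [energy, primitive_phi hq]; ring
  obtain ⟨V, hV, hVw⟩ := exists_abs_le_of_rpow_le hq (-primitive f l + 1)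
  have hw : ∀ᶠ r in atTop, |w r| ≤ V := by
    filter_upwards [hH.eventually_lt_const (by linarith : -primitive f l < -primitive f l + 1)]
      with r hr
    exact hVw _ hr.le
  -- times at which the slope is small
  have hξ : ∀ r : ℝ, ∃ ξ, 0 < r → ξ ∈ Ioo r (r + 1) ∧ phi q (w ξ) = u (r + 1) - u r := by
    intro r
    by_cases hr : 0 < r
    · obtain ⟨ξ, h1, h2⟩ := exists_hasDerivAt_eq_slope u (fun r => phi q (w r))
        (by linarith : r < r + 1) (hsol.contu.mono fun x hx => mem_Ici.2 (hr.le.trans hx.1))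
        fun x hx => hsol.du (hr.trans hx.1)
      exact ⟨ξ, fun _ => ⟨h1, by rw [h2]; simp⟩⟩
    · exact ⟨0, fun h => absurd h hr⟩
  choose ξ hξ using hξ
  have hξtop : Tendsto ξ atTop atTop := by
    refine tendsto_atTop_mono' _ ?_ tendsto_id
    filter_upwards [eventually_gt_atTop 0] with r hr
    exact (hξ r hr).1.1.le
  have hψ0 : Tendsto (fun r => phi q (w (ξ r))) atTop (𝓝 0) := by
    have h1 : Tendsto (fun r => u (r + 1) - u r) atTop (𝓝 (l - l)) :=
      (hul.comp (tendsto_atTop_add_const_right _ 1 tendsto_id)).sub hul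
    rw [sub_self] at h1
    refine h1.congr' ?_
    filter_upwards [eventually_gt_atTop 0] with r hr
    exact (hξ r hr).2.symm
  have hH0 : Tendsto (fun r => |w (ξ r)| ^ q / q) atTop (𝓝 0) := by
    have h1 := (hψ0.abs).const_mul V
    rw [abs_zero, mul_zero] at h1
    refine squeeze_zero' (Eventually.of_forall fun r => by positivity) ?_ h1
    filter_upwards [hξtop.eventually hw] with r hr
    have h2 := (primitive_nonneg_le_mul (monotone_phi hq) hψc (phi_zero q) (w (ξ r))).2
    rw [primitive_phi hq] at h2
    refine h2.trans ((le_abs_self _).trans ?_)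
    rw [abs_mul]
    gcongr
  -- The kinetic part has a limit, and along the mean-value times ξ this limit is 0; so F(l) = 0.
  have hFl : primitive f l = 0 := by
    have := tendsto_nhds_unique (hH.comp hξtop) hH0
    linarith
  rcases hl.1.eq_or_lt with h0 | h0
  · rwa [← h0] at hul
  exfalso
  have hβl : βp ≤ l := by
    by_contra h
    exact absurd hFl (hF l ⟨h0, not_le.1 h⟩).ne
  have hfl : 0 < f l := hfpos l ⟨hβl, hl.2⟩
  -- A limit l ≥ βp has f(l) > 0, so w would decrease linearly although it is bounded.
  have h1 : ∀ᶠ r in atTop, -((d : ℝ) / r * w r) - f (u r) ≤ -(f l / 4) := by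
    have h2 : ∀ᶠ r in atTop, f l / 2 < f (u r) :=
      ((hf.tendsto l).comp hul).eventually_const_lt (by linarith)
    filter_upwards [h2, hw, eventually_gt_atTop 0, eventually_ge_atTop (4 * (d * V) / f l)]
      with r h3 h4 h5 h6
    have h7 : (d : ℝ) / r * (-w r) ≤ d / r * V := by
      have := (neg_le_abs _).trans h4
      gcongr
    have h8 : (d : ℝ) / r * V ≤ f l / 4 := by
      rw [div_mul_eq_mul_div, div_le_iff₀ h5]
      rw [div_le_iff₀ hfl] at h6
      linarith
    linarith
  obtain ⟨R, hR⟩ := eventually_atTop.1 ((h1.and hw).and (eventually_gt_atTop (0 : ℝ)))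
  have hR0 : 0 < R := (hR R le_rfl).2
  have hanti : AntitoneOn (fun r => w r + f l / 4 * r) (Ici R) := by
    refine antitoneOn_of_hasDerivWithinAt_nonpos (convex_Ici R)
      (f' := fun r => -((d : ℝ) / r * w r) - f (u r) + f l / 4) ?_ ?_ ?_
    · have := hsol.contw.mono (Ici_subset_Ici.2 hR0.le)
      fun_prop
    · intro r hr
      rw [interior_Ici] at hr
      have := (hsol.dw (hR0.trans hr)).fun_add ((hasDerivAt_id' r).const_mul (f l / 4))
      rw [mul_one] at this
      exact this.hasDerivWithinAt
    · intro r hr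
      rw [interior_Ici] at hr
      have := (hR r (le_of_lt hr)).1.1
      linarith
  set x := 4 * (2 * V + 1) / f l with hx
  have hx0 : 0 < x := by positivity
  have h2 := hanti (mem_Ici.2 le_rfl) (mem_Ici.2 (by linarith : R ≤ R + x)) (by linarith)
  have h3 := (abs_le.1 (hR R le_rfl).1.2).2
  have h4 := (abs_le.1 (hR (R + x) (by linarith)).1.2).1
  have h5 : f l / 4 * x = 2 * V + 1 := by rw [hx]; field_simp
  simp only at h2
  nlinarith

/-- While `F(u) ≤ 0`, the energy decays faster than `1 / r`. -/
theorem eventually_mul_energy_lt (hq : 1 < q) (hf : Continuous f) (hd : 1 ≤ d)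
    (hsol : IsGlobalSol d (phi q) f u w) {r₁ : ℝ} (hr₁ : 0 < r₁)
    (hF : ∀ r ≥ r₁, primitive f (u r) ≤ 0) {ε : ℝ} (hε : 0 < ε) :
    ∀ᶠ r in atTop, r * energy (phi q) f u w r < ε := by
  have hψc := continuous_phi hq
  -- With this exponent the terms in |w|^q cancel in the derivative of r^κ I, which leaves κ r^(κ-1)
  -- F(u) ≤ 0. As d ≥ 1 and q > 1, κ exceeds 1.
  set κ := d * q with hκ
  have hd' : (1 : ℝ) ≤ d := by exact_mod_cast hd
  have hκ1 : 1 < κ := by nlinarith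
  have hanti : AntitoneOn (fun r => r ^ κ * energy (phi q) f u w r) (Ici r₁) := by
    refine antitoneOn_of_hasDerivWithinAt_nonpos (convex_Ici r₁)
      (f' := fun r => κ * r ^ (κ - 1) * primitive f (u r)) ?_ ?_ ?_
    · refine ContinuousOn.mul ?_ ((hsol.contI hψc hf).mono (Ici_subset_Ici.2 hr₁.le))
      exact fun r hr => (Real.continuousAt_rpow_const r κ
        (Or.inl (hr₁.trans_le hr).ne')).continuousWithinAt
    · intro r hr
      rw [interior_Ici] at hr
      have hr0 : 0 < r := hr₁.trans hr
      have h1 := (Real.hasDerivAt_rpow_const (p := κ) (Or.inl hr0.ne')).fun_mul (hsol.dI hψc hf hr0)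
      refine h1.hasDerivWithinAt.congr_deriv ?_
      have h2 : r ^ κ = r ^ (κ - 1) * r := by
        rw [← Real.rpow_add_one hr0.ne']; congr 1; ring
      rw [h2, mul_phi hq, energy, primitive_phi hq, hκ]
      field_simp
      ring
    · intro r hr
      rw [interior_Ici] at hr
      have h1 := hF r (le_of_lt hr)
      have h2 : 0 ≤ κ * r ^ (κ - 1) := by
        have := Real.rpow_nonneg (hr₁.trans hr).le (κ - 1)
        positivity
      exact mul_nonpos_of_nonneg_of_nonpos h2 h1
  set C := r₁ ^ κ * energy (phi q) f u w r₁ with hC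
  have hlim : Tendsto (fun r : ℝ => C * r ^ (-(κ - 1))) atTop (𝓝 0) := by
    simpa using (tendsto_rpow_neg_atTop (by linarith : 0 < κ - 1)).const_mul C
  filter_upwards [hlim.eventually_lt_const hε, eventually_ge_atTop r₁] with r h1 h2
  refine lt_of_le_of_lt ?_ h1
  have hr0 : 0 < r := hr₁.trans_le h2
  have h3 := hanti (mem_Ici.2 le_rfl) (mem_Ici.2 h2) h2
  simp only at h3
  rw [← hC] at h3
  have h4 : r * energy (phi q) f u w r = r ^ κ * energy (phi q) f u w r * r ^ (-(κ - 1)) := by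
    have : r ^ κ * r ^ (-(κ - 1)) = r := by
      rw [← Real.rpow_add hr0]; simp
    rw [mul_right_comm, this]
  rw [h4]
  have := Real.rpow_nonneg hr0.le (-(κ - 1))
  gcongr

end IsGlobalSol

namespace IsSol

/-- A solution with small energy loses all its energy before it climbs from `x₁` to `x₂`. -/
theorem climb_bound (h : IsSol d η ψ f T u w) (hψ : Continuous ψ) (hm : Monotone ψ) (h0 : ψ 0 = 0)
    (hf : Continuous f) (hη : 0 ≤ η) (hd : 1 ≤ d) {r₀ s x₁ x₂ μ w₀ v₀ ε : ℝ} (hr₀ : 0 < r₀)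
    (hrs : r₀ ≤ s) (hsT : s ≤ T) (hx : x₁ < x₂) (hur : u r₀ < x₁) (hus : u s = x₂)
    (hux : ∀ r ∈ Icc r₀ s, u r ≤ x₂) (hF : ∀ r ∈ Icc r₀ s, primitive f (u r) ≤ 0)
    (hFμ : ∀ x ∈ Icc x₁ x₂, primitive f x ≤ -μ) (hIs : 0 ≤ energy ψ f u w s)
    (hw₀ : 0 < w₀) (hv₀ : 0 < v₀) (hH : ∀ x, μ ≤ primitive ψ x → w₀ ≤ |x| ∧ v₀ ≤ |ψ x|)
    (hε : (r₀ + η) * energy ψ f u w r₀ ≤ ε) :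
    d * w₀ * (x₂ - x₁) ≤ ε * (1 + (x₂ - x₁) / (v₀ * r₀)) := by
  have hd' : (1 : ℝ) ≤ d := by exact_mod_cast hd
  have hpos : ∀ x, 0 ≤ x * ψ x := fun x =>
    (primitive_nonneg_le_mul hm hψ h0 x).1.trans (primitive_nonneg_le_mul hm hψ h0 x).2
  have hsub : Icc r₀ s ⊆ Icc 0 T := Icc_subset_Icc hr₀.le hsT
  have hsubo : Ioo r₀ s ⊆ Ioo 0 T := Ioo_subset_Ioo hr₀.le hsT
  have hanti := h.antitoneOn_energy hψ hf hη hpos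
  have hI : ∀ r ∈ Icc r₀ s, 0 ≤ energy ψ f u w r := fun r hr =>
    hIs.trans (hanti (hsub hr) (hsub ⟨hrs, le_rfl⟩) hr.2)
  -- the last time below `x₁`
  obtain ⟨t, ht, hut, htx⟩ : ∃ t ∈ Ico r₀ s, u t = x₁ ∧ ∀ r ∈ Ioc t s, x₁ < u r := by
    have hc : ContinuousOn (fun r => x₁ - u (-r)) (Icc (-s) (-r₀)) := by
      have := (h.contu.mono hsub).comp (continuous_neg.continuousOn (s := Icc (-s) (-r₀)))
        fun r hr => ⟨by linarith [hr.2], by linarith [hr.1]⟩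
      exact continuousOn_const.sub this
    obtain ⟨c, hc1, hc2, hc3⟩ := exists_first_zero (by linarith) hc
      (by simp only [neg_neg]; linarith) (by simp only [neg_neg]; linarith)
    refine ⟨-c, ⟨by linarith [hc1.2], by linarith [hc1.1]⟩, by linarith, fun r hr => ?_⟩
    have := hc3 (-r) ⟨by linarith [hr.2], by linarith [hr.1]⟩
    rw [neg_neg] at this
    linarith
  have hts : Icc t s ⊆ Icc r₀ s := Icc_subset_Icc_left ht.1
  have huI : ∀ r ∈ Icc t s, u r ∈ Icc x₁ x₂ := by
    intro r hr
    refine ⟨?_, hux r (hts hr)⟩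
    rcases hr.1.eq_or_lt with rfl | h1
    · exact hut.ge
    · exact (htx r ⟨h1, hr.2⟩).le
  -- Between x₁ and x₂ one has F(u) ≤ -μ while the energy is nonnegative, so the kinetic part is at
  -- least μ.
  have hbig : ∀ r ∈ Icc t s, w₀ ≤ |w r| ∧ v₀ ≤ |ψ (w r)| := by
    intro r hr
    refine hH _ ?_
    have h1 := hI r (hts hr)
    have h2 := hFμ _ (huI r hr)
    rw [energy] at h1
    linarith
  have hwpos : ∀ r ∈ Icc t s, 0 < w r := by
    obtain ⟨ξ, hξ, hξs⟩ := exists_hasDerivAt_eq_slope u (fun r => ψ (w r)) ht.2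
      (h.contu.mono (hts.trans hsub)) fun r hr => h.du r (hsubo ⟨ht.1.trans_lt hr.1, hr.2⟩)
    have h1 : 0 < ψ (w ξ) := by
      rw [hξs]; exact div_pos (by linarith) (by linarith [ht.2])
    have h2 : 0 < w ξ := by
      by_contra hcon
      have := hm (not_lt.1 hcon)
      rw [h0] at this
      linarith
    intro r hr
    by_contra hcon
    have hξ' := Ioo_subset_Icc_self hξ
    have hiv := intermediate_value_uIcc (h.contw.mono ((uIcc_subset_Icc hr hξ').trans
      (hts.trans hsub)))
    obtain ⟨x, hx1, hx2⟩ := hiv (show (0 : ℝ) ∈ uIcc (w r) (w ξ) from by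
      rw [uIcc_of_le ((not_lt.1 hcon).trans h2.le)]; exact ⟨not_lt.1 hcon, h2.le⟩)
    have := (hbig x (uIcc_subset_Icc hr hξ' hx1)).1
    rw [hx2, abs_zero] at this
    linarith
  have hψpos : ∀ r ∈ Icc t s, 0 ≤ ψ (w r) := fun r hr => h0 ▸ hm (hwpos r hr).le
  have ht0 : 0 < t := hr₀.trans_le ht.1
  -- the travel time
  have htime : v₀ * (s - t) ≤ x₂ - x₁ := by
    have hmono : MonotoneOn (fun r => u r - v₀ * r) (Icc t s) := by
      refine monotoneOn_of_hasDerivWithinAt_nonneg (convex_Icc t s) (f' := fun r => ψ (w r) - v₀)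
        ?_ ?_ ?_
      · have := h.contu.mono (hts.trans hsub)
        fun_prop
      · intro r hr
        rw [interior_Icc] at hr
        have := (h.du r (hsubo ⟨ht.1.trans_lt hr.1, hr.2⟩)).fun_sub
          ((hasDerivAt_id' r).const_mul v₀)
        rw [mul_one] at this
        exact this.hasDerivWithinAt
      · intro r hr
        rw [interior_Icc] at hr
        have hr' := Ioo_subset_Icc_self hr
        have h1 := (hbig r hr').2
        rw [abs_of_nonneg (hψpos r hr')] at h1
        linarith
    have := hmono ⟨le_rfl, ht.2.le⟩ ⟨ht.2.le, le_rfl⟩ ht.2.le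
    simp only [hut, hus] at this
    linarith
  have hs0 : 0 < s + η := by linarith [ht.2]
  -- the energy loss
  have hloss : d * w₀ / (s + η) * (x₂ - x₁) ≤ energy ψ f u w t := by
    have hant : AntitoneOn (fun r => energy ψ f u w r + d * w₀ / (s + η) * u r) (Icc t s) := by
      refine antitoneOn_of_hasDerivWithinAt_nonpos (convex_Icc t s)
        (f' := fun r => -((d : ℝ) / (r + η) * (w r * ψ (w r))) + d * w₀ / (s + η) * ψ (w r))
        ?_ ?_ ?_
      · have h1 := h.contu.mono (hts.trans hsub)
        have h2 := (h.continuousOn_energy hψ hf).mono (hts.trans hsub)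
        fun_prop
      · intro r hr
        rw [interior_Icc] at hr
        have hr' := hsubo ⟨ht.1.trans_lt hr.1, hr.2⟩
        exact ((h.hasDerivAt_energy hψ hf hr').fun_add
          ((h.du r hr').const_mul _)).hasDerivWithinAt
      · intro r hr
        rw [interior_Icc] at hr
        have hr' := Ioo_subset_Icc_self hr
        have h1 := (hbig r hr').1
        rw [abs_of_pos (hwpos r hr')] at h1
        have h2 := hψpos r hr'
        have hr0 : 0 < r + η := by linarith [hr.1]
        have h3 : (d : ℝ) * w₀ / (s + η) ≤ d * w r / (r + η) := by
          have := hwpos r hr'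
          have := hr.2.le
          gcongr
        have h4 := mul_le_mul_of_nonneg_right h3 h2
        have h5 : (d : ℝ) * w r / (r + η) * ψ (w r) = d / (r + η) * (w r * ψ (w r)) := by ring
        linarith
    have h1 := hant ⟨le_rfl, ht.2.le⟩ ⟨ht.2.le, le_rfl⟩ ht.2.le
    simp only [hut, hus] at h1
    linarith
  -- The derivative of (r+η) I is I - d w ψ(w), which is nonpositive since F(u) ≤ 0, d ≥ 1 and the
  -- primitive of ψ is at most w ψ(w).
  have hdecay : (t + η) * energy ψ f u w t ≤ ε := by
    have hts' : Icc r₀ t ⊆ Icc r₀ s := Icc_subset_Icc_right ht.2.le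
    have hant : AntitoneOn (fun r => (r + η) * energy ψ f u w r) (Icc r₀ t) := by
      refine antitoneOn_of_hasDerivWithinAt_nonpos (convex_Icc r₀ t)
        (f' := fun r => energy ψ f u w r - d * (w r * ψ (w r))) ?_ ?_ ?_
      · have h2 := (h.continuousOn_energy hψ hf).mono (hts'.trans hsub)
        fun_prop
      · intro r hr
        rw [interior_Icc] at hr
        have hr' := hsubo ⟨hr.1, hr.2.trans ht.2⟩
        have hr0 : 0 < r + η := by linarith [hr'.1]
        have h1 := ((hasDerivAt_id' r).add_const η).fun_mul (h.hasDerivAt_energy hψ hf hr')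
        refine h1.hasDerivWithinAt.congr_deriv ?_
        field_simp
        ring
      · intro r hr
        rw [interior_Icc] at hr
        have h1 := hF r (hts' (Ioo_subset_Icc_self hr))
        have h2 := (primitive_nonneg_le_mul hm hψ h0 (w r)).2
        have h3 := hpos (w r)
        have h4 : w r * ψ (w r) ≤ d * (w r * ψ (w r)) := le_mul_of_one_le_left h3 hd'
        rw [energy]
        linarith
    exact (hant ⟨le_rfl, ht.1⟩ ⟨ht.1, le_rfl⟩ ht.1).trans hε
  have ht0' : 0 < t + η := by linarith
  have h1 : d * w₀ * (x₂ - x₁) ≤ (s + η) * energy ψ f u w t := by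
    rw [div_mul_eq_mul_div, div_le_iff₀ hs0] at hloss
    linarith
  have hIt := hI t ⟨ht.1, ht.2.le⟩
  have h2 : s - t ≤ (t + η) * ((x₂ - x₁) / (v₀ * r₀)) := by
    have h3 : s - t ≤ (x₂ - x₁) / v₀ := by rw [le_div_iff₀ hv₀]; linarith
    refine h3.trans ?_
    have h4 : (x₂ - x₁) / v₀ = r₀ * ((x₂ - x₁) / (v₀ * r₀)) := by field_simp
    rw [h4]
    have : 0 ≤ (x₂ - x₁) / (v₀ * r₀) := div_nonneg (by linarith) (by positivity)
    gcongr
    linarith [ht.1]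
  -- The time of the climb is bounded, so s + η and t + η are comparable. This lets the energy loss,
  -- of order 1/(s+η), be compared with the available energy ε/(t+η).
  have h3 : s + η ≤ (t + η) * (1 + (x₂ - x₁) / (v₀ * r₀)) := by linarith
  have h4 : 0 ≤ 1 + (x₂ - x₁) / (v₀ * r₀) := by
    have : 0 ≤ (x₂ - x₁) / (v₀ * r₀) := div_nonneg (by linarith) (by positivity)
    linarith
  calc d * w₀ * (x₂ - x₁) ≤ (s + η) * energy ψ f u w t := h1
    _ ≤ (t + η) * (1 + (x₂ - x₁) / (v₀ * r₀)) * energy ψ f u w t := by gcongr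
    _ = (t + η) * energy ψ f u w t * (1 + (x₂ - x₁) / (v₀ * r₀)) := by ring
    _ ≤ ε * (1 + (x₂ - x₁) / (v₀ * r₀)) := by gcongr

/-- A solution that is close to `0` with little energy stays close to `0` as long as its energy is
nonnegative. -/
theorem trapped (h : IsSol d η ψ f T u w) (hψ : Continuous ψ) (hm : Monotone ψ) (h0 : ψ 0 = 0)
    (hf : Continuous f) (hη : 0 ≤ η) (hd : 1 ≤ d) {r₀ z a₁ a₂ b₁ b₂ μ w₀ v₀ ε : ℝ} (hr₀ : 0 < r₀)
    (hrz : r₀ ≤ z) (hzT : z ≤ T) (ha : a₂ < a₁) (hb : b₁ < b₂)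
    (hur : u r₀ ∈ Ioo a₁ b₁) (hF : ∀ x ∈ Icc a₂ b₂, primitive f x ≤ 0)
    (hFa : ∀ x ∈ Icc a₂ a₁, primitive f x ≤ -μ) (hFb : ∀ x ∈ Icc b₁ b₂, primitive f x ≤ -μ)
    (hIz : 0 ≤ energy ψ f u w z)
    (hw₀ : 0 < w₀) (hv₀ : 0 < v₀) (hH : ∀ x, μ ≤ primitive ψ x → w₀ ≤ |x| ∧ v₀ ≤ |ψ x|)
    (hε : (r₀ + η) * energy ψ f u w r₀ ≤ ε)
    (hεa : ε * (1 + (a₁ - a₂) / (v₀ * r₀)) < d * w₀ * (a₁ - a₂))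
    (hεb : ε * (1 + (b₂ - b₁) / (v₀ * r₀)) < d * w₀ * (b₂ - b₁)) :
    ∀ s ∈ Icc r₀ z, u s ∈ Ioo a₂ b₂ := by
  intro s hs
  by_contra hcon
  have hpos : ∀ x, 0 ≤ x * ψ x := fun x =>
    (primitive_nonneg_le_mul hm hψ h0 x).1.trans (primitive_nonneg_le_mul hm hψ h0 x).2
  have hsub : Icc r₀ s ⊆ Icc 0 T := Icc_subset_Icc hr₀.le (hs.2.trans hzT)
  -- The maximum is negative exactly inside (a₂, b₂), so its first zero is the first exit; either
  -- exit is then excluded by the cost of a climb, the lower one after reflection.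
  have hcont : ContinuousOn (fun r => max (u r - b₂) (a₂ - u r)) (Icc r₀ s) := by
    have := h.contu.mono hsub
    fun_prop
  obtain ⟨c, hc, hc0, hcn⟩ := exists_first_zero hs.1 hcont
    (max_lt (by linarith [hur.2]) (by linarith [hur.1])) (by
      by_contra hlt
      have hlt := max_lt_iff.1 (not_le.1 hlt)
      exact hcon ⟨by linarith [hlt.2], by linarith [hlt.1]⟩)
  have hcz : c ≤ z := hc.2.trans hs.2
  have hIc : 0 ≤ energy ψ f u w c := hIz.trans
    (h.antitoneOn_energy hψ hf hη hpos ⟨hr₀.le.trans hc.1.le, hcz.trans hzT⟩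
      ⟨hr₀.le.trans hrz, hzT⟩ hcz)
  have hrange : ∀ r ∈ Icc r₀ c, u r ∈ Icc a₂ b₂ := by
    intro r hr
    have hle : max (u r - b₂) (a₂ - u r) ≤ 0 := by
      rcases hr.2.eq_or_lt with rfl | h1
      · exact hc0.le
      · exact (hcn r ⟨hr.1, h1⟩).le
    have := max_le_iff.1 hle
    exact ⟨by linarith [this.2], by linarith [this.1]⟩
  have hor : u c = b₂ ∨ u c = a₂ := by
    rcases max_choice (u c - b₂) (a₂ - u c) with h1 | h1
    · left; rw [h1] at hc0; linarith
    · right; rw [h1] at hc0; linarith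
  rcases hor with huc | huc
  · have := h.climb_bound hψ hm h0 hf hη hd hr₀ hc.1.le (hcz.trans hzT) hb hur.2 huc
      (fun r hr => (hrange r hr).2) (fun r hr => hF _ (hrange r hr)) hFb hIc hw₀ hv₀ hH hε
    linarith
  · have hr := h.reflect
    have := hr.climb_bound (r₀ := r₀) (s := c) (x₁ := -a₁) (x₂ := -a₂) (μ := μ) (w₀ := w₀)
      (v₀ := v₀) (ε := ε) (continuous_reflect hψ)
      (fun x y hxy => neg_le_neg (hm (neg_le_neg hxy))) (by simp [RadialBoundState.reflect, h0])
      (continuous_reflect hf) hη hd hr₀ hc.1.le (hcz.trans hzT) (by linarith)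
      (by simp only [Pi.neg_apply]; linarith [hur.1]) (by simp [huc])
      (fun r hr => neg_le_neg (hrange r hr).1)
      (fun r hr => by
        rw [primitive_reflect, Pi.neg_apply, neg_neg]; exact hF _ (hrange r hr))
      (fun x hx => by
        rw [primitive_reflect]; exact hFa _ ⟨by linarith [hx.2], by linarith [hx.1]⟩)
      (by rwa [energy_reflect]) hw₀ hv₀
      (fun x hx => by
        rw [primitive_reflect] at hx
        have := hH _ hx
        rw [abs_neg] at this
        simpa [RadialBoundState.reflect] using this)
      (by rwa [energy_reflect])
    rw [neg_sub_neg] at this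
    linarith

/-- At a positive interior maximum ψ(w) = 0, so the kinetic energy vanishes even if w does not (ψ
need not be strictly monotone), and the energy is F(u) < 0. It would then stay negative up to z₂. -/
theorem nonpos_between_zeros (h : IsSol d η ψ f T u w) (hψ : Continuous ψ) (hm : Monotone ψ)
    (h0 : ψ 0 = 0) (hf : Continuous f) (hη : 0 ≤ η) {z₁ z₂ b : ℝ} (hz₁ : 0 ≤ z₁) (hz₂ : z₂ ≤ T)
    (hu₁ : u z₁ = 0) (hu₂ : u z₂ = 0) (hI : 0 ≤ energy ψ f u w z₂)
    (hF : ∀ x ∈ Ioo 0 b, primitive f x < 0) (hu : ∀ r ∈ Icc z₁ z₂, u r < b) :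
    ∀ r ∈ Icc z₁ z₂, u r ≤ 0 := by
  intro r hr
  by_contra hcon
  have hpos : ∀ x, 0 ≤ x * ψ x := fun x =>
    (primitive_nonneg_le_mul hm hψ h0 x).1.trans (primitive_nonneg_le_mul hm hψ h0 x).2
  have hsub : Icc z₁ z₂ ⊆ Icc 0 T := Icc_subset_Icc hz₁ hz₂
  obtain ⟨x, hx, hmax⟩ := isCompact_Icc.exists_isMaxOn ⟨r, hr⟩ (h.contu.mono hsub)
  have hux : 0 < u x := (not_le.1 hcon).trans_le (hmax hr)
  have hx1 : z₁ < x := lt_of_le_of_ne hx.1 (by rintro rfl; linarith)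
  have hx2 : x < z₂ := lt_of_le_of_ne hx.2 (by rintro rfl; linarith)
  have hψ0 : ψ (w x) = 0 := (hmax.isLocalMax (Icc_mem_nhds hx1 hx2)).hasDerivAt_eq_zero
    (h.du x ⟨hz₁.trans_lt hx1, hx2.trans_le hz₂⟩)
  have h1 := (primitive_nonneg_le_mul hm hψ h0 (w x)).2
  rw [hψ0, mul_zero] at h1
  have h2 := hF _ ⟨hux, hu x hx⟩
  have h3 := h.antitoneOn_energy hψ hf hη hpos (hsub hx) ⟨hz₁.trans (hx1.le.trans hx2.le), hz₂⟩
    hx2.le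
  have h4 : energy ψ f u w x = primitive ψ (w x) + primitive f (u x) := rfl
  linarith

theorem eq_zero_between_zeros (h : IsSol d η ψ f T u w) (hψ : Continuous ψ) (hm : Monotone ψ)
    (h0 : ψ 0 = 0) (hf : Continuous f) (hη : 0 ≤ η) {z₁ z₂ a b : ℝ} (hz₁ : 0 ≤ z₁) (hz₂ : z₂ ≤ T)
    (hu₁ : u z₁ = 0) (hu₂ : u z₂ = 0) (hI : 0 ≤ energy ψ f u w z₂)
    (hF : ∀ x ∈ Ioo a b, x ≠ 0 → primitive f x < 0) (ha : a < 0) (hb : 0 < b)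
    (hu : ∀ r ∈ Icc z₁ z₂, u r ∈ Ioo a b) :
    ∀ r ∈ Icc z₁ z₂, u r = 0 := by
  intro r hr
  refine le_antisymm (h.nonpos_between_zeros hψ hm h0 hf hη hz₁ hz₂ hu₁ hu₂ hI
    (fun x hx => hF x ⟨ha.trans hx.1, hx.2⟩ hx.1.ne') (fun r hr => (hu r hr).2) r hr) ?_
  have := h.reflect.nonpos_between_zeros (continuous_reflect hψ) (z₁ := z₁) (z₂ := z₂) (b := -a)
    (fun x y hxy => neg_le_neg (hm (neg_le_neg hxy))) (by simp [RadialBoundState.reflect, h0])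
    (continuous_reflect hf) hη hz₁ hz₂ (by simp [hu₁]) (by simp [hu₂]) (by rwa [energy_reflect])
    (fun x hx => by
      rw [primitive_reflect]
      exact hF _ ⟨by linarith [hx.2], by linarith [hx.1]⟩ (by linarith [hx.1]))
    (fun r hr => neg_lt_neg (hu r hr).1) r hr
  simpa using this

end IsSol

end RadialBoundState

/-! ### Stability and counting of zeros under approximation. -/

namespace RadialBoundState

variable {d : ℕ} {q T C : ℝ} {ψ f u w : ℝ → ℝ} {η : ℕ → ℝ} {ψn fn : ℕ → ℝ → ℝ}

/-- Uniform closeness alone would not keep the primitive negative near 0, yet that sign is what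
excludes small excursions between two zeros of the approximations. -/
theorem exists_scheme (hψ : Continuous ψ) (hm : Monotone ψ) (hψ0 : ψ 0 = 0)
    (hf : UniformContinuous f) (hC : ∀ s, |f s| ≤ C) (hf0 : f 0 = 0) {a b : ℝ} (ha : a ≤ 0)
    (hb : 0 ≤ b) (hF : ∀ s ∈ Icc a b, primitive f s ≤ 0) :
    ∃ ψn fn, Scheme ψ f (C + 1) (fun n => 1 / ((n : ℝ) + 1)) ψn fn ∧
      (∀ n, ∀ s ∈ Icc a b, s ≠ 0 → primitive (fn n) s < 0) ∧
      ∀ n, (∃ K, LipschitzWith K (ψn n)) ∧ (∃ K, LipschitzWith K (fn n)) ∧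
        ∃ B, ∀ x, |ψn n x| ≤ B := by
  have hpos : ∀ n : ℕ, 0 < 1 / ((n : ℝ) + 1) := fun n => by positivity
  have hlim : Tendsto (fun n : ℕ => 1 / ((n : ℝ) + 1)) atTop (𝓝 0) :=
    tendsto_one_div_add_atTop_nhds_zero_nat
  choose ψn h1 h2 h3 h4 h5 using fun n : ℕ =>
    exists_monotone_lipschitz_approx hψ hm hψ0 (Nat.cast_nonneg n) (hpos n)
  choose fn h6 h7 h8 using fun n : ℕ => exists_lipschitz_approx hf hC hf0 ha hb hF (hpos n)
  refine ⟨ψn, fn, ⟨hpos, hlim, ?_, fun n s => ?_, fun ε hε => ?_, fun ε hε R => ?_, h1, h2,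
    fun n => (h3 n).choose_spec.continuous, fun n => (h6 n).choose_spec.continuous⟩, h8,
    fun n => ⟨h3 n, h6 n, h4 n⟩⟩
  · have := (abs_nonneg _).trans (hC 0)
    linarith
  · have h9 := abs_sub_abs_le_abs_sub (fn n s) (f s)
    have h10 : 1 / ((n : ℝ) + 1) ≤ 1 := by
      rw [div_le_one (by positivity)]; linarith [(Nat.cast_nonneg n : (0 : ℝ) ≤ n)]
    linarith [h7 n s, hC s]
  · filter_upwards [hlim.eventually_lt_const hε] with n hn s
    exact (h7 n s).trans hn.le
  · filter_upwards [hlim.eventually_lt_const hε, tendsto_natCast_atTop_atTop.eventually_ge_atTop R]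
      with n hn hR x hx
    exact (h5 n x (hx.trans hR)).trans hn.le

/-- Supplies the constants of `IsSol.climb_bound` independently of n; strict monotonicity of the
limit ψ replaces that of the approximations. -/
theorem Scheme.exists_lower (h : Scheme ψ f C η ψn fn) (hm : StrictMono ψ) (hψ0 : ψ 0 = 0)
    {μ : ℝ} (hμ : 0 < μ) : ∃ w₀ > 0, ∃ v₀ > 0, ∀ᶠ n in atTop, ∀ x, μ ≤ primitive (ψn n) x →
      w₀ ≤ |x| ∧ v₀ ≤ |ψn n x| := by
  set B := max (ψ 1) (-ψ (-1)) + 1 with hB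
  have hψ1 : 0 < ψ 1 := hψ0 ▸ hm one_pos
  have hB0 : 0 < B := by
    have := le_max_left (ψ 1) (-ψ (-1)); linarith
  set w₀ := min 1 (μ / (2 * B)) with hw₀
  have hw₀pos : 0 < w₀ := by positivity
  have hp : 0 < ψ w₀ := hψ0 ▸ hm hw₀pos
  have hn : ψ (-w₀) < 0 := hψ0 ▸ hm (by linarith : -w₀ < 0)
  set v₀ := min (ψ w₀) (-ψ (-w₀)) / 2 with hv₀
  have hv₀pos : 0 < v₀ := half_pos (lt_min hp (by linarith))
  refine ⟨w₀, hw₀pos, v₀, hv₀pos, ?_⟩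
  filter_upwards [h.psi_lim (min 1 v₀) (lt_min one_pos hv₀pos) 1] with n hnn x hx
  have hlow : w₀ ≤ |x| := by
    by_contra hcon
    have hx1 : |x| ≤ 1 := (not_le.1 hcon).le.trans (min_le_left _ _)
    have h1 := (hnn x hx1).trans (min_le_left _ _)
    have h2 := (primitive_nonneg_le_mul (h.psi_mono n) (h.psi_cont n) (h.psi_zero n) x).2
    have h3 : |ψn n x| ≤ B := by
      have h4 : ψ x ≤ ψ 1 := hm.monotone (abs_le.1 hx1).2
      have h5 : ψ (-1) ≤ ψ x := hm.monotone (abs_le.1 hx1).1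
      have h6 := le_max_left (ψ 1) (-ψ (-1))
      have h7 := le_max_right (ψ 1) (-ψ (-1))
      rw [abs_le] at h1 ⊢
      constructor <;> linarith [h1.1, h1.2]
    have h4 : x * ψn n x ≤ w₀ * B := by
      refine (le_abs_self _).trans ?_
      rw [abs_mul]
      exact mul_le_mul (not_le.1 hcon).le h3 (abs_nonneg _) hw₀pos.le
    have h5 : w₀ * B ≤ μ / (2 * B) * B := by gcongr; exact min_le_right _ _
    have h6 : μ / (2 * B) * B = μ / 2 := by field_simp
    linarith
  refine ⟨hlow, ?_⟩
  have hw1 : |w₀| ≤ 1 := by rw [abs_of_pos hw₀pos]; exact min_le_left _ _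
  have e1 := abs_le.1 ((hnn w₀ hw1).trans (min_le_right _ _))
  have e2 := abs_le.1 ((hnn (-w₀) (by rwa [abs_neg])).trans (min_le_right _ _))
  have e3 : 2 * v₀ ≤ ψ w₀ := by rw [hv₀]; linarith [min_le_left (ψ w₀) (-ψ (-w₀))]
  have e4 : 2 * v₀ ≤ -ψ (-w₀) := by rw [hv₀]; linarith [min_le_right (ψ w₀) (-ψ (-w₀))]
  rcases le_abs.1 hlow with h1 | h1
  · have := h.psi_mono n h1
    exact le_trans (by linarith) (le_abs_self _)
  · have := h.psi_mono n (by linarith : x ≤ -w₀)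
    exact le_trans (by linarith) (neg_le_abs _)

theorem Alternates.mono {K : ℕ} {T T' : ℝ} (h : Alternates K T u) (hT : T ≤ T') :
    Alternates K T' u := by
  obtain ⟨t, h1, h2⟩ := h
  exact ⟨t, h1, fun i hi => ⟨⟨(h2 i hi).1.1, (h2 i hi).1.2.trans hT⟩, (h2 i hi).2⟩⟩

/-- Alternation is finitely many strict inequalities, hence an open condition for pointwise
convergence. This is why shooting counts sign changes rather than zeros. -/
theorem Alternates.eventually {K : ℕ} {R : ℝ} (h : Alternates K R u) {l : Filter ℕ}
    {un : ℕ → ℝ → ℝ} (hlim : ∀ r, 0 ≤ r → Tendsto (fun n => un n r) l (𝓝 (u r))) :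
    ∀ᶠ n in l, Alternates K R (un n) := by
  obtain ⟨t, h1, h2⟩ := h
  have : ∀ᶠ n in l, ∀ i ∈ Finset.range (K + 1), 0 < (-1) ^ i * un n (t i) := by
    rw [Filter.eventually_all_finset]
    intro i hi
    have h3 := h2 i (by rw [Finset.mem_range] at hi; omega)
    exact ((hlim _ h3.1.1).const_mul _).eventually_const_lt h3.2
  filter_upwards [this] with n hn
  exact ⟨t, h1, fun i hi => ⟨(h2 i hi).1, hn i (by rw [Finset.mem_range]; omega)⟩⟩

/-- The last clause, a nonzero value between consecutive zeros, is what will contradict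
`IsSol.eq_zero_between_zeros`. -/
theorem Alternates.exists_zeros {k : ℕ} (h : Alternates (k + 1) T u)
    (hu : ContinuousOn u (Icc 0 T)) : ∃ z : ℕ → ℝ, (∀ i < k, z i < z (i + 1)) ∧
      (∀ i ≤ k, z i ∈ Icc 0 T ∧ u (z i) = 0) ∧
      ∀ i < k, ∃ x ∈ Icc (z i) (z (i + 1)), u x ≠ 0 := by
  obtain ⟨t, h1, h2⟩ := h
  have hex : ∀ i ≤ k, ∃ z ∈ Ioo (t i) (t (i + 1)), u z = 0 := by
    intro i hi
    obtain ⟨ha, hap⟩ := h2 i (by omega)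
    obtain ⟨hb, hbp⟩ := h2 (i + 1) (by omega)
    have hlt := h1 i (by omega)
    have hc : ContinuousOn (fun r => (-1) ^ (i + 1) * u r) (Icc (t i) (t (i + 1))) := by
      have := hu.mono (Icc_subset_Icc ha.1 hb.2)
      fun_prop
    have hneg : (-1) ^ (i + 1) * u (t i) < 0 := by rw [pow_succ]; linarith
    obtain ⟨c, hc1, hc2, -⟩ := exists_first_zero hlt.le hc hneg hbp.le
    have hne : ((-1 : ℝ) ^ (i + 1)) ≠ 0 := by positivity
    refine ⟨c, ⟨hc1.1, lt_of_le_of_ne hc1.2 ?_⟩, (mul_eq_zero.1 hc2).resolve_left hne⟩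
    rintro rfl
    linarith
  choose! z hz hz0 using hex
  refine ⟨z, fun i hi => (hz i hi.le).2.trans (hz (i + 1) hi).1, fun i hi => ⟨⟨?_, ?_⟩, hz0 i hi⟩,
    fun i hi => ⟨t (i + 1), ⟨(hz i hi.le).2.le, (hz (i + 1) hi).1.le⟩, ?_⟩⟩
  · exact (h2 i (by omega)).1.1.trans (hz i hi).1.le
  · exact (hz i hi).2.le.trans (h2 (i + 1) (by omega)).1.2
  · intro h0
    have := (h2 (i + 1) (by omega)).2
    rw [h0, mul_zero] at this
    exact lt_irrefl _ this

theorem IsGlobalSol.alternates_of_zeros (hq : 1 < q) (hsol : IsGlobalSol d (phi q) f u w)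
    (hu0 : 0 < u 0) {k : ℕ} {y : ℕ → ℝ} {r₀ : ℝ} (hy : ∀ i < k, y i < y (i + 1))
    (hy0 : ∀ i ≤ k, y i ∈ Icc 0 r₀ ∧ u (y i) = 0)
    (hnd : ∀ r ∈ Icc 0 r₀, u r = 0 → w r ≠ 0) : Alternates (k + 1) (r₀ + 1) u := by
  refine RadialBoundState.alternates_of_zeros hsol.contu hu0 hy
    (fun i hi => ⟨?_, by linarith [(hy0 i hi).1.2], (hy0 i hi).2⟩) fun r hr hrk hur =>
      ⟨_, ?_, hsol.du hr⟩
  · refine lt_of_le_of_ne (hy0 i hi).1.1 fun h => ?_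
    have := (hy0 i hi).2
    rw [← h] at this
    linarith
  · rw [Ne, phi_eq_zero_iff hq]
    exact hnd r ⟨hr.le, hrk.trans (hy0 k le_rfl).1.2⟩ hur

/-- Zeros of approximating solutions converge to distinct zeros of the limit, as long as the limit
has no double zero. -/
theorem Scheme.exists_limit_zeros (h : Scheme (phi q) f C η ψn fn) (hq : 1 < q)
    {U : Ultrafilter ℕ} (hU : (U : Filter ℕ) ≤ atTop) {T : ℕ → ℝ}
    {un wn : ℕ → ℝ → ℝ} (hsol : ∀ n, IsSol d (η n) (ψn n) (fn n) (T n) (un n) (wn n))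
    (hlim : ∀ r, 0 ≤ r → ∀ ρ : ℕ → ℝ, (∀ᶠ n in (U : Filter ℕ), 0 ≤ ρ n) → Tendsto ρ U (𝓝 r) →
        Tendsto (fun n => un n (ρ n)) U (𝓝 (u r)) ∧
        Tendsto (fun n => wn n (ρ n)) U (𝓝 (w r)))
    {j : ℕ} {z : ℕ → ℕ → ℝ} {r₀ : ℝ} (hnd : ∀ r ∈ Icc 0 r₀, u r = 0 → w r ≠ 0)
    (hz : ∀ᶠ n in (U : Filter ℕ), (∀ i < j, z n i < z n (i + 1)) ∧
      (∀ i ≤ j, z n i ∈ Icc 0 (T n) ∧ un n (z n i) = 0) ∧ z n j ≤ r₀) :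
    ∃ y : ℕ → ℝ, (∀ i < j, y i < y (i + 1)) ∧ ∀ i ≤ j, y i ∈ Icc 0 r₀ ∧ u (y i) = 0 := by
  have hmem : ∀ i ≤ j, ∀ᶠ n in (U : Filter ℕ), z n i ∈ Icc 0 r₀ := by
    intro i hi
    filter_upwards [hz] with n hn
    refine ⟨(hn.2.1 i hi).1.1, ?_⟩
    rcases hi.eq_or_lt with rfl | hlt
    · exact hn.2.2
    · exact (chain_lt hn.1 hlt le_rfl).le.trans hn.2.2
  have hex : ∀ i ≤ j, ∃ y ∈ Icc 0 r₀, Tendsto (fun n => z n i) U (𝓝 y) := fun i hi =>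
    isCompact_Icc.ultrafilter_le_nhds (U.map fun n => z n i) (le_principal_iff.2 (hmem i hi))
  choose! y hy hylim using hex
  have hconv : ∀ i ≤ j, Tendsto (fun n => un n (z n i)) U (𝓝 (u (y i))) := fun i hi =>
    (hlim _ (hy i hi).1 _ ((hmem i hi).mono fun n hn => hn.1) (hylim i hi)).1
  have hu0 : ∀ i ≤ j, u (y i) = 0 := by
    intro i hi
    refine tendsto_nhds_unique (hconv i hi) ?_
    refine tendsto_const_nhds.congr' ?_
    filter_upwards [hz] with n hn
    exact (hn.2.1 i hi).2.symm
  refine ⟨y, fun i hi => ?_, fun i hi => ⟨hy i hi, hu0 i hi⟩⟩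
  have hle : y i ≤ y (i + 1) := le_of_tendsto_of_tendsto (hylim i hi.le) (hylim (i + 1) hi)
    (hz.mono fun n hn => (hn.1 i hi).le)
  refine lt_of_le_of_ne hle fun heq => ?_
  -- If two zeros merged in the limit, the critical points that Rolle's theorem puts between them
  -- would converge to the same point, making it a double zero.
  have hrolle : ∀ n, ∃ ξ, ((∀ i < j, z n i < z n (i + 1)) ∧
      (∀ i ≤ j, z n i ∈ Icc 0 (T n) ∧ un n (z n i) = 0) ∧ z n j ≤ r₀) →
      ξ ∈ Ioo (z n i) (z n (i + 1)) ∧ ψn n (wn n ξ) = 0 := by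
    intro n
    by_cases hn : (∀ i < j, z n i < z n (i + 1)) ∧
      (∀ i ≤ j, z n i ∈ Icc 0 (T n) ∧ un n (z n i) = 0) ∧ z n j ≤ r₀
    · have ha := hn.2.1 i hi.le
      have hb := hn.2.1 (i + 1) hi
      obtain ⟨ξ, h1, h2⟩ := exists_hasDerivAt_eq_zero (hn.1 i hi)
        ((hsol n).contu.mono (Icc_subset_Icc ha.1.1 hb.1.2)) (ha.2.trans hb.2.symm)
        fun x hx => (hsol n).du x ⟨ha.1.1.trans_lt hx.1, hx.2.trans_le hb.1.2⟩
      exact ⟨ξ, fun _ => ⟨h1, h2⟩⟩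
    · exact ⟨0, fun h => absurd h hn⟩
  choose ξ hξ using hrolle
  have hξlim : Tendsto ξ U (𝓝 (y i)) := by
    have h2 := hylim (i + 1) hi
    rw [← heq] at h2
    exact tendsto_of_tendsto_of_tendsto_of_le_of_le' (hylim i hi.le) h2
      (hz.mono fun n hn => (hξ n hn).1.1.le) (hz.mono fun n hn => (hξ n hn).1.2.le)
  have hw := (hlim _ (hy i hi.le).1 ξ (hz.mono fun n hn =>
    ((hn.2.1 i hi.le).1.1.trans (hξ n hn).1.1.le)) hξlim).2
  have hψw : Tendsto (fun n => ψn n (wn n (ξ n))) U (𝓝 (phi q (w (y i)))) :=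
    (joint_of_locally_uniform (continuous_phi hq) h.psi_lim (w (y i))).comp
      ((show Tendsto id (U : Filter ℕ) atTop from hU).prodMk hw)
  have hψ0 : phi q (w (y i)) = 0 := by
    refine tendsto_nhds_unique hψw ?_
    refine tendsto_const_nhds.congr' ?_
    filter_upwards [hz] with n hn
    exact (hξ n hn).2.symm
  exact hnd _ (hy i hi.le) (hu0 i hi.le) ((phi_eq_zero_iff hq).1 hψ0)

theorem finite_of_no_chain {Z : Set ℝ} {k : ℕ}
    (hno : ¬∃ y : ℕ → ℝ, (∀ i < k, y i < y (i + 1)) ∧ ∀ i ≤ k, y i ∈ Z) :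
    Z.Finite ∧ Z.ncard ≤ k := by
  have hno' : ¬∃ t : Finset ℝ, ↑t ⊆ Z ∧ t.card = k + 1 := by
    rintro ⟨t, ht, hcard⟩
    set e := t.orderEmbOfFin hcard
    refine hno ⟨fun i => if h : i < k + 1 then e ⟨i, h⟩ else 0, fun i hi => ?_, fun i hi => ?_⟩
    · dsimp only
      rw [dif_pos (by omega), dif_pos (by omega)]
      exact e.strictMono (Fin.mk_lt_mk.2 (Nat.lt_succ_self i))
    · dsimp only
      rw [dif_pos (by omega)]
      exact ht (t.orderEmbOfFin_mem hcard _)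
  have hfin : Z.Finite := by
    by_contra hinf
    exact hno' (Set.Infinite.exists_subset_card_eq hinf (k + 1))
  refine ⟨hfin, ?_⟩
  by_contra hcon
  rw [Set.ncard_eq_toFinset_card Z hfin] at hcon
  obtain ⟨t, ht, hcard⟩ := Finset.exists_subset_card_eq (not_le.1 hcon)
  exact hno' ⟨t, fun x hx => hfin.mem_toFinset.1 (ht hx), hcard⟩

theorem ncard_eq_of_chains {Z : Set ℝ} {k : ℕ}
    (hno : ¬∃ y : ℕ → ℝ, (∀ i < k, y i < y (i + 1)) ∧ ∀ i ≤ k, y i ∈ Z)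
    (hyes : 0 < k → ∃ y : ℕ → ℝ, (∀ i < k - 1, y i < y (i + 1)) ∧ ∀ i ≤ k - 1, y i ∈ Z) :
    Z.Finite ∧ Z.ncard = k := by
  obtain ⟨hfin, hle⟩ := finite_of_no_chain hno
  refine ⟨hfin, le_antisymm hle ?_⟩
  rcases Nat.eq_zero_or_pos k with rfl | hk
  · exact Nat.zero_le _
  obtain ⟨y, hy, hyZ⟩ := hyes hk
  have hinj : Set.InjOn y (Finset.range k : Set ℕ) := by
    intro i hi j hj hij
    rw [Finset.mem_coe, Finset.mem_range] at hi hj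
    rcases lt_trichotomy i j with h | h | h
    · exact absurd hij (chain_lt hy h (by omega)).ne
    · exact h
    · exact absurd hij (chain_lt hy h (by omega)).ne'
  rw [Set.ncard_eq_toFinset_card Z hfin]
  calc k = ((Finset.range k).image y).card := by
        rw [Finset.card_image_of_injOn hinj, Finset.card_range]
    _ ≤ _ := Finset.card_le_card fun x hx => by
        obtain ⟨i, hi, rfl⟩ := Finset.mem_image.1 hx
        rw [Finset.mem_range] at hi
        exact hfin.mem_toFinset.2 (hyZ i (by omega))

end RadialBoundState

/-! ### Shooting for the truncated nonlinearity. -/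

namespace RadialBoundState

variable {d : ℕ} {q C βm βp b a : ℝ} {f u w : ℝ → ℝ}

theorem strictMono_phi (hq : 1 < q) : StrictMono (phi q) := by
  refine (monotone_phi hq).strictMono_of_injective fun x y hxy => ?_
  -- Conjugation of exponents is an involution, so `phi_phi_conj` provides a left inverse of φ_q.
  have h : q = (q / (q - 1)) / (q / (q - 1) - 1) := by
    have : q - 1 ≠ 0 := by linarith
    field_simp
    ring
  have h1 := one_lt_conj hq
  rw [h] at hxy
  rw [← phi_phi_conj h1 x, hxy, phi_phi_conj h1 y]

theorem primitive_phi_nonneg (hq : 1 < q) (x : ℝ) : 0 ≤ primitive (phi q) x :=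
  (primitive_nonneg_le_mul (monotone_phi hq) (continuous_phi hq) (phi_zero q) x).1

/-- A bounded nonlinearity with the sign structure of the problem on all of `ℝ`, whose primitive
takes the same value at `b < βm` and `a > βp`. -/
structure Truncated (f : ℝ → ℝ) (βm βp b a C : ℝ) : Prop where
  uniform : UniformContinuous f
  bound : ∀ s, |f s| ≤ C
  betaMinus_neg : βm < 0
  betaPlus_pos : 0 < βp
  lt_betaMinus : b < βm
  betaPlus_lt : βp < a
  primitive_neg : ∀ s ∈ Ioo βm βp, s ≠ 0 → primitive f s < 0
  primitive_betaMinus : primitive f βm = 0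
  primitive_betaPlus : primitive f βp = 0
  pos : ∀ s, βp ≤ s → 0 < f s
  neg : ∀ s, s ≤ βm → f s < 0
  equal : primitive f b = primitive f a

namespace Truncated

theorem cont (h : Truncated f βm βp b a C) : Continuous f := h.uniform.continuous

theorem strictMonoOn (h : Truncated f βm βp b a C) : StrictMonoOn (primitive f) (Ici βp) := by
  refine strictMonoOn_of_deriv_pos (convex_Ici _) (continuous_primitive h.cont).continuousOn ?_
  intro x hx
  rw [interior_Ici] at hx
  rw [(hasDerivAt_primitive h.cont x).deriv]
  exact h.pos x (le_of_lt hx)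

theorem strictAntiOn (h : Truncated f βm βp b a C) : StrictAntiOn (primitive f) (Iic βm) := by
  refine strictAntiOn_of_deriv_neg (convex_Iic _) (continuous_primitive h.cont).continuousOn ?_
  intro x hx
  rw [interior_Iic] at hx
  rw [(hasDerivAt_primitive h.cont x).deriv]
  exact h.neg x (le_of_lt hx)

theorem mem_Icc_of_le (h : Truncated f βm βp b a C) {s : ℝ}
    (hs : primitive f s ≤ primitive f a) : s ∈ Icc b a := by
  constructor
  · by_contra hcon
    have hcon := not_le.1 hcon
    have := h.strictAntiOn (hcon.trans h.lt_betaMinus).le h.lt_betaMinus.le hcon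
    rw [h.equal] at this
    linarith
  · by_contra hcon
    have hcon := not_le.1 hcon
    have := h.strictMonoOn h.betaPlus_lt.le (h.betaPlus_lt.trans hcon).le hcon
    linarith

theorem primitive_nonpos (h : Truncated f βm βp b a C) {s : ℝ} (hs : s ∈ Icc βm βp) :
    primitive f s ≤ 0 := by
  rcases hs.1.eq_or_lt with rfl | h1
  · exact h.primitive_betaMinus.le
  rcases hs.2.eq_or_lt with rfl | h2
  · exact h.primitive_betaPlus.le
  by_cases h0 : s = 0
  · rw [h0, primitive_zero]
  · exact (h.primitive_neg s ⟨h1, h2⟩ h0).le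

/-- The origin is a local maximum of F. -/
theorem map_zero (h : Truncated f βm βp b a C) : f 0 = 0 := by
  have hmax : IsLocalMax (primitive f) 0 := by
    filter_upwards [Ioo_mem_nhds h.betaMinus_neg h.betaPlus_pos] with s hs
    rw [primitive_zero]
    exact h.primitive_nonpos ⟨hs.1.le, hs.2.le⟩
  exact hmax.hasDerivAt_eq_zero (hasDerivAt_primitive h.cont 0)

theorem eq_zero (h : Truncated f βm βp b a C) {s : ℝ} (h1 : f s = 0) (h2 : primitive f s = 0) :
    s = 0 := by
  by_contra h0
  rcases le_or_gt s βm with h3 | h3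
  · exact (h.neg s h3).ne h1
  rcases le_or_gt βp s with h4 | h4
  · exact (h.pos s h4).ne' h1
  exact (h.primitive_neg s ⟨h3, h4⟩ h0).ne h2

theorem primitive_top_pos (h : Truncated f βm βp b a C) : 0 < primitive f a := by
  have := h.strictMonoOn self_mem_Ici h.betaPlus_lt.le h.betaPlus_lt
  rwa [h.primitive_betaPlus] at this

theorem primitive_le_top (h : Truncated f βm βp b a C) {s : ℝ} (hs : s ∈ Icc (βp / 2) a) :
    primitive f s ≤ primitive f a := by
  have hβ := h.betaPlus_pos
  rcases le_or_gt βp s with h1 | h1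
  · exact h.strictMonoOn.monotoneOn h1 h.betaPlus_lt.le hs.2
  · have := h.primitive_nonpos (s := s) ⟨by linarith [h.betaMinus_neg, hs.1], h1.le⟩
    linarith [h.primitive_top_pos]

/-- Energy barrier: F(u(r)) ≤ I(r) ≤ I(0) = F(u(0)) ≤ F(a) = F(b). -/
theorem mem_Icc (h : Truncated f βm βp b a C) (hq : 1 < q) (hsol : IsGlobalSol d (phi q) f u w)
    (hu0 : u 0 ∈ Icc (βp / 2) a) {r : ℝ} (hr : 0 ≤ r) : u r ∈ Icc b a := by
  refine h.mem_Icc_of_le ((?_ : _ ≤ primitive f (u 0)).trans (h.primitive_le_top hu0))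
  have h1 := hsol.antiI (continuous_phi hq) h.cont (mul_phi_nonneg hq) self_mem_Ici hr hr
  have h2 := primitive_phi_nonneg hq (w r)
  simp only [energy, hsol.w0, primitive_zero] at h1
  linarith

end Truncated

/-- Take a failing point α' close to the supremum of the failing points and move right by δ, past
the supremum or up to a₁. No continuity of P is involved. The conclusion on α is conditional because
P a₁ is available only for large n. -/
theorem exists_close_pair {P : ℝ → Prop} {a₀ a₁ δ : ℝ} (ha : a₀ ≤ a₁) (hδ : 0 < δ)
    (h0 : ¬P a₀) : ∃ α ∈ Icc a₀ a₁, ∃ α' ∈ Icc a₀ a₁, |α - α'| ≤ δ ∧ ¬P α' ∧ (P a₁ → P α) := by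
  by_cases h1 : P a₁
  swap
  · exact ⟨a₀, ⟨le_rfl, ha⟩, a₀, ⟨le_rfl, ha⟩, by simpa using hδ.le, h0, fun h => absurd h h1⟩
  set S := {x ∈ Icc a₀ a₁ | ¬P x} with hS
  have hne : S.Nonempty := ⟨a₀, ⟨le_rfl, ha⟩, h0⟩
  have hbd : BddAbove S := ⟨a₁, fun x hx => hx.1.2⟩
  obtain ⟨α', hα', hlt⟩ := exists_lt_of_lt_csSup hne (by linarith : sSup S - δ / 2 < sSup S)
  have hle := le_csSup hbd hα'
  have hs1 : sSup S ≤ a₁ := csSup_le hne fun x hx => hx.1.2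
  refine ⟨min a₁ (α' + δ), ⟨le_min ha (by linarith [hα'.1.1]), min_le_left _ _⟩, α', hα'.1, ?_,
    hα'.2, fun _ => ?_⟩
  · have h2 := min_le_right a₁ (α' + δ)
    have h3 : α' ≤ min a₁ (α' + δ) := le_min hα'.1.2 (by linarith)
    rw [abs_of_nonneg (by linarith)]
    linarith
  · rcases le_total a₁ (α' + δ) with h2 | h2
    · rwa [min_eq_left h2]
    · rw [min_eq_right h2]
      by_contra hcon
      have := le_csSup hbd (show α' + δ ∈ S from ⟨⟨by linarith [hα'.1.1], h2⟩, hcon⟩)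
      linarith

/-- At a zero of u the energy is nonnegative, but it starts at F(u(0)) < 0. -/
theorem IsSol.not_alternates {T η : ℝ} {ψ : ℝ → ℝ} (h : IsSol d η ψ f T u w) (hψ : Continuous ψ)
    (hm : Monotone ψ) (h0 : ψ 0 = 0) (hf : Continuous f) (hη : 0 ≤ η)
    (hneg : primitive f (u 0) < 0) (k : ℕ) : ¬Alternates (k + 1) T u := by
  intro halt
  obtain ⟨z, -, hz, -⟩ := halt.exists_zeros h.contu
  obtain ⟨h1, h2⟩ := hz 0 (Nat.zero_le _)
  have h3 := h.antitoneOn_energy hψ hf hη (fun x => by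
    have := primitive_nonneg_le_mul hm hψ h0 x
    exact this.1.trans this.2) ⟨le_rfl, h1.1.trans h1.2⟩ h1 h1.1
  have h4 := (primitive_nonneg_le_mul hm hψ h0 (w (z 0))).1
  rw [energy_eq_of_zero h2] at h3
  simp only [energy, h.w0, primitive_zero] at h3
  linarith

/-- Positive energy at the last zero makes the energy positive at all earlier zeros, so none of them
is double. -/
theorem IsGlobalSol.alternates_of_energy_pos (hq : 1 < q) (hf : Continuous f)
    (hsol : IsGlobalSol d (phi q) f u w) (hu0 : 0 < u 0) {k : ℕ} {y : ℕ → ℝ}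
    (hy : ∀ i < k, y i < y (i + 1))
    (hy0 : ∀ i ≤ k, 0 < y i ∧ u (y i) = 0 ∧ 0 < energy (phi q) f u w (y i)) :
    Alternates (k + 1) (y k + 1) u := by
  refine hsol.alternates_of_zeros hq hu0 hy (fun i hi => ⟨⟨(hy0 i hi).1.le, ?_⟩, (hy0 i hi).2.1⟩)
    fun r hr hur hwr => ?_
  · rcases hi.eq_or_lt with rfl | h
    · exact le_rfl
    · exact (chain_lt hy h le_rfl).le
  · have h1 := hsol.antiI (continuous_phi hq) hf (mul_phi_nonneg hq) hr.1 (hy0 k le_rfl).1.le hr.2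
    rw [energy_eq_of_zero hur, hwr, primitive_zero] at h1
    linarith [(hy0 k le_rfl).2.2]

/-- Approximate solutions with at least `k + 1` sign changes, next to approximate solutions with
fewer, converge to a common solution of the limit problem. -/
theorem Truncated.exists_shooting_limit (ht : Truncated f βm βp b a C) (hq : 1 < q) (k : ℕ)
    (hosc : ∀ u w, IsGlobalSol d (phi q) f u w → u 0 = a → (∀ r, 0 ≤ r → u r ∈ Icc b a) →
      ∃ y : ℕ → ℝ, (∀ i < k, y i < y (i + 1)) ∧
        ∀ i ≤ k, 0 < y i ∧ u (y i) = 0 ∧ 0 < energy (phi q) f u w (y i)) :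
    ∃ (η : ℕ → ℝ) (ψn fn un wn vn : ℕ → ℝ → ℝ) (U : Ultrafilter ℕ) (u w : ℝ → ℝ),
      Scheme (phi q) f (C + 1) η ψn fn ∧
      (∀ n, ∀ s ∈ Icc βm βp, s ≠ 0 → primitive (fn n) s < 0) ∧ (U : Filter ℕ) ≤ atTop ∧
      (∀ n : ℕ, IsSol d (η n) (ψn n) (fn n) ((n : ℝ) + 1) (un n) (wn n)) ∧
      (∀ᶠ n : ℕ in (U : Filter ℕ), Alternates (k + 1) ((n : ℝ) + 1) (un n)) ∧
      (∀ n : ℕ, ¬Alternates (k + 1) ((n : ℝ) + 1) (vn n)) ∧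
      (∀ r, 0 ≤ r → ∀ ρ : ℕ → ℝ, (∀ᶠ n in (U : Filter ℕ), 0 ≤ ρ n) → Tendsto ρ U (𝓝 r) →
        Tendsto (fun n => un n (ρ n)) U (𝓝 (u r)) ∧
        Tendsto (fun n => wn n (ρ n)) U (𝓝 (w r))) ∧
      (∀ r, 0 ≤ r → Tendsto (fun n => vn n r) U (𝓝 (u r))) ∧
      IsGlobalSol d (phi q) f u w ∧ u 0 ∈ Icc (βp / 2) a := by
  have hβm := ht.betaMinus_neg
  have hβp := ht.betaPlus_pos
  have hβa := ht.betaPlus_lt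
  obtain ⟨ψn, fn, hS, hF, hreg⟩ := exists_scheme (continuous_phi hq) (monotone_phi hq) (phi_zero q)
    ht.uniform ht.bound ht.map_zero hβm.le hβp.le fun s hs => ht.primitive_nonpos hs
  have hT : Tendsto (fun n : ℕ => (n : ℝ) + 1) atTop atTop :=
    tendsto_atTop_add_const_right _ _ tendsto_natCast_atTop_atTop
  have hfam : ∀ (n : ℕ) (α : ℝ), ∃ u w,
      IsSol d (1 / ((n : ℝ) + 1)) (ψn n) (fn n) ((n : ℝ) + 1) u w ∧ u 0 = α := by
    intro n α
    obtain ⟨⟨K₁, h1⟩, ⟨K₂, h2⟩, B, h3⟩ := hreg n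
    exact exists_isSol (hS.eta_pos n) h1 h2 (C := max B (C + 1))
      (fun x => (h3 x).trans (le_max_left _ _)) (fun x => (hS.bound n x).trans (le_max_right _ _))
      (by positivity) α
  choose uu ww hsol h0 using hfam
  have hnot : ∀ n : ℕ, ¬Alternates (k + 1) ((n : ℝ) + 1) (uu n (βp / 2)) := fun n =>
    (hsol n _).not_alternates (hS.psi_cont n) (hS.psi_mono n) (hS.psi_zero n) (hS.f_cont n)
      (hS.eta_pos n).le (by
        rw [h0]; exact hF n _ ⟨by linarith, by linarith⟩ (by linarith)) k
  -- Otherwise an ultrafilter concentrated on the bad indices yields a limit starting at a. It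
  -- oscillates by `hosc`, and its sign changes pass back to bad approximations.
  have htop : ∀ᶠ n : ℕ in atTop, Alternates (k + 1) ((n : ℝ) + 1) (uu n a) := by
    by_contra hcon
    rw [not_eventually] at hcon
    set S := {n : ℕ | ¬Alternates (k + 1) ((n : ℝ) + 1) (uu n a)} with hSdef
    have : NeBot (atTop ⊓ 𝓟 S) := frequently_mem_iff_neBot.1 hcon
    set U := Ultrafilter.of (atTop ⊓ 𝓟 S) with hUdef
    have hU : (U : Filter ℕ) ≤ atTop := (Ultrafilter.of_le _).trans inf_le_left
    have hUS : ∀ᶠ n in (U : Filter ℕ), n ∈ S :=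
      (Ultrafilter.of_le (atTop ⊓ 𝓟 S)).trans inf_le_right (mem_principal_self S)
    obtain ⟨u, w, hg, hlim⟩ := hS.exists_limit (continuous_phi hq) ht.cont U hU hT
      (fun n => hsol n a) (B := |a|) fun n => by rw [h0]
    have hu0 : u 0 = a := by
      have := (hlim 0 le_rfl (fun _ => 0) (Eventually.of_forall fun _ => le_rfl)
        tendsto_const_nhds).1
      simp only [h0] at this
      exact tendsto_nhds_unique this tendsto_const_nhds
    obtain ⟨y, hy, hy0⟩ := hosc u w hg hu0 fun r hr =>
      ht.mem_Icc hq hg (by rw [hu0]; exact ⟨by linarith, le_rfl⟩) hr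
    have halt := IsGlobalSol.alternates_of_energy_pos hq ht.cont hg (by rw [hu0]; linarith) hy hy0
    have hev := halt.eventually (l := (U : Filter ℕ)) (un := fun n => uu n a) fun r hr =>
      (hlim r hr (fun _ => r) (Eventually.of_forall fun _ => hr) tendsto_const_nhds).1
    obtain ⟨n, h1, h2, h3⟩ := (hev.and (hUS.and (hU (hT.eventually_ge_atTop (y k + 1))))).exists
    exact h2 (h1.mono h3)
  have hdep : ∀ n : ℕ, ∃ K > 0, ∀ α α', ∀ t ∈ Icc (0 : ℝ) (n + 1),
      |uu n α t - uu n α' t| ≤ K * |α - α'| := by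
    intro n
    obtain ⟨⟨K₁, h1⟩, ⟨K₂, h2⟩, -⟩ := hreg n
    obtain ⟨K, hK, h⟩ := exists_dependence (d := d) (T := (n : ℝ) + 1) (hS.eta_pos n) h1 h2
    refine ⟨K, hK, fun α α' t ht => ?_⟩
    have := h _ _ _ _ (hsol n α) (hsol n α') t ht
    rwa [h0, h0] at this
  choose K hK hdep using hdep
  -- The gap is divided by the dependence constant K n, so the two solutions differ by at most
  -- 1/(n+1) on all of [0, n+1] and share their limit.
  choose α hα α' hα' hclose hnα' hαP using fun n : ℕ =>
    exists_close_pair (P := fun x => Alternates (k + 1) ((n : ℝ) + 1) (uu n x))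
      (a₁ := a) (δ := 1 / ((n : ℝ) + 1) / K n) (by linarith) (by have := hK n; positivity) (hnot n)
  obtain ⟨U, hU⟩ : ∃ U : Ultrafilter ℕ, (U : Filter ℕ) ≤ atTop :=
    ⟨Ultrafilter.of atTop, Ultrafilter.of_le _⟩
  obtain ⟨u, w, hg, hlim⟩ := hS.exists_limit (continuous_phi hq) ht.cont U hU hT
    (fun n => hsol n (α n)) (B := a) fun n => by
      rw [h0, abs_of_nonneg (by linarith [(hα n).1])]; exact (hα n).2
  have hlim' : ∀ r, 0 ≤ r → Tendsto (fun n => uu n (α n) r) U (𝓝 (u r)) := fun r hr =>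
    (hlim r hr (fun _ => r) (Eventually.of_forall fun _ => hr) tendsto_const_nhds).1
  refine ⟨_, ψn, fn, fun n => uu n (α n), fun n => ww n (α n), fun n => uu n (α' n), U, u, w, hS,
    hF, hU, fun n => hsol n _, ?_, hnα', hlim, fun r hr => ?_, hg, ?_⟩
  · exact hU (htop.mono fun n hn => hαP n hn)
  · have hz : Tendsto (fun n => uu n (α n) r - uu n (α' n) r) U (𝓝 0) := by
      refine squeeze_zero_norm' ?_ ((tendsto_one_div_add_atTop_nhds_zero_nat (𝕜 := ℝ)).mono_left hU)
      filter_upwards [hU (hT.eventually_ge_atTop r)] with n hn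
      have h1 := hdep n (α n) (α' n) r ⟨hr, hn⟩
      have h2 := mul_le_mul_of_nonneg_left (hclose n) (hK n).le
      rw [mul_div_cancel₀ _ (hK n).ne'] at h2
      exact h1.trans h2
    simpa using (hlim' r hr).sub hz
  · have h1 := hlim' 0 le_rfl
    simp only [h0] at h1
    exact isClosed_Icc.mem_of_tendsto h1 (Eventually.of_forall hα)

end RadialBoundState

/-! ### From the shooting limit to a bound state. -/

namespace RadialBoundState

variable {d : ℕ} {q C βm βp b a : ℝ} {f u w : ℝ → ℝ}

theorem exists_uniform_neg {F : ℝ → ℝ} (hF : Continuous F) {x y : ℝ} (hxy : x ≤ y)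
    (hneg : ∀ s ∈ Icc x y, F s < 0) : ∃ μ > 0, ∀ s ∈ Icc x y, F s ≤ -μ := by
  obtain ⟨s, hs, hmax⟩ := isCompact_Icc.exists_isMaxOn (nonempty_Icc.2 hxy) hF.continuousOn
  exact ⟨-F s, by linarith [hneg s hs], fun t ht => by linarith [isMaxOn_iff.1 hmax t ht]⟩

theorem exists_pos_mul_lt {A B : ℝ} (hA : 0 < A) (hB : 0 < B) : ∃ ε > 0, ε * A < B :=
  ⟨B / (2 * A), by positivity, by field_simp; linarith⟩

/-- The two properties of the solution obtained by shooting: it has at most `k` zeros and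
nonnegative energy before its first double zero, and `k` zeros before any point at which both the
solution and its energy are small. -/
theorem Truncated.exists_shooting_solution (ht : Truncated f βm βp b a C) (hq : 1 < q)
    (hd : 1 ≤ d) (k : ℕ)
    (hosc : ∀ u w, IsGlobalSol d (phi q) f u w → u 0 = a → (∀ r, 0 ≤ r → u r ∈ Icc b a) →
      ∃ y : ℕ → ℝ, (∀ i < k, y i < y (i + 1)) ∧
        ∀ i ≤ k, 0 < y i ∧ u (y i) = 0 ∧ 0 < energy (phi q) f u w (y i)) :
    ∃ u w : ℝ → ℝ, IsGlobalSol d (phi q) f u w ∧ u 0 ∈ Icc (βp / 2) a ∧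
      (∀ r₀, 0 ≤ r₀ → (∀ r ∈ Icc 0 r₀, u r = 0 → w r ≠ 0) →
        (¬∃ y : ℕ → ℝ, (∀ i < k, y i < y (i + 1)) ∧ ∀ i ≤ k, y i ∈ Icc 0 r₀ ∧ u (y i) = 0) ∧
        0 ≤ energy (phi q) f u w r₀) ∧
      ∀ ρ > 0, ∃ ε > 0, ∃ δ > 0, ∀ r₀ ≥ ρ, (∀ r ∈ Icc 0 r₀, u r = 0 → w r ≠ 0) → |u r₀| < δ →
        r₀ * energy (phi q) f u w r₀ < ε → 0 < k →
        ∃ y : ℕ → ℝ, (∀ i < k - 1, y i < y (i + 1)) ∧ ∀ i ≤ k - 1, y i ∈ Icc 0 r₀ ∧ u (y i) = 0 := by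
  have hβm := ht.betaMinus_neg
  have hβp := ht.betaPlus_pos
  obtain ⟨η, ψn, fn, un, wn, vn, U, u, w, hS, hFn, hU, hsol, halt, hnalt, hlim, hvlim, hg, hu0⟩ :=
    ht.exists_shooting_limit hq k hosc
  refine ⟨u, w, hg, hu0, ?_⟩
  have hT : Tendsto (fun n : ℕ => (n : ℝ) + 1) atTop atTop :=
    tendsto_atTop_add_const_right _ _ tendsto_natCast_atTop_atTop
  have hlimc : ∀ r, 0 ≤ r → Tendsto (fun n => un n r) U (𝓝 (u r)) ∧
      Tendsto (fun n => wn n r) U (𝓝 (w r)) := fun r hr =>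
    hlim r hr (fun _ => r) (Eventually.of_forall fun _ => hr) tendsto_const_nhds
  have hIlim : ∀ r, 0 ≤ r → Tendsto (fun n => energy (ψn n) (fn n) (un n) (wn n) r) U
      (𝓝 (energy (phi q) f u w r)) := fun r hr =>
    hS.tendsto_energy (continuous_phi hq) ht.cont hU (ρ := fun _ => r) (hlimc r hr).1 (hlimc r hr).2
  have hIanti : ∀ n, AntitoneOn (energy (ψn n) (fn n) (un n) (wn n)) (Icc 0 ((n : ℝ) + 1)) :=
    fun n => (hsol n).antitoneOn_energy (hS.psi_cont n) (hS.f_cont n) (hS.eta_pos n).le fun x =>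
      have h := primitive_nonneg_le_mul (hS.psi_mono n) (hS.psi_cont n) (hS.psi_zero n) x
      h.1.trans h.2
  have hIzero : ∀ n x, un n x = 0 → 0 ≤ energy (ψn n) (fn n) (un n) (wn n) x := fun n x hx => by
    rw [energy_eq_of_zero hx]
    exact (primitive_nonneg_le_mul (hS.psi_mono n) (hS.psi_cont n) (hS.psi_zero n) _).1
  have hz : ∀ n : ℕ, ∃ z : ℕ → ℝ, Alternates (k + 1) ((n : ℝ) + 1) (un n) →
      (∀ i < k, z i < z (i + 1)) ∧ (∀ i ≤ k, z i ∈ Icc 0 ((n : ℝ) + 1) ∧ un n (z i) = 0) ∧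
      ∀ i < k, ∃ x ∈ Icc (z i) (z (i + 1)), un n x ≠ 0 := by
    intro n
    by_cases h : Alternates (k + 1) ((n : ℝ) + 1) (un n)
    · obtain ⟨z, hz⟩ := h.exists_zeros (hsol n).contu
      exact ⟨z, fun _ => hz⟩
    · exact ⟨0, fun h' => absurd h' h⟩
  choose z hz using hz
  replace hz := halt.mono fun n hn => hz n hn
  -- k+1 simple zeros of u would give k+1 sign changes, inherited by the approximations `vn`, which
  -- do not have them.
  have hno : ∀ r₀, 0 ≤ r₀ → (∀ r ∈ Icc 0 r₀, u r = 0 → w r ≠ 0) →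
      ¬∃ y : ℕ → ℝ, (∀ i < k, y i < y (i + 1)) ∧ ∀ i ≤ k, y i ∈ Icc 0 r₀ ∧ u (y i) = 0 := by
    rintro r₀ - hnd ⟨y, hy, hy0⟩
    have h1 := hg.alternates_of_zeros hq (by linarith [hu0.1]) hy hy0 hnd
    obtain ⟨n, h2, h3⟩ := ((h1.eventually hvlim).and
      (hU (hT.eventually_ge_atTop (r₀ + 1)))).exists
    exact hnalt n (h2.mono h3)
  -- If the last zeros of `un` stayed in [0, r₀] along the ultrafilter, they would converge to k+1
  -- distinct zeros of u.
  have hlast : ∀ r₀, 0 ≤ r₀ → (∀ r ∈ Icc 0 r₀, u r = 0 → w r ≠ 0) →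
      ∀ᶠ n in (U : Filter ℕ), r₀ < z n k := by
    intro r₀ h0 hnd
    by_contra hcon
    refine hno r₀ h0 hnd (hS.exists_limit_zeros hq hU hsol hlim (z := z) hnd ?_)
    filter_upwards [hz, Ultrafilter.eventually_not.2 hcon] with n hn hn'
    exact ⟨hn.1, hn.2.1, not_lt.1 hn'⟩
  refine ⟨fun r₀ h0 hnd => ⟨hno r₀ h0 hnd, ?_⟩, fun ρ hρ => ?_⟩
  -- The approximate energy at r₀ is at least that at the later zero z n k, which is nonnegative.
  · refine ge_of_tendsto (hIlim r₀ h0) ?_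
    filter_upwards [hz, hlast r₀ h0 hnd] with n hn hlt
    obtain ⟨h1, h2⟩ := hn.2.1 k le_rfl
    exact (hIzero n _ h2).trans (hIanti n ⟨h0, hlt.le.trans h1.2⟩ h1 hlt.le)
  obtain ⟨μ₁, hμ₁, hF₁⟩ := exists_uniform_neg (continuous_primitive ht.cont)
    (by linarith : βm / 2 ≤ βm / 4) fun s hs => ht.primitive_neg s
      ⟨by linarith [hs.1], by linarith [hs.2]⟩ (by linarith [hs.2])
  obtain ⟨μ₂, hμ₂, hF₂⟩ := exists_uniform_neg (continuous_primitive ht.cont)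
    (by linarith : βp / 4 ≤ βp / 2) fun s hs => ht.primitive_neg s
      ⟨by linarith [hs.1], by linarith [hs.2]⟩ (by linarith [hs.1])
  -- Half of the gap is reserved for the error in replacing f by `fn n`.
  set μ := min μ₁ μ₂ / 2 with hμdef
  have hμ : 0 < μ := half_pos (lt_min hμ₁ hμ₂)
  obtain ⟨w₀, hw₀, v₀, hv₀, hlow⟩ := hS.exists_lower (strictMono_phi hq) (phi_zero q) hμ
  have hd' : (0 : ℝ) < d := by exact_mod_cast hd
  have hΔa : 0 < βm / 4 - βm / 2 := by linarith
  have hΔb : 0 < βp / 2 - βp / 4 := by linarith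
  obtain ⟨ε₁, hε₁, hε₁'⟩ := exists_pos_mul_lt
    (A := 1 + (βm / 4 - βm / 2) / (v₀ * ρ)) (B := d * w₀ * (βm / 4 - βm / 2))
    (by positivity) (by positivity)
  obtain ⟨ε₂, hε₂, hε₂'⟩ := exists_pos_mul_lt
    (A := 1 + (βp / 2 - βp / 4) / (v₀ * ρ)) (B := d * w₀ * (βp / 2 - βp / 4))
    (by positivity) (by positivity)
  set ε := min ε₁ ε₂ with hεdef
  have hε : 0 < ε := lt_min hε₁ hε₂
  refine ⟨ε, hε, min (-βm / 4) (βp / 4), lt_min (by linarith) (by linarith),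
    fun r₀ hr₀ hnd hur hI hk => ?_⟩
  have hr₀pos : 0 < r₀ := hρ.trans_le hr₀
  obtain ⟨j, rfl⟩ : ∃ j, k = j + 1 := ⟨k - 1, by omega⟩
  rw [Nat.add_sub_cancel]
  -- If instead z n j > r₀, the approximation is trapped near 0 from r₀ up to z n (j+1), so it
  -- vanishes identically between these two zeros, against its alternation.
  suffices hle : ∀ᶠ n in (U : Filter ℕ), z n j ≤ r₀ by
    refine hS.exists_limit_zeros hq hU hsol hlim (z := z) hnd ?_
    filter_upwards [hz, hle] with n hn hn'
    exact ⟨fun i hi => hn.1 i (by omega), fun i hi => hn.2.1 i (by omega), hn'⟩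
  by_contra hcon
  have hur' := abs_lt.1 hur
  have hmin₁ := min_le_left (-βm / 4) (βp / 4)
  have hmin₂ := min_le_right (-βm / 4) (βp / 4)
  have hEta : Tendsto (fun n => (r₀ + η n) * energy (ψn n) (fn n) (un n) (wn n) r₀) U
      (𝓝 ((r₀ + 0) * energy (phi q) f u w r₀)) :=
    (tendsto_const_nhds.add (hS.eta_lim.mono_left hU)).mul (hIlim r₀ hr₀pos.le)
  rw [add_zero] at hEta
  obtain ⟨n, hzn, hzr, hlown, hFlim, hE, hua, hub⟩ := (hz.and
    ((Ultrafilter.eventually_not.2 hcon).and ((hlow.filter_mono hU).and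
    (((hS.primitive_f_lim ht.cont μ hμ (max (-βm) βp)).filter_mono hU).and ((hEta.eventually_lt_const hI).and
    (((hlimc r₀ hr₀pos.le).1.eventually_const_lt (by linarith : βm / 4 < u r₀)).and
    ((hlimc r₀ hr₀pos.le).1.eventually_lt_const (by linarith : u r₀ < βp / 4)))))))).exists
  rw [not_le] at hzr
  have hj := hzn.2.1 j (by omega)
  have hk' := hzn.2.1 (j + 1) le_rfl
  have hjk := hzn.1 j (by omega)
  have hFnμ : ∀ x, |x| ≤ max (-βm) βp → primitive f x ≤ -(2 * μ) → primitive (fn n) x ≤ -μ := by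
    intro x hx hx'
    linarith [(abs_le.1 (hFlim x hx)).2]
  have hμ₁' : 2 * μ ≤ μ₁ := by rw [hμdef]; linarith [min_le_left μ₁ μ₂]
  have hμ₂' : 2 * μ ≤ μ₂ := by rw [hμdef]; linarith [min_le_right μ₁ μ₂]
  have hFneg : ∀ x ∈ Icc βm βp, primitive (fn n) x ≤ 0 := by
    intro x hx
    by_cases h0 : x = 0
    · rw [h0, primitive_zero]
    · exact (hFn n x hx h0).le
  have hεbound : ∀ Δ > 0, ∀ ε', ε ≤ ε' → ε' * (1 + Δ / (v₀ * ρ)) < d * w₀ * Δ →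
      ε * (1 + Δ / (v₀ * r₀)) < d * w₀ * Δ := by
    intro Δ hΔ ε' hle hlt
    refine lt_of_le_of_lt ?_ hlt
    have := hε.le.trans hle
    gcongr
  have htrap := (hsol n).trapped (hS.psi_cont n) (hS.psi_mono n) (hS.psi_zero n) (hS.f_cont n)
    (hS.eta_pos n).le hd hr₀pos (hzr.trans hjk).le hk'.1.2 (by linarith : βm / 2 < βm / 4)
    (by linarith : βp / 4 < βp / 2) ⟨hua, hub⟩
    (fun x hx => hFneg x ⟨by linarith [hx.1], by linarith [hx.2]⟩)
    (fun x hx => hFnμ x (le_max_of_le_left (abs_le.2 ⟨by linarith [hx.1], by linarith [hx.2]⟩))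
      (by linarith [hF₁ x hx]))
    (fun x hx => hFnμ x (le_max_of_le_right (abs_le.2 ⟨by linarith [hx.1], by linarith [hx.2]⟩))
      (by linarith [hF₂ x hx]))
    (hIzero n _ hk'.2) hw₀ hv₀ hlown hE.le (hεbound _ hΔa _ (min_le_left _ _) hε₁')
    (hεbound _ hΔb _ (min_le_right _ _) hε₂')
  have hzero := (hsol n).eq_zero_between_zeros (hS.psi_cont n) (hS.psi_mono n) (hS.psi_zero n)
    (hS.f_cont n) (hS.eta_pos n).le hj.1.1 hk'.1.2 hj.2 hk'.2 (hIzero n _ hk'.2)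
    (fun x hx h0 => hFn n x ⟨by linarith [hx.1], by linarith [hx.2]⟩ h0)
    (by linarith : βm / 2 < 0) (by linarith : 0 < βp / 2)
    fun r hr => htrap r ⟨hzr.le.trans hr.1, hr.2⟩
  obtain ⟨x, hx, hx0⟩ := hzn.2.2 j (by omega)
  exact hx0 (hzero x hx)

/-- Nonnegative energy is positive as long as there is no double zero. -/
theorem Truncated.energy_pos (ht : Truncated f βm βp b a C) (hq : 1 < q) (hd : 1 ≤ d)
    (hsol : IsGlobalSol d (phi q) f u w)
    (hI : ∀ r₀, 0 ≤ r₀ → (∀ r ∈ Icc 0 r₀, u r = 0 → w r ≠ 0) → 0 ≤ energy (phi q) f u w r₀)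
    {r₀ : ℝ} (h0 : 0 ≤ r₀) (hnd : ∀ r ∈ Icc 0 r₀, u r = 0 → w r ≠ 0) :
    0 < energy (phi q) f u w r₀ := by
  refine lt_of_le_of_ne (hI r₀ h0 hnd) fun hI0 => ?_
  have hpair : ContinuousWithinAt (fun r => (u r, w r)) (Ici 0) r₀ :=
    (hsol.contu r₀ h0).prodMk (hsol.contw r₀ h0)
  have hne : (u r₀, w r₀) ≠ ((0 : ℝ), (0 : ℝ)) := fun h =>
    hnd r₀ ⟨h0, le_rfl⟩ (Prod.mk.inj h).1 (Prod.mk.inj h).2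
  have hev : ∀ᶠ r in 𝓝[≥] r₀, (u r, w r) ≠ ((0 : ℝ), (0 : ℝ)) :=
    (hpair.mono (Ici_subset_Ici.2 h0)).eventually_ne hne
  obtain ⟨r₂, hr₂, hsub⟩ := (mem_nhdsGE_iff_exists_Icc_subset).1 hev
  have hr₂ : r₀ < r₂ := hr₂
  have hnd' : ∀ r ∈ Icc 0 r₂, u r = 0 → w r ≠ 0 := by
    intro r hr hur hwr
    rcases le_total r r₀ with h | h
    · exact hnd r ⟨hr.1, h⟩ hur hwr
    · exact hsub ⟨h, hr.2⟩ (by rw [hur, hwr])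
  -- Zero energy persists just after r₀, being nonnegative by `hI` and nonincreasing. Then
  -- dissipation gives w = 0, the equation gives f(u) = 0, and F(u) = 0 leaves only the excluded
  -- double zero.
  have hIz : ∀ r ∈ Ioo r₀ r₂, energy (phi q) f u w r = 0 := by
    intro r hr
    refine le_antisymm ?_ (hI r (h0.trans hr.1.le) fun s hs => hnd' s ⟨hs.1, hs.2.trans hr.2.le⟩)
    rw [hI0]
    exact hsol.antiI (continuous_phi hq) ht.cont (mul_phi_nonneg hq) h0
      (show (0 : ℝ) ≤ r from h0.trans hr.1.le) hr.1.le
  have hwz : ∀ r ∈ Ioo r₀ r₂, w r = 0 ∧ 0 < r := by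
    intro r hr
    have hr0 : 0 < r := h0.trans_lt hr.1
    refine ⟨?_, hr0⟩
    have h1 := hsol.dI (continuous_phi hq) ht.cont hr0
    have h2 : HasDerivAt (energy (phi q) f u w) 0 r :=
      (hasDerivAt_const r (0 : ℝ)).congr_of_eventuallyEq
        (eventually_of_mem (Ioo_mem_nhds hr.1 hr.2) hIz)
    have h3 := h1.unique h2
    by_contra hw
    have h4 : w r * phi q (w r) ≠ 0 := mul_ne_zero hw (mt (phi_eq_zero_iff hq).1 hw)
    have hd' : (d : ℝ) ≠ 0 := by positivity
    exact neg_ne_zero.2 (mul_ne_zero (div_ne_zero hd' hr0.ne') h4) h3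
  have hmid : (r₀ + r₂) / 2 ∈ Ioo r₀ r₂ := ⟨by linarith, by linarith⟩
  set r := (r₀ + r₂) / 2
  obtain ⟨hw, hr0⟩ := hwz r hmid
  have h1 := hsol.dw hr0
  have h2 : HasDerivAt w 0 r := (hasDerivAt_const r (0 : ℝ)).congr_of_eventuallyEq
    (eventually_of_mem (Ioo_mem_nhds hmid.1 hmid.2) fun s hs => (hwz s hs).1)
  have h3 := h1.unique h2
  rw [hw, mul_zero, neg_zero, zero_sub, neg_eq_zero] at h3
  have h4 := hIz r hmid
  simp only [energy, hw, primitive_zero, zero_add] at h4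
  exact hnd' r ⟨hr0.le, hmid.2.le⟩ (ht.eq_zero h3 h4) hw

theorem hasDerivAt_truncate {g g' : ℝ → ℝ} {R : ℝ} (hg : ∀ r, 0 < r → HasDerivAt g (g' r) r)
    (h0 : g R = 0) (h0' : g' R = 0) {r : ℝ} (hr : 0 < r) :
    HasDerivAt (fun r => if r < R then g r else 0) (if r < R then g' r else 0) r := by
  rcases lt_trichotomy r R with h | rfl | h
  · rw [if_pos h]
    refine (hg r hr).congr_of_eventuallyEq ?_
    filter_upwards [Iio_mem_nhds h] with s hs
    exact if_pos hs
  · rw [if_neg (lt_irrefl r)]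
    have h1 : HasDerivWithinAt (fun s => if s < r then g s else 0) 0 (Iio r) r := by
      have := (hg r hr).hasDerivWithinAt (s := Iio r)
      rw [h0'] at this
      exact this.congr (fun s hs => if_pos hs) (by simp [h0])
    have h2 : HasDerivWithinAt (fun s => if s < r then g s else 0) 0 (Ici r) r :=
      (hasDerivWithinAt_const r (Ici r) (0 : ℝ)).congr (fun s hs => if_neg (not_lt.2 hs)) (by simp)
    have := h1.union h2
    rwa [Iio_union_Ici, hasDerivWithinAt_univ] at this
  · rw [if_neg h.le.not_gt]
    refine (hasDerivAt_const r (0 : ℝ)).congr_of_eventuallyEq ?_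
    filter_upwards [Ioi_mem_nhds h] with s hs
    exact if_neg (le_of_lt hs).not_gt

theorem IsGlobalSol.of_hasDerivAt {ψ : ℝ → ℝ} (hu : ContinuousWithinAt u (Ici 0) 0)
    (hw : ContinuousWithinAt w (Ici 0) 0) (hdu : ∀ r, 0 < r → HasDerivAt u (ψ (w r)) r)
    (hdw : ∀ r, 0 < r → HasDerivAt w (-((d : ℝ) / r * w r) - f (u r)) r) (h0 : w 0 = 0) :
    IsGlobalSol d ψ f u w := fun T => by
  refine ⟨fun r hr => ?_, fun r hr => ?_, fun r hr => hdu r hr.1, fun r hr => ?_, h0⟩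
  · rcases hr.1.eq_or_lt with rfl | h
    · exact hu.mono Icc_subset_Ici_self
    · exact (hdu r h).continuousAt.continuousWithinAt
  · rcases hr.1.eq_or_lt with rfl | h
    · exact hw.mono Icc_subset_Ici_self
    · exact (hdw r h).continuousAt.continuousWithinAt
  · simpa using hdw r hr.1

/-- A solution can be continued by zero after a double zero. -/
theorem IsGlobalSol.truncate (hsol : IsGlobalSol d (phi q) f u w) (hf0 : f 0 = 0) {R : ℝ}
    (hR : 0 < R) (hu : u R = 0) (hw : w R = 0) :
    IsGlobalSol d (phi q) f (fun r => if r < R then u r else 0)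
      (fun r => if r < R then w r else 0) := by
  have hev : ∀ g : ℝ → ℝ, (fun r => if r < R then g r else 0) =ᶠ[𝓝[≥] 0] g := fun g =>
    eventually_of_mem (mem_nhdsWithin_of_mem_nhds (Iio_mem_nhds hR)) fun s hs => if_pos hs
  refine .of_hasDerivAt ((hsol.contu 0 self_mem_Ici).congr_of_eventuallyEq (hev u) (if_pos hR))
    ((hsol.contw 0 self_mem_Ici).congr_of_eventuallyEq (hev w) (if_pos hR))
    (fun r hr => ?_) (fun r hr => ?_) (by simp [hR, hsol.w0])
  · refine (hasDerivAt_truncate (g' := fun r => phi q (w r)) (fun r hr => hsol.du hr) hu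
      (by simp [hw, phi_zero]) hr).congr_deriv ?_
    split_ifs <;> simp [phi_zero]
  · refine (hasDerivAt_truncate (g' := fun r => -((d : ℝ) / r * w r) - f (u r))
      (fun r hr => hsol.dw hr) hw (by simp [hu, hw, hf0]) hr).congr_deriv ?_
    split_ifs <;> simp [hf0]

/-- Without double zeros, a solution with positive energy and finitely many zeros decays. -/
theorem Truncated.decay (ht : Truncated f βm βp b a C) (hq : 1 < q) (hd : 1 ≤ d) {k : ℕ}
    (hsol : IsGlobalSol d (phi q) f u w) (hu0 : u 0 ∈ Icc (βp / 2) a)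
    (hI : ∀ r, 0 ≤ r → 0 < energy (phi q) f u w r)
    (hno : ¬∃ y : ℕ → ℝ, (∀ i < k, y i < y (i + 1)) ∧ ∀ i ≤ k, 0 ≤ y i ∧ u (y i) = 0) :
    Tendsto u atTop (𝓝 0) ∧ ∀ ε > 0, ∀ᶠ r in atTop, r * energy (phi q) f u w r < ε := by
  have hβm := ht.betaMinus_neg
  have hβp := ht.betaPlus_pos
  have hrange : ∀ r, 0 ≤ r → u r ∈ Icc b a := fun r hr => ht.mem_Icc hq hsol hu0 hr
  -- Energy bounded below at a large time would produce k+1 further zeros.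
  have hI0 : Tendsto (energy (phi q) f u w) atTop (𝓝 0) := by
    rw [tendsto_order]
    refine ⟨fun x hx => (eventually_ge_atTop 0).mono fun r hr => hx.trans (hI r hr), fun x hx => ?_⟩
    obtain ⟨M, hM, h⟩ := exists_many_zeros (d := d) (e₁ := energy (phi q) f u w 0) hq ht.cont hβm hβp
      ht.lt_betaMinus.le ht.betaPlus_lt.le (fun s hs => ht.primitive_nonpos hs)
      (fun s hs => ht.pos s hs.1) (fun s hs => ht.neg s hs.2) hx k
    filter_upwards [eventually_ge_atTop M] with τ hτ
    by_contra hcon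
    have hτ0 : 0 ≤ τ := hM.le.trans hτ
    obtain ⟨y, hy, hy0⟩ := h u w hsol τ hτ (fun r hr => hrange r (hτ0.trans hr)) (not_lt.1 hcon)
      (hsol.antiI (continuous_phi hq) ht.cont (mul_phi_nonneg hq) self_mem_Ici hτ0 hτ0)
    exact hno ⟨y, hy, fun i hi => ⟨hτ0.trans (hy0 i hi).1, (hy0 i hi).2.1⟩⟩
  obtain ⟨hfin, -⟩ := finite_of_no_chain (Z := {r | 0 ≤ r ∧ u r = 0}) hno
  obtain ⟨B, hB⟩ := hfin.bddAbove
  set r₁ := max B 0 + 1 with hr₁def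
  have hr₁ : 0 < r₁ := by positivity
  have hne : ∀ r ≥ r₁, u r ≠ 0 := by
    intro r hr h0
    have h1 : r ≤ B := hB ⟨hr₁.le.trans hr, h0⟩
    have h2 := le_max_left B 0
    linarith
  have hc : ContinuousOn u (Ici r₁) := hsol.contu.mono (Ici_subset_Ici.2 hr₁.le)
  have hsign : (∀ r ≥ r₁, 0 < u r) ∨ ∀ r ≥ r₁, u r < 0 := by
    by_contra hcon
    push Not at hcon
    obtain ⟨⟨x, hx, hx'⟩, y, hy, hy'⟩ := hcon
    obtain ⟨z, hz, hz0⟩ := isPreconnected_Ici.intermediate_value hx hy hc ⟨hx', hy'⟩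
    exact hne z hz hz0
  have hu : Tendsto u atTop (𝓝 0) := by
    rcases hsign with h | h
    · exact hsol.tendsto_zero_of_pos hq ht.cont hr₁
        (fun s hs => ht.primitive_neg s ⟨hβm.trans hs.1, hs.2⟩ hs.1.ne')
        (Bp := a) (fun s hs => ht.pos s hs.1)
        (fun r hr => ⟨h r hr, (hrange r (hr₁.le.trans hr)).2⟩) (fun r hr => hI r (hr₁.le.trans hr)) hI0
    · have := hsol.reflect_phi.tendsto_zero_of_pos hq (continuous_reflect ht.cont) hr₁
        (βp := -βm) (Bp := -b) (fun s hs => ?_) (fun s hs => ?_) (fun r hr => ⟨?_, ?_⟩)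
        (fun r hr => ?_) ?_
      · simpa using this.neg
      · rw [primitive_reflect]
        exact ht.primitive_neg _ ⟨by linarith [hs.2], by linarith [hs.1]⟩ (by linarith [hs.1])
      · have := ht.neg (-s) (by linarith [hs.1])
        simpa [reflect] using this
      · simpa using h r hr
      · simpa using (hrange r (hr₁.le.trans hr)).1
      · rw [energy_reflect_phi]
        exact hI r (hr₁.le.trans hr)
      · rwa [energy_reflect_phi]
  refine ⟨hu, fun ε hε => ?_⟩
  obtain ⟨r₂, hr₂⟩ := eventually_atTop.1 (hu.eventually (Ioo_mem_nhds hβm hβp))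
  exact hsol.eventually_mul_energy_lt hq ht.cont hd (r₁ := max r₂ 1) (by positivity)
    (fun r hr => ht.primitive_nonpos (Ioo_subset_Icc_self (hr₂ r ((le_max_left _ _).trans hr)))) hε

/-- The data of a bound state with `k` zeros, for the first order system. -/
def HasBoundState (d k : ℕ) (q : ℝ) (f : ℝ → ℝ) (b a : ℝ) : Prop :=
  ∃ u w : ℝ → ℝ, IsGlobalSol d (phi q) f u w ∧ (∀ r, 0 ≤ r → u r ∈ Icc b a) ∧
    Tendsto u atTop (𝓝 0) ∧ u 0 ≠ 0 ∧ ∃ R : EReal, 0 < R ∧ (∀ r : ℝ, R ≤ (r : EReal) → u r = 0) ∧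
    {r : ℝ | 0 < r ∧ (r : EReal) < R ∧ u r = 0}.Finite ∧
    {r : ℝ | 0 < r ∧ (r : EReal) < R ∧ u r = 0}.ncard = k ∧
    ∀ r : ℝ, 0 < r → (r : EReal) < R → u r = 0 → w r ≠ 0

theorem exists_first_double_zero (hsol : IsGlobalSol d (phi q) f u w) (hu0 : 0 < u 0)
    (h : ∃ r, 0 ≤ r ∧ u r = 0 ∧ w r = 0) :
    ∃ R, 0 < R ∧ u R = 0 ∧ w R = 0 ∧ ∀ r, 0 ≤ r → r < R → u r = 0 → w r ≠ 0 := by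
  set D := {r | r ∈ Ici (0 : ℝ) ∧ (u r, w r) ∈ ({((0 : ℝ), (0 : ℝ))} : Set (ℝ × ℝ))} with hD
  have hclosed : IsClosed D :=
    (hsol.contu.prodMk hsol.contw).preimage_isClosed_of_isClosed isClosed_Ici isClosed_singleton
  have hbd : BddBelow D := ⟨0, fun x hx => hx.1⟩
  obtain ⟨r, hr, hur, hwr⟩ := h
  have hmem : sInf D ∈ D := hclosed.csInf_mem ⟨r, hr, by rw [hur, hwr]; rfl⟩ hbd
  have heq := Prod.mk.inj (mem_singleton_iff.1 hmem.2)
  refine ⟨sInf D, lt_of_le_of_ne hmem.1 fun h => ?_, heq.1, heq.2, fun s hs hlt hus hws => ?_⟩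
  · rw [← h] at heq
    linarith [heq.1]
  · exact hlt.not_ge (csInf_le hbd ⟨hs, by rw [hus, hws]; rfl⟩)

/-- Near a double zero, and near infinity if there is none, both u and r I(r) become small. There
the second property of the shooting solution supplies the k zeros, while the first allows no more.
-/
theorem Truncated.hasBoundState (ht : Truncated f βm βp b a C) (hq : 1 < q) (hd : 1 ≤ d) (k : ℕ)
    (hosc : ∀ u w, IsGlobalSol d (phi q) f u w → u 0 = a → (∀ r, 0 ≤ r → u r ∈ Icc b a) →
      ∃ y : ℕ → ℝ, (∀ i < k, y i < y (i + 1)) ∧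
        ∀ i ≤ k, 0 < y i ∧ u (y i) = 0 ∧ 0 < energy (phi q) f u w (y i)) :
    HasBoundState d k q f b a := by
  have hβp := ht.betaPlus_pos
  obtain ⟨u, w, hsol, hu0, hA, hB⟩ := ht.exists_shooting_solution hq hd k hosc
  have hu0' : 0 < u 0 := by linarith [hu0.1]
  by_cases hdz : ∃ r, 0 ≤ r ∧ u r = 0 ∧ w r = 0
  · obtain ⟨R, hR, huR, hwR, hnd⟩ := exists_first_double_zero hsol hu0' hdz
    have hnd' : ∀ r₀ < R, ∀ r ∈ Icc 0 r₀, u r = 0 → w r ≠ 0 := fun r₀ h r hr =>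
      hnd r hr.1 (hr.2.trans_lt h)
    have hsol' := hsol.truncate ht.map_zero hR huR hwR
    refine ⟨_, _, hsol', fun r hr => ht.mem_Icc hq hsol' (by rwa [if_pos hR]) hr, ?_,
      by rw [if_pos hR]; exact hu0'.ne', R, by exact_mod_cast hR, fun r hr => ?_, ?_⟩
    · refine tendsto_const_nhds.congr' ?_
      filter_upwards [eventually_ge_atTop R] with r hr
      exact (if_neg (not_lt.2 hr)).symm
    · exact if_neg (not_lt.2 (by exact_mod_cast hr))
    have hZ : {r : ℝ | 0 < r ∧ (r : EReal) < R ∧ (if r < R then u r else 0) = 0} =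
        {r | 0 < r ∧ r < R ∧ u r = 0} := by
      ext r
      simp only [mem_ofPred_eq, EReal.coe_lt_coe_iff]
      refine and_congr_right fun _ => and_congr_right fun h => ?_
      rw [if_pos h]
    rw [hZ, ← and_assoc]
    refine ⟨ncard_eq_of_chains ?_ ?_, fun r hr hrR => ?_⟩
    · rintro ⟨y, hy, hyZ⟩
      refine (hA (y k) (hyZ k le_rfl).1.le (hnd' _ (hyZ k le_rfl).2.1)).1
        ⟨y, hy, fun i hi => ⟨⟨(hyZ i hi).1.le, ?_⟩, (hyZ i hi).2.2⟩⟩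
      rcases hi.eq_or_lt with rfl | h
      · exact le_rfl
      · exact (chain_lt hy h le_rfl).le
    · intro hk
      obtain ⟨ε, hε, δ, hδ, hB⟩ := hB (R / 2) (by positivity)
      have hcu := (hsol.contu R hR.le).continuousAt (Ici_mem_nhds hR)
      have hcI := (hsol.contI (continuous_phi hq) ht.cont R hR.le).continuousAt (Ici_mem_nhds hR)
      have hIR : energy (phi q) f u w R = 0 := by
        simp [energy, huR, hwR, primitive_zero]
      have h1 : ∀ᶠ r in 𝓝 R, |u r| < δ :=
        (hcu.abs).eventually_lt_const (by simpa [huR] using hδ)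
      have h2 : ∀ᶠ r in 𝓝 R, r * energy (phi q) f u w r < ε :=
        (continuousAt_id.mul hcI).eventually_lt_const (by simpa [hIR] using hε)
      have h3 : ∀ᶠ r in 𝓝[<] R, R / 2 ≤ r :=
        (eventually_ge_nhds (by linarith)).filter_mono nhdsWithin_le_nhds
      obtain ⟨r₀, hr1, hr2, hr3, hr4⟩ := ((h1.filter_mono nhdsWithin_le_nhds).and
        ((h2.filter_mono nhdsWithin_le_nhds).and (h3.and
          (self_mem_nhdsWithin (s := Iio R) (a := R))))).exists
      obtain ⟨y, hy, hy0⟩ := hB r₀ hr3 (hnd' r₀ hr4) hr1 hr2 hk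
      refine ⟨y, hy, fun i hi => ⟨lt_of_le_of_ne (hy0 i hi).1.1 fun h => ?_,
        (hy0 i hi).1.2.trans_lt hr4, (hy0 i hi).2⟩⟩
      have := (hy0 i hi).2
      rw [← h] at this
      linarith
    · have hrR' : r < R := by exact_mod_cast hrR
      simp only [if_pos hrR']
      exact hnd r hr.le hrR'
  · have hnd : ∀ r, 0 ≤ r → u r = 0 → w r ≠ 0 := fun r hr hur hwr => hdz ⟨r, hr, hur, hwr⟩
    have hnd' : ∀ r₀, ∀ r ∈ Icc 0 r₀, u r = 0 → w r ≠ 0 := fun _ r hr => hnd r hr.1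
    have hno : ¬∃ y : ℕ → ℝ, (∀ i < k, y i < y (i + 1)) ∧ ∀ i ≤ k, 0 ≤ y i ∧ u (y i) = 0 := by
      rintro ⟨y, hy, hyZ⟩
      refine (hA (y k) (hyZ k le_rfl).1 (hnd' _)).1
        ⟨y, hy, fun i hi => ⟨⟨(hyZ i hi).1, ?_⟩, (hyZ i hi).2⟩⟩
      rcases hi.eq_or_lt with rfl | h
      · exact le_rfl
      · exact (chain_lt hy h le_rfl).le
    obtain ⟨hu, hI⟩ := ht.decay hq hd hsol hu0 (fun r hr => ht.energy_pos hq hd hsol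
      (fun r₀ h0 h => (hA r₀ h0 h).2) hr (hnd' r)) hno
    refine ⟨u, w, hsol, fun r hr => ht.mem_Icc hq hsol hu0 hr, hu, hu0'.ne', ⊤, EReal.zero_lt_top,
      fun r hr => absurd (top_le_iff.1 hr) (EReal.coe_ne_top r), ?_⟩
    rw [← and_assoc]
    refine ⟨ncard_eq_of_chains ?_ ?_, fun r hr _ => hnd r hr.le⟩
    · rintro ⟨y, hy, hyZ⟩
      exact hno ⟨y, hy, fun i hi => ⟨(hyZ i hi).1.le, (hyZ i hi).2.2⟩⟩
    · intro hk
      obtain ⟨ε, hε, δ, hδ, hB⟩ := hB 1 one_pos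
      have h1 : ∀ᶠ r in atTop, |u r| < δ := hu.abs.eventually_lt_const (by simpa using hδ)
      obtain ⟨r₀, hr1, hr2, hr3⟩ := (h1.and ((hI ε hε).and (eventually_ge_atTop 1))).exists
      obtain ⟨y, hy, hy0⟩ := hB r₀ hr3 (hnd' r₀) hr1 hr2 hk
      refine ⟨y, hy, fun i hi => ⟨lt_of_le_of_ne (hy0 i hi).1.1 fun h => ?_,
        EReal.coe_lt_top _, (hy0 i hi).2⟩⟩
      have := (hy0 i hi).2
      rw [← h] at this
      linarith

end RadialBoundState

/-! ### Back to the radial equation, and reduction to an energy bound at a fixed time. -/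

namespace RadialBoundState

variable {d k : ℕ} {m q C βm βp b a : ℝ} {f u w : ℝ → ℝ}

theorem HasBoundState.reflect (h : HasBoundState d k q (reflect f) b a) :
    HasBoundState d k q f (-a) (-b) := by
  obtain ⟨u, w, hsol, hr, hu, hu0, R, hR, hR0, hZ⟩ := h
  have hsol' := hsol.reflect_phi
  rw [reflect_reflect] at hsol'
  refine ⟨-u, -w, hsol', fun r h => ⟨?_, ?_⟩, neg_zero (G := ℝ) ▸ hu.neg, by simpa using hu0, R, hR,
    fun r h => by simp [hR0 r h], by simpa using hZ⟩
  · simpa using (hr r h).2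
  · simpa using (hr r h).1

theorem HasBoundState.congr {g : ℝ → ℝ} (h : HasBoundState d k q g b a)
    (hg : ∀ s ∈ Icc b a, g s = f s) : HasBoundState d k q f b a := by
  obtain ⟨u, w, hsol, hr, h⟩ := h
  exact ⟨u, w, hsol.congr_f fun r h0 => hg _ (hr r h0.le), hr, h⟩

theorem contDiffOn_one_Ici {g g' : ℝ → ℝ} {x : ℝ}
    (h : ∀ r ∈ Ici x, HasDerivWithinAt g (g' r) (Ici x) r) (hc : ContinuousOn g' (Ici x)) :
    ContDiffOn ℝ 1 g (Ici x) := by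
  rw [contDiffOn_one_iff_derivWithin (uniqueDiffOn_Ici x)]
  exact ⟨fun r hr => (h r hr).differentiableWithinAt,
    hc.congr fun r hr => (h r hr).derivWithin (uniqueDiffOn_Ici x r hr)⟩

namespace IsGlobalSol

theorem hasDerivWithinAt_u (hq : 1 < q) (h : IsGlobalSol d (phi q) f u w) :
    ∀ r ∈ Ici (0 : ℝ), HasDerivWithinAt u (phi q (w r)) (Ici 0) r := by
  intro r hr
  rcases (show (0 : ℝ) ≤ r from hr).eq_or_lt with rfl | h0
  · refine hasDerivWithinAt_Ici_of_tendsto_deriv (s := Ioi 0)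
      (fun r hr => (h.du hr).differentiableAt.differentiableWithinAt)
      ((h.contu 0 self_mem_Ici).mono Ioi_subset_Ici_self) self_mem_nhdsWithin ?_
    have h1 : Tendsto (fun r => phi q (w r)) (𝓝[>] 0) (𝓝 (phi q (w 0))) :=
      ((continuous_phi hq).tendsto _).comp
        ((h.contw 0 self_mem_Ici).mono Ioi_subset_Ici_self)
    exact h1.congr' (eventually_of_mem self_mem_nhdsWithin fun r hr => (h.du hr).deriv.symm)
  · exact (h.du h0).hasDerivWithinAt

/-- L'Hôpital's rule for r^d w / r^(d+1). The limit is the value w'(0), needed for φ_m(u') to be C¹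
at the origin. -/
theorem tendsto_div (hf : Continuous f) (h : IsGlobalSol d (phi q) f u w) :
    Tendsto (fun r => w r / r) (𝓝[>] 0) (𝓝 (-f (u 0) / (d + 1))) := by
  have hw : Tendsto w (𝓝[>] 0) (𝓝 0) := by
    have := (h.contw 0 self_mem_Ici).mono Ioi_subset_Ici_self
    rwa [ContinuousWithinAt, h.w0] at this
  have hfu : Tendsto (fun r => f (u r)) (𝓝[>] 0) (𝓝 (f (u 0))) :=
    (hf.tendsto _).comp ((h.contu 0 self_mem_Ici).mono Ioi_subset_Ici_self)
  have hid : Tendsto (fun r : ℝ => r) (𝓝[>] 0) (𝓝 0) := tendsto_id.mono_left nhdsWithin_le_nhds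
  have hd : (d : ℝ) + 1 ≠ 0 := by positivity
  have key : Tendsto (fun r => (r ^ d * w r) / r ^ (d + 1)) (𝓝[>] 0)
      (𝓝 (-f (u 0) / (d + 1))) := by
    refine HasDerivAt.lhopital_zero_right_on_Ioo (b := 1) (f' := fun r => -(r ^ d * f (u r)))
      (g' := fun r => ((d : ℝ) + 1) * r ^ d) one_pos (fun r hr => ?_) (fun r hr => ?_)
      (fun r hr => ?_) ?_ ?_ ?_
    · have := (h (r + 1)).hasDerivAt_weighted le_rfl (r := r) ⟨hr.1, by linarith⟩
      simpa using this
    · simpa using (hasDerivAt_id' r).fun_pow (d + 1)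
    · have := hr.1
      positivity
    · simpa using (hid.pow d).mul hw
    · simpa using hid.pow (d + 1)
    · refine (hfu.neg.div_const ((d : ℝ) + 1)).congr' ?_
      filter_upwards [self_mem_nhdsWithin] with r hr
      have hr : r ≠ 0 := (show (0 : ℝ) < r from hr).ne'
      field_simp
  refine key.congr' ?_
  filter_upwards [self_mem_nhdsWithin] with r hr
  have hr : r ≠ 0 := (show (0 : ℝ) < r from hr).ne'
  field_simp
  ring

theorem exists_deriv_w (hf : Continuous f) (h : IsGlobalSol d (phi q) f u w) :
    ∃ w' : ℝ → ℝ, ContinuousOn w' (Ici 0) ∧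
      (∀ r ∈ Ici (0 : ℝ), HasDerivWithinAt w (w' r) (Ici 0) r) ∧
      ∀ r, 0 < r → w' r = -((d : ℝ) / r * w r) - f (u r) := by
  set w' : ℝ → ℝ := fun r => if r = 0 then -f (u 0) / (d + 1) else -((d : ℝ) / r * w r) - f (u r)
    with hw'
  have hpos : ∀ r, 0 < r → w' r = -((d : ℝ) / r * w r) - f (u r) := fun r hr => if_neg hr.ne'
  have hlim : Tendsto w' (𝓝[>] 0) (𝓝 (w' 0)) := by
    have hfu : Tendsto (fun r => f (u r)) (𝓝[>] 0) (𝓝 (f (u 0))) :=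
      (hf.tendsto _).comp ((h.contu 0 self_mem_Ici).mono Ioi_subset_Ici_self)
    have h1 := (((h.tendsto_div hf).const_mul (d : ℝ)).neg).sub hfu
    have h2 : w' 0 = -((d : ℝ) * (-f (u 0) / (d + 1))) - f (u 0) := by
      simp only [hw', if_true]
      field_simp
      ring
    rw [h2]
    refine h1.congr' (eventually_of_mem self_mem_nhdsWithin fun r hr => ?_)
    rw [hpos r hr]
    ring
  refine ⟨w', fun r hr => ?_, fun r hr => ?_, hpos⟩
  · rcases (show (0 : ℝ) ≤ r from hr).eq_or_lt with rfl | h0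
    · rw [← continuousWithinAt_Ioi_iff_Ici]
      exact hlim
    · have h1 : ContinuousAt (fun r => -((d : ℝ) / r * w r) - f (u r)) r := by
        have h2 := (h.du h0).continuousAt
        have h3 := (h.dw h0).continuousAt
        have h4 : ContinuousAt (fun r => f (u r)) r := hf.continuousAt.comp h2
        have h5 : r ≠ 0 := h0.ne'
        fun_prop (disch := assumption)
      refine (h1.congr ?_).continuousWithinAt
      filter_upwards [Ioi_mem_nhds h0] with s hs
      exact (hpos s hs).symm
  · rcases (show (0 : ℝ) ≤ r from hr).eq_or_lt with rfl | h0
    · refine hasDerivWithinAt_Ici_of_tendsto_deriv (s := Ioi 0)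
        (fun r hr => (h.dw hr).differentiableAt.differentiableWithinAt)
        ((h.contw 0 self_mem_Ici).mono Ioi_subset_Ici_self) self_mem_nhdsWithin ?_
      refine hlim.congr' (eventually_of_mem self_mem_nhdsWithin fun r hr => ?_)
      exact (hpos r hr).trans (h.dw hr).deriv.symm
    · rw [hpos r h0]
      exact (h.dw h0).hasDerivWithinAt

end IsGlobalSol

theorem HasBoundState.exists_isBoundState (hm : 1 < m) (hf : Continuous f)
    (h : HasBoundState d k (m / (m - 1)) f b a) :
    ∃ u : ℝ → ℝ, IsBoundState (d + 1) m f u ∧ HasExactlyZeros k u := by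
  obtain ⟨u, w, hsol, -, hu, hu0, R, hR, hR0, hfin, hcard, hsimple⟩ := h
  have hq := one_lt_conj hm
  have hdu := hsol.hasDerivWithinAt_u hq
  obtain ⟨w', hw'c, hdw, hw'⟩ := hsol.exists_deriv_w hf
  have huniq := uniqueDiffOn_Ici (0 : ℝ)
  have hrad : ∀ r ∈ Ici (0 : ℝ), radialDeriv u r = phi (m / (m - 1)) (w r) := fun r hr =>
    (hdu r hr).derivWithin (huniq r hr)
  have hflux : ∀ r ∈ Ici (0 : ℝ), flux m u r = w r := fun r hr => by
    rw [flux, hrad r hr, phi_phi_conj hm]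
  have hdflux : ∀ r ∈ Ici (0 : ℝ), HasDerivWithinAt (flux m u) (w' r) (Ici 0) r := fun r hr =>
    (hdw r hr).congr hflux (hflux r hr)
  refine ⟨u, ⟨contDiffOn_one_Ici hdu ((continuous_phi hq).comp_continuousOn hsol.contw),
    contDiffOn_one_Ici hdflux hw'c, fun r hr => ?_, ?_, hu, ?_⟩, R, hR, hR0, hfin, hcard,
    fun r hr hrR h0 => ?_⟩
  · rw [radialDeriv, (hdflux r hr.le).derivWithin (huniq r hr.le), hflux r hr.le, hw' r hr]
    push_cast
    ring
  · rw [hrad 0 self_mem_Ici, hsol.w0, phi_zero]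
  · obtain ⟨r, h1, h2⟩ := ((hu.eventually_ne hu0.symm).and (eventually_ge_atTop 0)).exists
    exact ⟨r, h2, 0, le_rfl, h1⟩
  · rw [hrad r hr.le, Ne, phi_eq_zero_iff hq]
    exact hsimple r hr hrR h0

/-- The continuity of `f` and the sign structure of its primitive near the origin. -/
structure Shape (f : ℝ → ℝ) (βm βp : ℝ) : Prop where
  cont : Continuous f
  betaMinus_neg : βm < 0
  betaPlus_pos : 0 < βp
  primitive_neg : ∀ s ∈ Ioo βm βp, s ≠ 0 → primitive f s < 0
  primitive_betaMinus : primitive f βm = 0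
  primitive_betaPlus : primitive f βp = 0

/-- Two points `b < βm` and `a > βp` at the same level of the primitive of `f`, with `f` of constant
sign on `[b, βm]` and on `[βp, a]`. -/
structure Level (f : ℝ → ℝ) (βm βp b a : ℝ) : Prop where
  lt_betaMinus : b < βm
  betaPlus_lt : βp < a
  pos : ∀ s ∈ Icc βp a, 0 < f s
  neg : ∀ s ∈ Icc b βm, f s < 0
  equal : primitive f b = primitive f a

theorem Shape.reflect (h : Shape f βm βp) : Shape (reflect f) (-βp) (-βm) where
  cont := continuous_reflect h.cont
  betaMinus_neg := by linarith [h.betaPlus_pos]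
  betaPlus_pos := by linarith [h.betaMinus_neg]
  primitive_neg s hs h0 := by
    rw [primitive_reflect]
    exact h.primitive_neg _ ⟨by linarith [hs.2], by linarith [hs.1]⟩ (neg_ne_zero.2 h0)
  primitive_betaMinus := by rw [primitive_reflect, neg_neg, h.primitive_betaPlus]
  primitive_betaPlus := by rw [primitive_reflect, neg_neg, h.primitive_betaMinus]

theorem Level.reflect (h : Level f βm βp b a) : Level (reflect f) (-βp) (-βm) (-a) (-b) where
  lt_betaMinus := by linarith [h.betaPlus_lt]
  betaPlus_lt := by linarith [h.lt_betaMinus]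
  pos s hs := by
    have := h.neg (-s) ⟨by linarith [hs.2], by linarith [hs.1]⟩
    simpa [RadialBoundState.reflect] using this
  neg s hs := by
    have := h.pos (-s) ⟨by linarith [hs.2], by linarith [hs.1]⟩
    simpa [RadialBoundState.reflect] using this
  equal := by simp [primitive_reflect, h.equal]

theorem Shape.primitive_nonpos (h : Shape f βm βp) {s : ℝ} (hs : s ∈ Icc βm βp) :
    primitive f s ≤ 0 := by
  rcases hs.1.eq_or_lt with rfl | h1
  · exact h.primitive_betaMinus.le
  rcases hs.2.eq_or_lt with rfl | h2
  · exact h.primitive_betaPlus.le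
  by_cases h0 : s = 0
  · rw [h0, primitive_zero]
  · exact (h.primitive_neg s ⟨h1, h2⟩ h0).le

theorem Level.strictMonoOn (h : Level f βm βp b a) (hf : Continuous f) :
    StrictMonoOn (primitive f) (Icc βp a) := by
  refine strictMonoOn_of_deriv_pos (convex_Icc _ _) (continuous_primitive hf).continuousOn ?_
  intro x hx
  rw [interior_Icc] at hx
  rw [(hasDerivAt_primitive hf x).deriv]
  exact h.pos x (Ioo_subset_Icc_self hx)

theorem Level.strictAntiOn (h : Level f βm βp b a) (hf : Continuous f) :
    StrictAntiOn (primitive f) (Icc b βm) := by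
  refine strictAntiOn_of_deriv_neg (convex_Icc _ _) (continuous_primitive hf).continuousOn ?_
  intro x hx
  rw [interior_Icc] at hx
  rw [(hasDerivAt_primitive hf x).deriv]
  exact h.neg x (Ioo_subset_Icc_self hx)

theorem Level.primitive_pos (h : Level f βm βp b a) (hs : Shape f βm βp) : 0 < primitive f a := by
  have := h.strictMonoOn hs.cont ⟨le_rfl, h.betaPlus_lt.le⟩ ⟨h.betaPlus_lt.le, le_rfl⟩ h.betaPlus_lt
  rwa [hs.primitive_betaPlus] at this

/-- Levels are nested. -/
theorem Level.mem_Icc_of_le {b₀ a₀ : ℝ} (h : Level f βm βp b a) (h₀ : Level f βm βp b₀ a₀)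
    (hf : Continuous f) {s : ℝ} (hs : s ∈ Icc b a) (hle : primitive f s ≤ primitive f a₀) :
    s ∈ Icc b₀ a₀ := by
  constructor
  · by_contra hcon
    have hcon := not_le.1 hcon
    have := h.strictAntiOn hf ⟨hs.1, (hcon.trans h₀.lt_betaMinus).le⟩
      ⟨hs.1.trans hcon.le, h₀.lt_betaMinus.le⟩ hcon
    rw [h₀.equal] at this
    linarith
  · by_contra hcon
    have hcon := not_le.1 hcon
    have := h.strictMonoOn hf ⟨h₀.betaPlus_lt.le, hcon.le.trans hs.2⟩
      ⟨(h₀.betaPlus_lt.trans hcon).le, hs.2⟩ hcon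
    linarith

theorem primitive_comp_clamp (hb : b ≤ 0) (ha : 0 ≤ a) {s : ℝ}
    (hs : s ∈ Icc b a) : primitive (fun t => f (clamp b a t)) s = primitive f s := by
  refine intervalIntegral.integral_congr fun t ht => ?_
  have : t ∈ Icc b a := (Set.ordConnected_Icc.uIcc_subset ⟨hb, ha⟩ hs) ht
  simp only [clamp_of_mem this]

/-- Freezing f outside [b, a] keeps its sign at both ends, so the sign structure extends to the
whole line. -/
theorem Shape.exists_truncated (hs : Shape f βm βp) (h : Level f βm βp b a) :
    ∃ C, Truncated (fun s => f (clamp b a s)) βm βp b a C := by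
  have hb : b < 0 := h.lt_betaMinus.trans hs.betaMinus_neg
  have ha : 0 < a := hs.betaPlus_pos.trans h.betaPlus_lt
  have hba := hb.le.trans ha.le
  have hprim : ∀ s ∈ Icc b a, primitive (fun t => f (clamp b a t)) s = primitive f s := fun s =>
    primitive_comp_clamp hb.le ha.le
  have hm := hs.betaMinus_neg
  have hp := hs.betaPlus_pos
  have hbm := h.lt_betaMinus
  have hpa := h.betaPlus_lt
  obtain ⟨C, -, hC⟩ := exists_bound_comp_clamp hs.cont hba
  refine ⟨C, uniformContinuous_comp_clamp hs.cont hba, hC, hm, hp, hbm, hpa, fun s h1 h2 => ?_,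
    ?_, ?_, fun s h1 => ?_, fun s h1 => ?_, ?_⟩
  · rw [hprim s ⟨by linarith [h1.1], by linarith [h1.2]⟩]
    exact hs.primitive_neg s h1 h2
  · rw [hprim _ ⟨by linarith, by linarith⟩, hs.primitive_betaMinus]
  · rw [hprim _ ⟨by linarith, by linarith⟩, hs.primitive_betaPlus]
  · have h2 := monotone_clamp b a h1
    rw [clamp_of_mem (s := βp) ⟨by linarith, by linarith⟩] at h2
    exact h.pos _ ⟨h2, (clamp_mem hba s).2⟩
  · have h2 := monotone_clamp b a h1
    rw [clamp_of_mem (s := βm) ⟨by linarith, by linarith⟩] at h2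
    exact h.neg _ ⟨(clamp_mem hba s).1, h2⟩
  · rw [hprim _ ⟨le_rfl, hba⟩, hprim _ ⟨hba, le_rfl⟩, h.equal]

theorem Shape.hasBoundState (hs : Shape f βm βp) (h : Level f βm βp b a) (hq : 1 < q) (hd : 1 ≤ d)
    (hosc : ∀ u w, IsGlobalSol d (phi q) f u w → u 0 = a → (∀ r, 0 ≤ r → u r ∈ Icc b a) →
      ∃ y : ℕ → ℝ, (∀ i < k, y i < y (i + 1)) ∧
        ∀ i ≤ k, 0 < y i ∧ u (y i) = 0 ∧ 0 < energy (phi q) f u w (y i)) :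
    HasBoundState d k q f b a := by
  obtain ⟨C, ht⟩ := hs.exists_truncated h
  have hfg : ∀ s ∈ Icc b a, f (clamp b a s) = f s := fun s h => by rw [clamp_of_mem h]
  refine (ht.hasBoundState hq hd k fun u w hsol hu0 hr => ?_).congr hfg
  obtain ⟨y, hy, hy0⟩ := hosc u w (hsol.congr_f fun r h0 => hfg _ (hr r h0.le)) hu0 hr
  refine ⟨y, hy, fun i hi => ⟨(hy0 i hi).1, (hy0 i hi).2.1, ?_⟩⟩
  -- At a zero of u the energy does not involve the nonlinearity, so it is the same for f and its
  -- truncation.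
  rw [energy_eq_of_zero (hy0 i hi).2.1]
  have := (hy0 i hi).2.2
  rwa [energy_eq_of_zero (hy0 i hi).2.1] at this

/-- A solution whose energy stays above a fixed level for long enough has many zeros. -/
theorem Shape.exists_time (hs : Shape f βm βp) (hq : 1 < q) {b₀ a₀ : ℝ}
    (h₀ : Level f βm βp b₀ a₀) (k : ℕ) : ∃ M > 0, ∀ b a, Level f βm βp b a → ∀ u w,
      IsGlobalSol d (phi q) f u w → (∀ r, 0 ≤ r → u r ∈ Icc b a) →
      primitive f a₀ ≤ energy (phi q) f u w M → ∃ y : ℕ → ℝ, (∀ i < k, y i < y (i + 1)) ∧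
        ∀ i ≤ k, 0 < y i ∧ u (y i) = 0 ∧ 0 < energy (phi q) f u w (y i) := by
  have he := h₀.primitive_pos hs
  obtain ⟨M, hM, hosc⟩ := exists_many_zeros (d := d) (e₁ := primitive f a₀) hq hs.cont
    hs.betaMinus_neg hs.betaPlus_pos h₀.lt_betaMinus.le h₀.betaPlus_lt.le
    (fun s h => hs.primitive_nonpos h) h₀.pos h₀.neg he k
  refine ⟨M, hM, fun b a h u w hsol hr hI => ?_⟩
  have hanti := hsol.antiI (continuous_phi hq) hs.cont (mul_phi_nonneg hq)
  by_cases hlow : ∃ τ ≥ M, energy (phi q) f u w τ ≤ primitive f a₀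
  · obtain ⟨τ, hτ, hIτ⟩ := hlow
    have hc := (hsol.contI (continuous_phi hq) hs.cont).mono
      (Icc_subset_Ici_self.trans (Ici_subset_Ici.2 hM.le) : Icc M τ ⊆ Ici 0)
    obtain ⟨σ, hσ, hIσ⟩ := intermediate_value_Icc' hτ hc ⟨hIτ, hI⟩
    have hσ0 : 0 < σ := hM.trans_le hσ.1
    have hrange : ∀ r ≥ σ, u r ∈ Icc b₀ a₀ := by
      intro r hr'
      have hr0 : 0 ≤ r := hσ0.le.trans hr'
      refine h.mem_Icc_of_le h₀ hs.cont (hr r hr0) ?_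
      have h1 := hanti hσ0.le hr0 hr'
      have h2 := primitive_phi_nonneg hq (w r)
      rw [hIσ, energy] at h1
      linarith
    obtain ⟨y, hy, hy0⟩ := hosc u w hsol σ hσ.1 hrange hIσ.ge hIσ.le
    exact ⟨y, hy, fun i hi => ⟨hσ0.trans_le (hy0 i hi).1, (hy0 i hi).2⟩⟩
  · push Not at hlow
    obtain ⟨M', hM', hosc'⟩ := exists_many_zeros (d := d) (e₁ := energy (phi q) f u w 0) hq hs.cont
      hs.betaMinus_neg hs.betaPlus_pos h.lt_betaMinus.le h.betaPlus_lt.le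
      (fun s h => hs.primitive_nonpos h) h.pos h.neg he k
    have hτ0 : 0 < max M M' := lt_max_of_lt_left hM
    obtain ⟨y, hy, hy0⟩ := hosc' u w hsol (max M M') (le_max_right _ _)
      (fun r hr' => hr r (hτ0.le.trans hr')) (hlow _ (le_max_left _ _)).le
      (hanti self_mem_Ici hτ0.le hτ0.le)
    exact ⟨y, hy, fun i hi => ⟨hτ0.trans_le (hy0 i hi).1, (hy0 i hi).2⟩⟩

theorem Shape.exists_hasBoundState (hs : Shape f βm βp) (hq : 1 < q) (hd : 1 ≤ d) {b₀ a₀ : ℝ}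
    (h₀ : Level f βm βp b₀ a₀) (hM : ∀ M > 0, ∃ b a, Level f βm βp b a ∧ ∀ u w,
      IsGlobalSol d (phi q) f u w → u 0 = a → (∀ r, 0 ≤ r → u r ∈ Icc b a) →
      primitive f a₀ ≤ energy (phi q) f u w M) (k : ℕ) : ∃ b a, HasBoundState d k q f b a := by
  obtain ⟨M, hM0, hzeros⟩ := hs.exists_time (d := d) hq h₀ k
  obtain ⟨b, a, h, hE⟩ := hM M hM0
  exact ⟨b, a, hs.hasBoundState h hq hd fun u w hsol hu0 hr =>
    hzeros b a h u w hsol hr (hE u w hsol hu0 hr)⟩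

end RadialBoundState

/-! ### Initial heights from which the energy stays large. -/

namespace RadialBoundState

variable {d k : ℕ} {m q βm βp b a : ℝ} {f u w : ℝ → ℝ}

theorem IsGlobalSol.nonpos_of_nonneg (hsol : IsGlobalSol d (phi q) f u w) {r : ℝ} (hr : 0 ≤ r)
    (hf : ∀ t ∈ Ioo 0 r, 0 ≤ f (u t)) : w r ≤ 0 := by
  have := (hsol r).reflect.neg_mul_le le_rfl (r := r) ⟨hr, le_rfl⟩ le_rfl fun t ht => by
    simpa [RadialBoundState.reflect] using hf t ht
  simpa using this

theorem conj_exponent (hm : 1 < m) : (m - 1) * (m / (m - 1) - 1) = 1 := by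
  have : m - 1 ≠ 0 := by linarith
  field_simp
  ring

/-- Near an end of the range at which `f` vanishes fast enough, solutions stay close to that end
for a long time. -/
theorem IsGlobalSol.lt_of_close (hm : 1 < m) (hsol : IsGlobalSol d (phi (m / (m - 1))) f u w)
    {g L₀ x M : ℝ} (hL : 0 ≤ L₀) (hM : 0 ≤ M) (hf : ∀ s ∈ Icc x (u 0), 0 ≤ f s)
    (hfL : ∀ s ∈ Icc x (u 0), f s ≤ L₀ * (g - s) ^ (m - 1)) (hg : u 0 < g) (hx : x < u 0)
    (hle : ∀ r, 0 ≤ r → u r ≤ u 0)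
    (hsmall : (g - u 0) * Real.exp ((L₀ * M) ^ (m / (m - 1) - 1) * M) < g - x) : x < u M := by
  have hq := one_lt_conj hm
  by_contra hcon
  obtain ⟨c, hc, hc0, hcx⟩ := exists_first_zero (g := fun r => x - u r) hM
    (continuousOn_const.sub (hsol.contu.mono Icc_subset_Ici_self)) (by linarith)
    (by linarith [not_lt.1 hcon])
  have huc : u c = x := by linarith
  have hrange : ∀ r ∈ Icc 0 c, u r ∈ Icc x (u 0) := by
    intro r hr
    refine ⟨?_, hle r hr.1⟩
    rcases hr.2.eq_or_lt with rfl | h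
    · exact huc.ge
    · linarith [hcx r ⟨hr.1, h⟩]
  have hwneg : ∀ r ∈ Icc 0 c, w r ≤ 0 := fun r hr =>
    hsol.nonpos_of_nonneg hr.1 fun t ht => hf _ (hrange t ⟨ht.1.le, ht.2.le.trans hr.2⟩)
  have hanti : AntitoneOn u (Icc 0 c) := by
    refine antitoneOn_of_hasDerivWithinAt_nonpos (convex_Icc 0 c)
      (hsol.contu.mono Icc_subset_Ici_self) (f' := fun r => phi (m / (m - 1)) (w r)) ?_ ?_
    · intro r hr
      rw [interior_Icc] at hr
      exact (hsol.du hr.1).hasDerivWithinAt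
    · intro r hr
      have := monotone_phi hq (hwneg r (interior_subset hr))
      rwa [phi_zero] at this
  -- Integrating the equation gives -w(r) ≤ L₀ M (g - u(r))^(m-1). Since (m-1)(q-1) = 1, applying
  -- φ_q makes this linear, (g - u)' ≤ K (g - u), and Gronwall's argument applies.
  set K := (L₀ * M) ^ (m / (m - 1) - 1) with hK
  have hK0 : 0 ≤ K := by positivity
  have hder : ∀ r ∈ Ioo 0 c, -(K * (g - u r)) ≤ phi (m / (m - 1)) (w r) := by
    intro r hr
    have hr' := Ioo_subset_Icc_self hr
    have hz : 0 < g - u r := by linarith [hle r hr.1.le]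
    have h1 : -(L₀ * (g - u r) ^ (m - 1) * r) ≤ w r := by
      refine (hsol r).neg_mul_le le_rfl ⟨hr.1.le, le_rfl⟩ (by positivity) fun t ht => ?_
      have ht' : t ∈ Icc 0 c := ⟨ht.1.le, ht.2.le.trans hr.2.le⟩
      refine (hfL _ (hrange t ht')).trans ?_
      have h2 := hanti ht' hr' ht.2.le
      have h3 : 0 ≤ g - u t := by linarith [hle t ht.1.le]
      have h4 : 0 ≤ m - 1 := by linarith
      gcongr
    have h2 : -(L₀ * M * (g - u r) ^ (m - 1)) ≤ w r := by
      have h3 : r ≤ M := hr.2.le.trans hc.2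
      have h4 : L₀ * (g - u r) ^ (m - 1) * r ≤ L₀ * (g - u r) ^ (m - 1) * M := by gcongr
      linarith
    have h3 := monotone_phi hq h2
    rw [phi_neg, phi_of_nonneg hq (by positivity), Real.mul_rpow (by positivity) (by positivity),
      ← Real.rpow_mul hz.le, conj_exponent hm, Real.rpow_one] at h3
    exact h3
  have hG : AntitoneOn (fun r => (g - u r) * Real.exp (-(K * r))) (Icc 0 c) := by
    refine antitoneOn_of_hasDerivWithinAt_nonpos (convex_Icc 0 c)
      (f' := fun r => (-phi (m / (m - 1)) (w r) - K * (g - u r)) * Real.exp (-(K * r))) ?_ ?_ ?_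
    · have := hsol.contu.mono (Icc_subset_Ici_self : Icc 0 c ⊆ Ici 0)
      fun_prop
    · intro r hr
      rw [interior_Icc] at hr
      have h1 := (hasDerivAt_const r g).fun_sub (hsol.du hr.1)
      have h2 := ((hasDerivAt_id' r).const_mul K).fun_neg.exp
      exact ((h1.fun_mul h2).congr_deriv (by ring)).hasDerivWithinAt
    · intro r hr
      rw [interior_Icc] at hr
      exact mul_nonpos_of_nonpos_of_nonneg (by linarith [hder r hr]) (Real.exp_pos _).le
  have h1 := hG ⟨le_rfl, hc.1.le⟩ ⟨hc.1.le, le_rfl⟩ hc.1.le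
  simp only [huc, mul_zero, neg_zero, Real.exp_zero, mul_one] at h1
  rw [Real.exp_neg, ← div_eq_mul_inv, div_le_iff₀ (Real.exp_pos _)] at h1
  have h2 : Real.exp (K * c) ≤ Real.exp (K * M) := by
    have := hc.2
    gcongr
  have h3 := mul_le_mul_of_nonneg_left h2 (by linarith : 0 ≤ g - u 0)
  linarith

theorem Shape.exists_hasBoundState_of_finite (hs : Shape f βm βp) (hm : 1 < m) (hd : 1 ≤ d)
    {g L₀ x : ℝ} (hlev : ∀ a, βp < a → a < g → ∃ b, Level f βm βp b a) (hL : 0 < L₀)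
    (hx : βp < x) (hxg : x < g) (hfL : ∀ s ∈ Ico x g, f s ≤ L₀ * (g - s) ^ (m - 1)) (k : ℕ) :
    ∃ b a, HasBoundState d k (m / (m - 1)) f b a := by
  have hq := one_lt_conj hm
  obtain ⟨b₀, h₀⟩ := hlev x hx hxg
  refine hs.exists_hasBoundState hq hd h₀ (fun M hM => ?_) k
  obtain ⟨ξ, hξ, hsmall⟩ := exists_pos_mul_lt
    (A := Real.exp ((L₀ * M) ^ (m / (m - 1) - 1) * M)) (B := g - x) (Real.exp_pos _) (by linarith)
  have hξx : ξ < g - x := by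
    refine lt_of_le_of_lt ?_ hsmall
    exact le_mul_of_one_le_right hξ.le (Real.one_le_exp (by positivity))
  -- Starting at distance ξ from g, the solution is still above x at time M, so its energy there is
  -- at least F(x).
  obtain ⟨b, h⟩ := hlev (g - ξ) (by linarith) (by linarith)
  refine ⟨b, g - ξ, h, fun u w hsol hu0 hr => ?_⟩
  have hxM : x < u M := by
    refine hsol.lt_of_close hm hL.le hM.le (fun s hs => ?_) (fun s hs => ?_)
      (by linarith : u 0 < g) (by linarith) (fun r h0 => ?_) ?_
    · rw [hu0] at hs
      exact (h.pos s ⟨by linarith [hs.1], hs.2⟩).le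
    · rw [hu0] at hs
      exact hfL s ⟨hs.1, by linarith [hs.2]⟩
    · rw [hu0]
      exact (hr r h0).2
    · rw [hu0]
      simpa using hsmall
  have h1 := h.strictMonoOn hs.cont ⟨hx.le, hxM.le.trans (hr M hM.le).2⟩
    ⟨(hx.trans hxM).le, (hr M hM.le).2⟩ hxM
  have h2 := primitive_phi_nonneg hq (w M)
  rw [energy]
  linarith

/-- The Pohozaev functional. -/
noncomputable def pohozaev (d : ℕ) (m : ℝ) (f u w : ℝ → ℝ) (r : ℝ) : ℝ :=
  r ^ (d + 1) * energy (phi (m / (m - 1))) f u w r + ((d : ℝ) + 1 - m) / m * (r ^ d * w r * u r)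

/-- The coefficient (N-m)/m in the functional is the one that cancels all terms in |w|^q and leaves
only Q(u). -/
theorem IsGlobalSol.hasDerivAt_pohozaev (hm : 1 < m) (hf : Continuous f)
    (hsol : IsGlobalSol d (phi (m / (m - 1))) f u w) {r : ℝ} (hr : 0 < r) :
    HasDerivAt (pohozaev d m f u w) (r ^ d * (pohozaevQ (d + 1) m f (u r) / m)) r := by
  have hq := one_lt_conj hm
  have h1 : HasDerivAt (fun r : ℝ => r ^ (d + 1)) (((d : ℝ) + 1) * r ^ d) r := by
    simpa using (hasDerivAt_id' r).fun_pow (d + 1)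
  have h2 := hsol.dI (continuous_phi hq) hf hr
  have h3 : HasDerivAt (fun t => t ^ d * w t) (-(r ^ d * f (u r))) r := by
    simpa using (hsol (r + 1)).hasDerivAt_weighted le_rfl (r := r) ⟨hr, by linarith⟩
  have h4 := (h1.fun_mul h2).fun_add ((h3.fun_mul (hsol.du hr)).const_mul (((d : ℝ) + 1 - m) / m))
  refine h4.congr_deriv ?_
  rw [energy, primitive_phi hq, ← mul_phi hq, pohozaevQ]
  have hm0 : m ≠ 0 := by linarith
  have hm1 : m - 1 ≠ 0 := by linarith
  push_cast
  field_simp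
  ring

theorem IsGlobalSol.pohozaev_sub_ge (hm : 1 < m) (hf : Continuous f)
    (hsol : IsGlobalSol d (phi (m / (m - 1))) f u w) {x y κ : ℝ} (hx : 0 ≤ x) (hxy : x ≤ y)
    (hκ : ∀ r ∈ Ioo x y, κ ≤ pohozaevQ (d + 1) m f (u r)) :
    κ / (m * ((d : ℝ) + 1)) * (y ^ (d + 1) - x ^ (d + 1)) ≤
      pohozaev d m f u w y - pohozaev d m f u w x := by
  have hq := one_lt_conj hm
  have hm0 : m ≠ 0 := by linarith
  have hd : (d : ℝ) + 1 ≠ 0 := by positivity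
  have hmono : MonotoneOn (fun r => pohozaev d m f u w r -
      κ / (m * ((d : ℝ) + 1)) * r ^ (d + 1)) (Icc x y) := by
    refine monotoneOn_of_hasDerivWithinAt_nonneg (convex_Icc x y)
      (f' := fun r => r ^ d * (pohozaevQ (d + 1) m f (u r) / m) - r ^ d * (κ / m)) ?_ ?_ ?_
    · have hsub : Icc x y ⊆ Ici 0 := Icc_subset_Ici_self.trans (Ici_subset_Ici.2 hx)
      have h1 := (hsol.contI (continuous_phi hq) hf).mono hsub
      have h2 := hsol.contu.mono hsub
      have h3 := hsol.contw.mono hsub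
      unfold pohozaev
      fun_prop
    · intro r hr
      rw [interior_Icc] at hr
      have h1 : HasDerivAt (fun r : ℝ => r ^ (d + 1)) (((d : ℝ) + 1) * r ^ d) r := by
        simpa using (hasDerivAt_id' r).fun_pow (d + 1)
      refine ((hsol.hasDerivAt_pohozaev hm hf (hx.trans_lt hr.1)).fun_sub
        (h1.const_mul (κ / (m * ((d : ℝ) + 1))))).congr_deriv ?_ |>.hasDerivWithinAt
      field_simp
    · intro r hr
      rw [interior_Icc] at hr
      have h1 : 0 < r := hx.trans_lt hr.1
      have h2 : κ / m ≤ pohozaevQ (d + 1) m f (u r) / m :=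
        div_le_div_of_nonneg_right (hκ r hr) (by linarith)
      have := mul_le_mul_of_nonneg_left h2 (pow_pos h1 d).le
      linarith
  have := hmono ⟨le_rfl, hxy⟩ ⟨hxy, le_rfl⟩ hxy
  simp only at this
  linarith

/-- A lower bound for the time that a solution needs to descend from `a` to `θ a`. -/
theorem IsGlobalSol.descent_time (hm : 1 < m) (hsol : IsGlobalSol d (phi (m / (m - 1))) f u w)
    {θ t c : ℝ} (hθ : θ < 1) (ha : 0 < a) (hc : 0 < c) (ht : 0 < t) (hu0 : u 0 = a)
    (hut : u t = θ * a) (hf : ∀ r ∈ Ioo 0 t, f (u r) ≤ c) {p : ℝ} (hp : 0 < p) :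
    (1 - θ) ^ ((m - 1) * (p / m)) * (phi m a / c) ^ (p / m) ≤ t ^ p := by
  have hq := one_lt_conj hm
  set e := m / (m - 1) - 1 with he
  have hm1 : 0 < m - 1 := by linarith
  have hm0 : 0 < m := by linarith
  have hmono : MonotoneOn (fun r => u r + (c * t) ^ e * r) (Icc 0 t) := by
    refine monotoneOn_of_hasDerivWithinAt_nonneg (convex_Icc 0 t)
      (f' := fun r => phi (m / (m - 1)) (w r) + (c * t) ^ e * 1) ?_ ?_ ?_
    · have := hsol.contu.mono (Icc_subset_Ici_self : Icc 0 t ⊆ Ici 0)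
      fun_prop
    · intro r hr
      rw [interior_Icc] at hr
      exact ((hsol.du hr.1).fun_add ((hasDerivAt_id' r).const_mul _)).hasDerivWithinAt
    · intro r hr
      rw [interior_Icc] at hr
      have h1 := (hsol r).neg_mul_le le_rfl ⟨hr.1.le, le_rfl⟩ hc.le fun s hs =>
        hf s ⟨hs.1, hs.2.trans hr.2⟩
      have h2 : -(c * t) ≤ w r := by
        have := mul_le_mul_of_nonneg_left hr.2.le hc.le
        linarith
      have h3 := monotone_phi hq h2
      rw [phi_neg, phi_of_nonneg hq (by positivity)] at h3
      linarith
  have h1 := hmono ⟨le_rfl, ht.le⟩ ⟨ht.le, le_rfl⟩ ht.le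
  simp only [hu0, hut, mul_zero, add_zero] at h1
  have h2 : (1 - θ) * a ≤ (c * t) ^ e * t := by linarith
  have h0 : 0 < 1 - θ := by linarith
  -- This exponent turns (c t)^(1/(m-1)) t into c^(p/m) t^p, which with p = N matches the growth
  -- hypothesis.
  have h3 : ((1 - θ) * a) ^ ((m - 1) * (p / m)) ≤ ((c * t) ^ e * t) ^ ((m - 1) * (p / m)) :=
    Real.rpow_le_rpow (by positivity) h2 (by positivity)
  have h4 : ((c * t) ^ e * t) ^ ((m - 1) * (p / m)) = c ^ (p / m) * t ^ p := by
    have e1 : e * ((m - 1) * (p / m)) = p / m := by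
      have := conj_exponent hm
      rw [← mul_assoc, mul_comm e, this, one_mul]
    rw [Real.mul_rpow (by positivity) ht.le, ← Real.rpow_mul (by positivity), e1,
      Real.mul_rpow hc.le ht.le, mul_assoc, ← Real.rpow_add ht]
    congr 2
    field_simp
    ring
  rw [h4, Real.mul_rpow h0.le ha.le, Real.rpow_mul ha.le] at h3
  rw [phi_of_nonneg hm ha.le, Real.div_rpow (by positivity) hc.le, mul_div_assoc',
    div_le_iff₀ (by positivity)]
  linarith

theorem continuous_pohozaevQ (hf : Continuous f) (N : ℕ) (m : ℝ) :
    Continuous (pohozaevQ N m f) := by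
  have := continuous_primitive hf
  unfold pohozaevQ
  fun_prop

theorem exists_lower_bound_of_nonneg {Q : ℝ → ℝ} (hQ : Continuous Q) {x y : ℝ}
    (hx : ∀ s ≤ x, 0 ≤ Q s) (hy : ∀ s ≥ y, 0 ≤ Q s) : ∃ C ≥ 0, ∀ s, -C ≤ Q s := by
  obtain ⟨C, hC⟩ := (isCompact_Icc (a := x) (b := y)).exists_bound_of_continuousOn hQ.continuousOn
  refine ⟨max C 0, le_max_right _ _, fun s => ?_⟩
  have h1 := le_max_left C 0
  have h2 := le_max_right C 0
  rcases le_or_gt s x with h | h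
  · linarith [hx s h]
  rcases le_or_gt y s with h' | h'
  · linarith [hy s h']
  have := hC s ⟨h.le, h'.le⟩
  rw [Real.norm_eq_abs] at this
  linarith [(abs_le.1 this).1]

/-- Below a given level of the energy the Pohozaev functional is bounded. -/
theorem Shape.exists_pohozaev_le (hs : Shape f βm βp) (hm : 1 < m) (hN : m ≤ (d : ℝ) + 1)
    {b₀ a₀ M : ℝ} (h₀ : Level f βm βp b₀ a₀) (hM : 0 ≤ M) : ∃ B, ∀ b a, Level f βm βp b a →
      ∀ u w : ℝ → ℝ, u M ∈ Icc b a → energy (phi (m / (m - 1))) f u w M < primitive f a₀ →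
      pohozaev d m f u w M ≤ B := by
  have hq := one_lt_conj hm
  obtain ⟨C, hC⟩ := (isCompact_Icc (a := b₀) (b := a₀)).exists_bound_of_continuousOn
    (continuous_primitive hs.cont).continuousOn
  obtain ⟨V, hV, hVw⟩ := exists_abs_le_of_rpow_le hq (primitive f a₀ + C)
  refine ⟨M ^ (d + 1) * primitive f a₀ + ((d : ℝ) + 1 - m) / m * (M ^ d * V * max (-b₀) a₀),
    fun b a h u w hu hI => ?_⟩
  have h1 := primitive_phi_nonneg hq (w M)
  have hI' := hI
  rw [energy] at hI'
  have hu' := h.mem_Icc_of_le h₀ hs.cont hu (by linarith)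
  have h2 := (abs_le.1 ((Real.norm_eq_abs _).symm.le.trans (hC _ hu'))).1
  have h3 := hVw (w M) (by rw [← primitive_phi hq]; linarith)
  have h4 : |u M| ≤ max (-b₀) a₀ :=
    abs_le.2 ⟨by linarith [hu'.1, le_max_left (-b₀) a₀], hu'.2.trans (le_max_right _ _)⟩
  have h5 : w M * u M ≤ V * max (-b₀) a₀ := by
    refine (le_abs_self _).trans ?_
    rw [abs_mul]
    exact mul_le_mul h3 h4 (abs_nonneg _) hV.le
  have h6 : 0 ≤ ((d : ℝ) + 1 - m) / m := div_nonneg (by linarith) (by linarith)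
  rw [pohozaev]
  gcongr ?_ + ((d : ℝ) + 1 - m) / m * ?_
  · gcongr
  · rw [mul_assoc, mul_assoc]
    gcongr

/-- If the energy at M were below the reference level, the Pohozaev functional at M would be at most
B. But during the descent from a to θ a it gains at least c times the infimum in the growth
hypothesis, and it loses only a bounded amount afterwards. For large a this is impossible. -/
theorem Shape.exists_hasBoundState_of_infinite (hs : Shape f βm βp) (hm : 1 < m) (hd : 1 ≤ d)
    (hN : m ≤ (d : ℝ) + 1) (hlev : ∀ a, βp < a → ∃ b, Level f βm βp b a) {x y θ : ℝ}
    (hx : ∀ s ≤ x, 0 ≤ pohozaevQ (d + 1) m f s) (hy : ∀ s ≥ y, 0 ≤ pohozaevQ (d + 1) m f s)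
    (hθ : θ ∈ Ioo (0 : ℝ) 1)
    (hlim : Tendsto (fun s : ℝ => sInf ((fun p : ℝ × ℝ =>
          pohozaevQ (d + 1) m f p.2 * (phi m s / f p.1) ^ (((d + 1 : ℕ) : ℝ) / m)) ''
        (Icc (θ * s) s ×ˢ Icc (θ * s) s))) atTop atTop) (k : ℕ) :
    ∃ b a, HasBoundState d k (m / (m - 1)) f b a := by
  have hq := one_lt_conj hm
  have hm0 : 0 < m := by linarith
  have hm1 : 0 < m - 1 := by linarith
  have hβp := hs.betaPlus_pos
  have hQc := continuous_pohozaevQ hs.cont (d + 1) m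
  obtain ⟨CQ, hCQ, hQ⟩ := exists_lower_bound_of_nonneg hQc hx hy
  obtain ⟨b₀, h₀⟩ := hlev (βp + 1) (by linarith)
  refine hs.exists_hasBoundState hq hd h₀ (fun M hM => ?_) k
  obtain ⟨B, hB⟩ := hs.exists_pohozaev_le (d := d) hm hN h₀ hM.le
  set p : ℝ := ((d + 1 : ℕ) : ℝ) with hp
  have hpd : p = (d : ℝ) + 1 := by rw [hp]; push_cast; ring
  have hp0 : 0 < p := by rw [hp]; positivity
  have hθ1 : 0 < 1 - θ := by linarith [hθ.2]
  set c := (1 - θ) ^ ((m - 1) * (p / m)) / (m * p) with hc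
  have hc0 : 0 < c := by positivity
  have hθlim : Tendsto (fun s => θ * s) atTop atTop := tendsto_id.const_mul_atTop hθ.1
  obtain ⟨a, haS, hay, haβ⟩ := (((hlim.const_mul_atTop hc0).eventually_gt_atTop
    (B + CQ / (m * p) * M ^ (d + 1))).and ((hθlim.eventually_ge_atTop y).and
    (hθlim.eventually_ge_atTop (βp + 1)))).exists
  have ha0 : 0 < a := by
    by_contra hcon
    have := mul_nonpos_of_nonneg_of_nonpos hθ.1.le (not_lt.1 hcon)
    linarith
  have hθa : θ * a < a := by nlinarith [hθ.2]
  obtain ⟨b, h⟩ := hlev a (by linarith)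
  refine ⟨b, a, h, fun u w hsol hu0 hr => ?_⟩
  by_contra hcon
  have hI := not_le.1 hcon
  have hPM := hB b a h u w (hr M hM.le) hI
  -- Otherwise u(M) ≥ θ a ≥ βp + 1, and F(u(M)) alone would reach the reference level.
  have huM : u M < θ * a := by
    by_contra hge
    have h1 := (h.strictMonoOn hs.cont).monotoneOn ⟨by linarith, by linarith⟩
      ⟨by linarith, (hr M hM.le).2⟩ (haβ.trans (not_lt.1 hge))
    have h2 := primitive_phi_nonneg hq (w M)
    rw [energy] at hI
    linarith
  obtain ⟨t, ht, hut, htr⟩ := exists_first_zero (g := fun r => θ * a - u r) hM.le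
    (continuousOn_const.sub (hsol.contu.mono Icc_subset_Ici_self)) (by linarith) (by linarith)
  have hrange : ∀ r ∈ Ioo 0 t, u r ∈ Icc (θ * a) a := fun r hr' =>
    ⟨by linarith [htr r ⟨hr'.1.le, hr'.2⟩], (hr r hr'.1.le).2⟩
  have hne : (Icc (θ * a) a).Nonempty := nonempty_Icc.2 hθa.le
  obtain ⟨s₁, hs₁, hmax⟩ := isCompact_Icc.exists_isMaxOn hne hs.cont.continuousOn
  obtain ⟨s₂, hs₂, hmin⟩ := isCompact_Icc.exists_isMinOn hne hQc.continuousOn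
  have hfpos : ∀ s ∈ Icc (θ * a) a, 0 < f s := fun s hs' => h.pos s ⟨by linarith [hs'.1], hs'.2⟩
  have hQpos : ∀ s ∈ Icc (θ * a) a, 0 ≤ pohozaevQ (d + 1) m f s := fun s hs' =>
    hy s (hay.trans hs'.1)
  have htime := hsol.descent_time hm hθ.2 ha0 (hfpos s₁ hs₁) ht.1 hu0 (by linarith)
    (fun r hr' => isMaxOn_iff.1 hmax _ (hrange r hr')) hp0
  rw [hp, Real.rpow_natCast, ← hp] at htime
  have hP1 := hsol.pohozaev_sub_ge hm hs.cont le_rfl ht.1.le fun r hr' =>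
    isMinOn_iff.1 hmin _ (hrange r hr')
  -- From t to M the solution may go anywhere, including far negative values, so only the global
  -- lower bound -CQ for Q is available.
  have hP2 := hsol.pohozaev_sub_ge hm hs.cont ht.1.le ht.2 (κ := -CQ) fun r _ => hQ _
  rw [← hpd] at hP1 hP2
  have hP0 : pohozaev d m f u w 0 = 0 := by simp [pohozaev, hsol.w0]
  rw [hP0, zero_pow (Nat.succ_ne_zero d), sub_zero, sub_zero] at hP1
  have hinf : sInf ((fun p' : ℝ × ℝ => pohozaevQ (d + 1) m f p'.2 * (phi m a / f p'.1) ^ (p / m)) ''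
      (Icc (θ * a) a ×ˢ Icc (θ * a) a)) ≤
      pohozaevQ (d + 1) m f s₂ * (phi m a / f s₁) ^ (p / m) := by
    refine csInf_le ⟨0, ?_⟩ ⟨(s₁, s₂), ⟨hs₁, hs₂⟩, rfl⟩
    rintro _ ⟨⟨x₁, x₂⟩, ⟨h1, h2⟩, rfl⟩
    have h3 := hQpos x₂ h2
    have h4 := hfpos x₁ h1
    have h5 := phi_pos hm ha0
    positivity
  have hQs₂ := hQpos s₂ hs₂
  have h1 : c * (pohozaevQ (d + 1) m f s₂ * (phi m a / f s₁) ^ (p / m)) ≤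
      pohozaevQ (d + 1) m f s₂ / (m * p) * t ^ (d + 1) := by
    calc _ = pohozaevQ (d + 1) m f s₂ / (m * p) *
          ((1 - θ) ^ ((m - 1) * (p / m)) * (phi m a / f s₁) ^ (p / m)) := by rw [hc]; ring
      _ ≤ _ := by gcongr
  have h2 := mul_le_mul_of_nonneg_left hinf hc0.le
  have h3 : -(CQ / (m * p) * M ^ (d + 1)) ≤ -CQ / (m * p) * (M ^ (d + 1) - t ^ (d + 1)) := by
    have h4 : 0 ≤ CQ / (m * p) * t ^ (d + 1) := by have := ht.1; positivity
    rw [neg_div]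
    linarith
  linarith

end RadialBoundState

/-! ### Levels from the sign condition, and conclusion. -/

namespace RadialBoundState

variable {βm βp : ℝ} {f : ℝ → ℝ}

theorem eventually_lt_of_common_limit {F : ℝ → ℝ} {l₁ l₂ : Filter ℝ} [NeBot l₁] {L : EReal}
    (h₁ : Tendsto (fun s => (F s : EReal)) l₁ (𝓝 L))
    (h₂ : Tendsto (fun s => (F s : EReal)) l₂ (𝓝 L)) {x x' : ℝ} (hx : x < x')
    (hev : ∀ᶠ s in l₁, x' ≤ F s) : ∀ᶠ s in l₂, x < F s := by
  have hL : (x' : EReal) ≤ L := ge_of_tendsto h₁ (hev.mono fun s hs => by exact_mod_cast hs)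
  have hxL : (x : EReal) < L := lt_of_lt_of_le (by exact_mod_cast hx) hL
  exact (h₂.eventually_const_lt hxL).mono fun s hs => by exact_mod_cast hs

theorem neBot_comap_nhdsGT {γ : EReal} (h : γ < ⊤) :
    NeBot (comap (fun s : ℝ => (s : EReal)) (𝓝[>] γ)) := by
  refine comap_neBot_iff.2 fun t ht => ?_
  obtain ⟨c, hc, hsub⟩ := (mem_nhdsGT_iff_exists_Ioo_subset' h).1 ht
  obtain ⟨s, h1, h2⟩ := EReal.lt_iff_exists_real_btwn.1 hc
  exact ⟨s, hsub ⟨h1, h2⟩⟩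

theorem neBot_comap_nhdsLT {γ : EReal} (h : ⊥ < γ) :
    NeBot (comap (fun s : ℝ => (s : EReal)) (𝓝[<] γ)) := by
  refine comap_neBot_iff.2 fun t ht => ?_
  obtain ⟨c, hc, hsub⟩ := (mem_nhdsLT_iff_exists_Ioo_subset' h).1 ht
  obtain ⟨s, h1, h2⟩ := EReal.lt_iff_exists_real_btwn.1 hc
  exact ⟨s, hsub ⟨h1, h2⟩⟩

theorem lt_gammaPlus (hf : Continuous f) (h : 0 < f βp) : (βp : EReal) < gammaPlus f βp := by
  obtain ⟨δ, hδ, hball⟩ := Metric.eventually_nhds_iff.1 (hf.continuousAt.eventually_const_lt h)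
  refine lt_of_lt_of_le (EReal.coe_lt_coe_iff.2 (by linarith : βp < βp + δ)) (le_sInf ?_)
  rintro _ ⟨s, ⟨hs, hs0⟩, rfl⟩
  by_contra hcon
  have hcon : s < βp + δ := EReal.coe_lt_coe_iff.1 (not_le.1 hcon)
  have := hball (y := s) (by rw [Real.dist_eq, abs_lt]; constructor <;> linarith)
  linarith

theorem gammaMinus_lt (hf : Continuous f) (h : f βm < 0) : gammaMinus f βm < (βm : EReal) := by
  obtain ⟨δ, hδ, hball⟩ := Metric.eventually_nhds_iff.1 (hf.continuousAt.eventually_lt_const h)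
  refine lt_of_le_of_lt (sSup_le ?_) (EReal.coe_lt_coe_iff.2 (by linarith : βm - δ < βm))
  rintro _ ⟨s, ⟨hs, hs0⟩, rfl⟩
  by_contra hcon
  have hcon : βm - δ < s := EReal.coe_lt_coe_iff.1 (not_le.1 hcon)
  have := hball (y := s) (by rw [Real.dist_eq, abs_lt]; constructor <;> linarith)
  linarith

namespace SignCondition

theorem shape (h : SignCondition f βm βp) (hf : Continuous f) : Shape f βm βp :=
  ⟨hf, h.betaMinus_neg, h.betaPlus_pos, h.primitive_neg, h.primitive_betaMinus,
    h.primitive_betaPlus⟩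

theorem pos (h : SignCondition f βm βp) {a : ℝ} (ha : (a : EReal) < gammaPlus f βp) :
    ∀ s ∈ Icc βp a, 0 < f s := by
  intro s hs
  rcases hs.1.eq_or_lt with rfl | h1
  · exact h.betaPlus_nondegenerate
  · exact h.pos_right s h1 (lt_of_le_of_lt (by exact_mod_cast hs.2) ha)

theorem neg (h : SignCondition f βm βp) {b : ℝ} (hb : gammaMinus f βm < (b : EReal)) :
    ∀ s ∈ Icc b βm, f s < 0 := by
  intro s hs
  rcases hs.2.eq_or_lt with rfl | h1
  · exact h.betaMinus_nondegenerate
  · exact h.neg_left s (lt_of_lt_of_le hb (by exact_mod_cast hs.1)) h1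

theorem primitive_lt_right (h : SignCondition f βm βp) (hf : Continuous f) {x y : ℝ}
    (hx : βp ≤ x) (hxy : x < y) (hy : (y : EReal) < gammaPlus f βp) :
    primitive f x < primitive f y := by
  refine strictMonoOn_of_deriv_pos (convex_Icc βp y) (continuous_primitive hf).continuousOn
    (fun s hs => ?_) ⟨hx, hxy.le⟩ ⟨hx.trans hxy.le, le_rfl⟩ hxy
  rw [(hasDerivAt_primitive hf s).deriv]
  exact h.pos hy s (interior_subset hs)

theorem primitive_lt_left (h : SignCondition f βm βp) (hf : Continuous f) {x y : ℝ}
    (hx : gammaMinus f βm < (x : EReal)) (hxy : x < y) (hy : y ≤ βm) :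
    primitive f y < primitive f x := by
  refine strictAntiOn_of_deriv_neg (convex_Icc x βm) (continuous_primitive hf).continuousOn
    (fun s hs => ?_) ⟨le_rfl, hxy.le.trans hy⟩ ⟨hxy.le, hy⟩ hxy
  rw [(hasDerivAt_primitive hf s).deriv]
  exact h.neg hx s (interior_subset hs)

theorem exists_level_of_right (h : SignCondition f βm βp) (hf : Continuous f) {a : ℝ}
    (ha : βp < a) (haγ : (a : EReal) < gammaPlus f βp) : ∃ b, Level f βm βp b a := by
  obtain ⟨L, hL₁, hL₂⟩ := h.equal_limits
  -- An intermediate point a' with F(a') > F(a) forces L > F(a), so F exceeds F(a) near γ⁻ and the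
  -- intermediate value theorem gives b.
  obtain ⟨a', h1, h2⟩ := EReal.lt_iff_exists_real_btwn.1 haγ
  have h1 : a < a' := by exact_mod_cast h1
  have hγ := gammaMinus_lt hf h.betaMinus_nondegenerate
  have := neBot_comap_nhdsGT (hγ.trans (EReal.coe_lt_top _))
  have := neBot_comap_nhdsLT ((EReal.bot_lt_coe _).trans haγ)
  have hev := eventually_lt_of_common_limit hL₂ hL₁ (h.primitive_lt_right hf ha.le h1 h2) (by
    filter_upwards [preimage_mem_comap (Ioo_mem_nhdsLT h2)] with s hs
    exact (h.primitive_lt_right hf (ha.trans h1).le (EReal.coe_lt_coe_iff.1 hs.1) hs.2).le)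
  obtain ⟨c, hc, hcγ⟩ := (hev.and (preimage_mem_comap (Ioo_mem_nhdsGT hγ))).exists
  have hcβ : c < βm := EReal.coe_lt_coe_iff.1 hcγ.2
  have hapos := h.primitive_lt_right hf le_rfl ha haγ
  rw [h.primitive_betaPlus] at hapos
  obtain ⟨b, hb, hbF⟩ := intermediate_value_Icc' hcβ.le (continuous_primitive hf).continuousOn
    ⟨h.primitive_betaMinus.trans_le hapos.le, hc.le⟩
  refine ⟨b, lt_of_le_of_ne hb.2 ?_, ha, h.pos haγ,
    h.neg (lt_of_lt_of_le hcγ.1 (EReal.coe_le_coe_iff.2 hb.1)), hbF⟩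
  rintro rfl
  rw [h.primitive_betaMinus] at hbF
  linarith

theorem exists_level_of_left (h : SignCondition f βm βp) (hf : Continuous f) {b : ℝ}
    (hb : b < βm) (hbγ : gammaMinus f βm < (b : EReal)) : ∃ a, Level f βm βp b a := by
  obtain ⟨L, hL₁, hL₂⟩ := h.equal_limits
  obtain ⟨b', h2, h1⟩ := EReal.lt_iff_exists_real_btwn.1 hbγ
  have h1 : b' < b := by exact_mod_cast h1
  have hγ := lt_gammaPlus hf h.betaPlus_nondegenerate
  have := neBot_comap_nhdsLT ((EReal.bot_lt_coe _).trans hγ)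
  have := neBot_comap_nhdsGT (hbγ.trans (EReal.coe_lt_top _))
  have hev := eventually_lt_of_common_limit hL₁ hL₂ (h.primitive_lt_left hf h2 h1 hb.le) (by
    filter_upwards [preimage_mem_comap (Ioo_mem_nhdsGT h2)] with s hs
    exact (h.primitive_lt_left hf hs.1 (EReal.coe_lt_coe_iff.1 hs.2) (h1.trans hb).le).le)
  obtain ⟨c, hc, hcγ⟩ := (hev.and (preimage_mem_comap (Ioo_mem_nhdsLT hγ))).exists
  have hcβ : βp < c := EReal.coe_lt_coe_iff.1 hcγ.1
  have hbpos := h.primitive_lt_left hf hbγ hb le_rfl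
  rw [h.primitive_betaMinus] at hbpos
  obtain ⟨a, ha, haF⟩ := intermediate_value_Icc hcβ.le (continuous_primitive hf).continuousOn
    ⟨h.primitive_betaPlus.trans_le hbpos.le, hc.le⟩
  refine ⟨a, hb, lt_of_le_of_ne ha.1 ?_,
    h.pos (lt_of_le_of_lt (EReal.coe_le_coe_iff.2 ha.2) hcγ.2), h.neg hbγ, haF.symm⟩
  rintro rfl
  rw [h.primitive_betaPlus] at haF
  linarith

/-- One finite end is enough, whatever the other end is, since the other side enters only through
the matching level; a finite γ⁻ is reflected to the right. The Pohozaev argument is used only when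
both ends are infinite, and then Q ≥ 0 is available at both. -/
theorem exists_hasBoundState {d k : ℕ} {m : ℝ} (h : SignCondition f βm βp) (hm : 1 < m)
    (hd : 1 ≤ d) (hN : m ≤ (d : ℝ) + 1) (hf : Continuous f)
    (h₃ : GrowthAtInfinity (d + 1) m f βm βp) (h₄ : BoundAtFiniteEnd m f βm βp) :
    ∃ b a, HasBoundState d k (m / (m - 1)) f b a := by
  have hs := h.shape hf
  have hγp := lt_gammaPlus hf h.betaPlus_nondegenerate
  have hγm := gammaMinus_lt hf h.betaMinus_nondegenerate
  induction hp : gammaPlus f βp with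
  | bot => simp [hp] at hγp
  | coe g =>
    obtain ⟨L₀, hL, x, hx, hxg, hle⟩ := h₄.plus g hp
    exact hs.exists_hasBoundState_of_finite hm hd (fun a h1 h2 =>
      h.exists_level_of_right hf h1 (by rw [hp]; exact_mod_cast h2)) hL hx hxg hle k
  | top =>
    induction hg : gammaMinus f βm with
    | top => simp [hg] at hγm
    | coe g =>
      obtain ⟨L₀, hL, x, hx, hxg, hle⟩ := h₄.minus g hg
      have hlev : ∀ a, -βm < a → a < -g → ∃ b, Level (reflect f) (-βp) (-βm) b a := by
        intro a h1 h2
        obtain ⟨a', hlev⟩ := h.exists_level_of_left hf (b := -a) (by linarith)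
          (by rw [hg]; exact EReal.coe_lt_coe_iff.2 (by linarith))
        refine ⟨-a', ?_⟩
        simpa using hlev.reflect
      have hle' : ∀ s ∈ Ico x (-g), reflect f s ≤ L₀ * (-g - s) ^ (m - 1) := by
        intro s hs'
        have := hle (-s) ⟨by linarith [hs'.2], by linarith [hs'.1]⟩
        rwa [show -s - g = -g - s by ring] at this
      obtain ⟨b, a, hb⟩ := hs.reflect.exists_hasBoundState_of_finite hm hd hlev hL hx
        (by linarith) hle' k
      exact ⟨_, _, hb.reflect⟩
    | bot =>
      obtain ⟨y, -, hy⟩ := h₃.plus_nonneg hp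
      obtain ⟨x, -, hx⟩ := h₃.minus_nonneg hg
      obtain ⟨θ, hθ, hlim⟩ := h₃.plus_limit hp
      exact hs.exists_hasBoundState_of_infinite hm hd hN (fun a h1 =>
        h.exists_level_of_right hf h1 (by rw [hp]; exact EReal.coe_lt_top a)) hx hy hθ hlim k

end SignCondition

end RadialBoundState

theorem theorem1p1 (N : ℕ) (m : ℝ) (hm : 1 < m) (hN : m ≤ (N : ℝ))
    (f : ℝ → ℝ) (βm βp : ℝ)
    (hf1 : Continuous f)
    (hf2 : RadialBoundState.SignCondition f βm βp)
    (hf3 : RadialBoundState.GrowthAtInfinity N m f βm βp)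
    (hf4 : RadialBoundState.BoundAtFiniteEnd m f βm βp)
    (k : ℕ) :
    ∃ u : ℝ → ℝ, RadialBoundState.IsBoundState N m f u ∧
      RadialBoundState.HasExactlyZeros k u := by
  have hN1 : 1 < N := by exact_mod_cast hm.trans_le hN
  obtain ⟨d, rfl⟩ : ∃ d, N = d + 1 := ⟨N - 1, by omega⟩
  obtain ⟨b, a, h⟩ := hf2.exists_hasBoundState (k := k) hm (by omega : 1 ≤ d)
    (by exact_mod_cast hN) hf1 hf3 hf4
  exact h.exists_isBoundState hm hf1
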